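/- **Setting.** Let $\Theta\subset\mathbb R^d$ be open, $\lambda$ a measure on a measurable space $\mathcal X$, and $(\varphi_\theta)_{\theta\in\Theta}$ probability densities with respect to $\lambda$ such that $P_\theta=\varphi_\theta\,d\lambda$ is a Markov kernel; let $\varphi_{\theta_0}$, $\theta_0\in\Theta$, be the reference density and $w_x(\theta)=\varphi_{\theta_0}(x)/\varphi_\theta(x)$. Let $H:\mathcal X\times\Theta\to\mathbb R^d$ be measurable, with mean field $h(\theta)=\int H(x,\theta)\,P_\theta(dx)$, all these integrals being well defined. Let $(\mathcal K_j)_{j\ge 0}$ be compact sets with $\Theta=\bigcup_j\mathcal K_j$ and $\mathcal K_j\subset\operatorname{int}\mathcal K_{j+1}$, let $\bar\Theta=\Theta\cup\{\theta_c\}$ with an isolated cemetery point $\theta_c$, let $\Phi:\mathcal X\times\bar\Theta\to\mathcal X_0\times\mathcal K_0$ be measurable, where $\mathcal X_0\subset\mathcal X$, and let $\phi:\mathbb N\to\mathbb Z$ satisfy $\phi(n)>-n$. Let $\gamma=(\gamma_n)_{n\ge0}$, $\epsilon=(\epsilon_n)_{n\ge0}$ be positive nonincreasing sequences with $\gamma_n\to0$.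 For $a\ge 0$ the kernel $Q_a$ on $\mathcal X\times\bar\Theta$ draws, from $(x,\theta)$ with $\theta\in\Theta$, a point $y\sim P_\theta$ and moves to $(y,\theta+aH(y,\theta))$, with second component $\theta_c$ if $\theta+aH(y,\theta)\notin\Theta$; the points $(x,\theta_c)$ are absorbing. $\mathbb P^\gamma_{x,\theta}$ is the law of the Markov chain $(X_{n+1},\theta_{n+1})\sim Q_{\gamma_{n+1}}(X_n,\theta_n;\cdot)$ started at $(X_0,\theta_0)=(x,\theta)$. **Algorithm with adaptive truncation.** The Markov chain $(X_n,\theta_n,\kappa_n,\nu_n,\zeta_n)$ starts at an arbitrary point of $\mathcal X\times\Theta$ with $\kappa_0=\nu_0=\zeta_0=0$; write $\mathbb P$ for its law. In step $n+1$, put $(x,\theta)=\Phi(X_n,\theta_n)$ if $\nu_n=0$ and $(x,\theta)=(X_n,\theta_n)$ otherwise, and draw $(X_{n+1},\theta_{n+1})\sim Q_{\gamma_{\zeta_n}}(x,\theta;\cdot)$. If $\theta_{n+1}\in\mathcal K_{\kappa_n}$ and $\|\theta_{n+1}-\theta\|\le\epsilon_{\zeta_n}$, set $\kappa_{n+1}=\kappa_n$,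 $\nu_{n+1}=\nu_n+1$, $\zeta_{n+1}=\zeta_n+1$; otherwise (truncation) set $\kappa_{n+1}=\kappa_n+1$, $\nu_{n+1}=0$, $\zeta_{n+1}=\zeta_n+\phi(\nu_n)$. **The quantity $A$.** For $\mathcal K\subset\Theta$ let $\sigma(\mathcal K)=\inf\{k\ge1:\theta_k\notin\mathcal K\}$, $\nu(\epsilon)=\inf\{k\ge1:\|\theta_k-\theta_{k-1}\|\ge\epsilon_k\}$, $$S_{1,n}(\gamma,\epsilon,\mathcal K)=\mathbf 1_{\{\sigma(\mathcal K)\wedge\nu(\epsilon)\ge n\}}\sum_{k=1}^n\gamma_k\bigl(H(X_k,\theta_{k-1})-h(\theta_{k-1})\bigr).$$ For a function $w$ let $\mathcal W_M=\{\theta\in\Theta:w(\theta)\le M\}$, and put $$A(\delta,M,\gamma,\epsilon)=\sup_{(x,\theta)\in\mathcal X\times\bar\Theta}\Bigl\{\mathbb P^\gamma_{\Phi(x,\theta)}\Bigl(\sup_{n\ge1}\|S_{1,n}(\gamma,\epsilon,\mathcal W_M)\|>\delta\Bigr)+\mathbb P^\gamma_{\Phi(x,\theta)}\bigl(\nu(\epsilon)<\sigma(\mathcal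 W_M)\bigr)\Bigr\}.$$ Write $\mathbf a^{\leftarrow k}=(a_{l+k})_l$. **Lyapunov condition.** $h$ is continuous and there are a $C^1$ function $w:\Theta\to[0,\infty)$ and $0<M_0<M_1<\infty$ such that, with $\mathcal L=\{\theta\in\Theta:\langle h(\theta),\nabla w(\theta)\rangle=0\}$: $\mathcal L\subset\{w<M_0\}$; $\mathcal W_{M_1}$ is compact; $\langle h,\nabla w\rangle<0$ on $\Theta\setminus\mathcal L$; the closure of $w(\mathcal L)$ has empty interior. Moreover $\mathcal K_0\subset\mathcal W_{M_0}$. **Proposition 4.1.** Assume the Lyapunov condition. (a) For every $M\in(M_0,M_1)$ there is $\delta_0>0$ such that for every $n$ there are $n_0$ and $C>0$ with, for all $j>n_0$ (and all starting points), $$\mathbb P\Bigl(\sup_{k\ge1}\kappa_k\ge j\Bigr)\le C\Bigl(\sup_{k\ge n}A(\delta_0,M,\gamma^{\leftarrow k},\epsilon^{\leftarrow k})\Bigr)^j.\tag{4.58}$$ Assume in addition that $\epsilon_n\to0$, that for some $p>1$ one has $\sum_n\gamma_n=\infty$ and $\sum_n(\gamma_n^2+(\gamma_n/\epsilon_n)^p)<\infty$,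 and that there is $W\in L_p(P_{\theta_0})$ such that for every compact $\mathcal K\subset\Theta$ there is $C_{\mathcal K}<\infty$ with $\|H(x,\theta)\|^p\le C_{\mathcal K}\,w_x(\theta)|W(x)|^p$ for all $x\in\mathcal X$, $\theta\in\mathcal K$ (read after multiplication by $\varphi_\theta(x)$). Then: (b) For every $M\in[M_0,M_1)$ and every $n$ there are $n_0$, $\delta_0>0$ and $C>0$ such that (4.58) holds for all $j>n_0$ (and all starting points). (c) For every $M\in[M_0,M_1)$ and $\delta>0$, $\lim_{k\to\infty}A(\delta,M,\gamma^{\leftarrow k},\epsilon^{\leftarrow k})=0$. (d) Almost surely the distance from $\theta_n$ to $\mathcal L$ tends to $0$; in particular, if $\mathcal L=\{\theta^*\}$, then $\theta_n\to\theta^*$ almost surely. (e) Almost surely $\theta_j\in\mathcal K_{\kappa_n}$ for all $j\le n$ with $\nu_j\ne0$, and for every $\rho\in(0,1)$ there is a constant $C(\rho)$ (not depending on the starting point) such that $\mathbb P(\sup_{k\ge1}\kappa_k\ge j)\le C(\rho)\rho^j$ for all $j\in\mathbb N$. -/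

import Mathlib

open MeasureTheory ProbabilityTheory Filter Topology
open scoped ENNReal NNReal RealInnerProductSpace

noncomputable section

namespace AdaptiveTruncation

/-! ### The parameter space with a cemetery point -/

/-- `Θ̄ = Θ ∪ {θ_c}`: the parameter space together with an isolated cemetery point `Sum.inr ()`. -/
abbrev Bar {d : ℕ} (Θ : Set (EuclideanSpace ℝ (Fin d))) : Type := Θ ⊕ Unit

/-- A function on `α × (β ⊕ β')` is measurable as soon as it is so on both pieces. -/
theorem measurable_prod_sum {α β β' δ : Type*} [MeasurableSpace α] [MeasurableSpace β]
    [MeasurableSpace β'] [MeasurableSpace δ] {f : α × (β ⊕ β') → δ}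
    (hl : Measurable fun q : α × β => f (q.1, Sum.inl q.2))
    (hr : Measurable fun q : α × β' => f (q.1, Sum.inr q.2)) : Measurable f := by
  have h : Measurable (f ∘ (MeasurableEquiv.prodSumDistrib α β β').symm) :=
    measurable_fun_sum hl hr
  have h2 := h.comp (MeasurableEquiv.prodSumDistrib α β β').measurable
  have h3 : (f ∘ (MeasurableEquiv.prodSumDistrib α β β').symm) ∘
      (MeasurableEquiv.prodSumDistrib α β β') = f := by
    funext q; simp
  rwa [h3] at h2

/-! ### Laws of Markov chains on the path space -/

/-- The law on `Z^ℕ` of the Markov chain started at `z` whose transition from time `n` to time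
`n + 1` is `T n` (Ionescu-Tulcea). -/
def chainLaw {Z : Type*} [MeasurableSpace Z] (T : ℕ → Kernel Z Z) [∀ n, IsMarkovKernel (T n)]
    (z : Z) : Measure (ℕ → Z) :=
  Kernel.traj (X := fun _ => Z)
    (fun n => (T n).comap (fun x : (Π _ : Finset.Iic n, Z) => x ⟨n, Finset.mem_Iic.2 le_rfl⟩)
      (measurable_pi_apply _)) 0 (fun _ => z)

/-! ### The data of the algorithm -/

/-- The data of the stochastic approximation scheme on the parameter set `Θ ⊆ ℝ^d`. -/
structure Scheme (𝒳 : Type*) [MeasurableSpace 𝒳] {d : ℕ}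
    (Θ : Set (EuclideanSpace ℝ (Fin d))) where
  isOpen : IsOpen Θ
  /-- the reference measure `λ` on the sample space -/
  lam : Measure 𝒳
  /-- the densities `φ_θ` with respect to `λ` -/
  dens : Θ → 𝒳 → ℝ
  dens_nonneg : ∀ θ x, 0 ≤ dens θ x
  dens_measurable : ∀ θ, Measurable (dens θ)
  /-- the parameter of the reference density -/
  θref : Θ
  /-- the sampling kernel `θ ↦ P_θ`, where `P_θ = φ_θ dλ` is a probability measure -/
  P : Kernel Θ 𝒳
  P_eq : ∀ θ, P θ = lam.withDensity fun x => ENNReal.ofReal (dens θ x)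
  P_markov : IsMarkovKernel P
  /-- the map generating the stochastic vector field -/
  H : 𝒳 → Θ → EuclideanSpace ℝ (Fin d)
  H_measurable : Measurable fun q : 𝒳 × Θ => H q.1 q.2
  /-- the compact exhaustion of `Θ` (compactness and interior are the same in `Θ` and in `ℝ^d`,
  since `Θ` is open) -/
  K : ℕ → Set Θ
  K_compact : ∀ j, IsCompact (K j)
  K_subset : ∀ j, K j ⊆ interior (K (j + 1))
  K_union : ⋃ j, K j = Set.univ
  /-- the set of sample points from which the scheme is re-initialized -/
  𝒳₀ : Set 𝒳
  /-- the re-initialization map; it is also applied after a jump to the cemetery point -/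
  Φ : 𝒳 × Bar Θ → 𝒳 × Θ
  Φ_measurable : Measurable Φ
  Φ_mem : ∀ q, Φ q ∈ 𝒳₀ ×ˢ K 0
  /-- the rule shifting the index into the step sequences at a truncation -/
  φ : ℕ → ℤ
  φ_gt : ∀ n : ℕ, -(n : ℤ) < φ n

namespace Scheme

variable {𝒳 : Type*} [MeasurableSpace 𝒳] {d : ℕ} {Θ : Set (EuclideanSpace ℝ (Fin d))}

instance (S : Scheme 𝒳 Θ) : IsMarkovKernel S.P := S.P_markov

/-- The mean field `h(θ) = ∫ H(x, θ) P_θ(dx)`. -/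
def h (S : Scheme 𝒳 Θ) (θ : Θ) : EuclideanSpace ℝ (Fin d) := ∫ x, S.H x θ ∂(S.P θ)

open Classical in
/-- The update `θ + a H(y, θ)`, replaced by the cemetery point if it is not in `Θ`; the cemetery
point is absorbing. -/
def move (S : Scheme 𝒳 Θ) (a : ℝ) (y : 𝒳) : Bar Θ → Bar Θ
  | Sum.inl θ => if hmem : (θ : EuclideanSpace ℝ (Fin d)) + a • S.H y θ ∈ Θ
      then Sum.inl ⟨_, hmem⟩ else Sum.inr ()
  | Sum.inr u => Sum.inr u

theorem measurable_move (S : Scheme 𝒳 Θ) :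
    Measurable fun q : (ℝ × 𝒳) × Bar Θ => S.move q.1.1 q.1.2 q.2 := by
  classical
  apply measurable_prod_sum
  · have hf : Measurable fun q : (ℝ × 𝒳) × Θ =>
        (q.2 : EuclideanSpace ℝ (Fin d)) + q.1.1 • S.H q.1.2 q.2 := by
      have h1 : Measurable fun q : (ℝ × 𝒳) × Θ => S.H q.1.2 q.2 :=
        S.H_measurable.comp
          ((measurable_snd.comp measurable_fst).prodMk measurable_snd)
      exact (measurable_subtype_coe.comp measurable_snd).add
        ((measurable_fst.comp measurable_fst).smul h1)
    have hs := hf S.isOpen.measurableSet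
    have hd := Measurable.dite (s := (fun q : (ℝ × 𝒳) × Θ =>
        (q.2 : EuclideanSpace ℝ (Fin d)) + q.1.1 • S.H q.1.2 q.2) ⁻¹' Θ)
      (f := fun q => (Sum.inl ⟨_, q.2⟩ : Bar Θ)) (g := fun _ => Sum.inr ())
      (measurable_inl.comp ((hf.comp measurable_subtype_coe).subtype_mk)) measurable_const hs
    exact hd
  · exact measurable_inr.comp measurable_snd

open Classical in
/-- The law of the next sample: `P_θ` at `(x, θ)` with `θ ∈ Θ`, and the point mass at `x` once the
cemetery point has been reached (the process is then stopped). -/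
def sample (S : Scheme 𝒳 Θ) : Kernel (𝒳 × Bar Θ) 𝒳 :=
  Kernel.piecewise (s := {q | q.2 ∈ Set.range (Sum.inl : Θ → Bar Θ)})
    (measurable_snd measurableSet_range_inl)
    (S.P.comap (fun q : 𝒳 × Bar Θ => Sum.elim id (fun _ => S.θref) q.2)
      ((measurable_id.sumElim measurable_const).comp measurable_snd))
    (Kernel.deterministic Prod.fst measurable_fst)

instance (S : Scheme 𝒳 Θ) : IsMarkovKernel S.sample := by
  unfold sample; infer_instance

theorem sample_inl (S : Scheme 𝒳 Θ) (x : 𝒳) (θ : Θ) : S.sample (x, Sum.inl θ) = S.P θ := by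
  simp [sample, Kernel.piecewise_apply, Kernel.comap_apply]

/-- The kernel `Q_a(x, θ; ·)`, jointly in the step size `a` and the state `(x, θ)`: draw `y` from
the sampling law and move to `(y, θ + a H(y, θ))`, with `θ_c` replacing a second component that
falls outside `Θ`. -/
def QJoint (S : Scheme 𝒳 Θ) : Kernel (ℝ × (𝒳 × Bar Θ)) (𝒳 × Bar Θ) :=
  (Kernel.id ×ₖ S.sample.comap Prod.snd measurable_snd).map
    fun q : (ℝ × (𝒳 × Bar Θ)) × 𝒳 => (q.2, S.move q.1.1 q.2 q.1.2.2)

instance (S : Scheme 𝒳 Θ) : IsMarkovKernel S.QJoint := by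
  unfold QJoint
  refine Kernel.IsMarkovKernel.map _ (measurable_snd.prodMk ?_)
  exact S.measurable_move.comp (f := fun q : (ℝ × (𝒳 × Bar Θ)) × 𝒳 => ((q.1.1, q.2), q.1.2.2))
    (by fun_prop)

/-- The kernel `Q_a` on `𝒳 × Θ̄`. -/
def Q (S : Scheme 𝒳 Θ) (a : ℝ) : Kernel (𝒳 × Bar Θ) (𝒳 × Bar Θ) :=
  S.QJoint.comap (fun q => (a, q)) measurable_prodMk_left

instance (S : Scheme 𝒳 Θ) (a : ℝ) : IsMarkovKernel (S.Q a) := by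
  unfold Q; infer_instance

/-- The law `ℙ^γ_{x,θ}` on `(𝒳 × Θ̄)^ℕ` of the nonhomogeneous chain
`(X_{n+1}, θ_{n+1}) ∼ Q_{γ_{n+1}}(X_n, θ_n; ·)` started at `(x, θ)`. -/
def pathLaw (S : Scheme 𝒳 Θ) (γ : ℕ → ℝ) (q : 𝒳 × Θ) : Measure (ℕ → 𝒳 × Bar Θ) :=
  chainLaw (fun n => S.Q (γ (n + 1))) (q.1, Sum.inl q.2)

/-! ### The algorithm with adaptive truncation -/

/-- States `((X, θ), κ, ν, ζ)`: the active truncation index `κ`, the number `ν` of iterations since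
the last truncation and the index `ζ` into the step sequences. -/
abbrev State (_S : Scheme 𝒳 Θ) : Type _ := (𝒳 × Bar Θ) × (ℕ × ℕ × ℕ)

/-- The point from which the next step is made: the re-initialized point if `ν = 0`, the current
point otherwise. -/
def start (S : Scheme 𝒳 Θ) (z : S.State) : 𝒳 × Bar Θ :=
  if z.2.2.1 = 0 then Prod.map id Sum.inl (S.Φ z.1) else z.1

theorem measurable_start (S : Scheme 𝒳 Θ) : Measurable S.start := by
  refine Measurable.ite ?_ ?_ measurable_fst
  · exact (measurable_fst.comp (measurable_snd.comp measurable_snd)) (measurableSet_singleton 0)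
  · exact (measurable_id.prodMap measurable_inl).comp (S.Φ_measurable.comp measurable_fst)

/-- A move from `u` to `v` is accepted with tolerance `e` and truncation set `K` if it stays in the
parameter space, `‖v - u‖ ≤ e` and `v ∈ K`. -/
def Accepted (e : ℝ) (K : Set Θ) (u v : Bar Θ) : Prop :=
  ∃ a b : Θ, u = Sum.inl a ∧ v = Sum.inl b ∧
    ‖(b : EuclideanSpace ℝ (Fin d)) - (a : EuclideanSpace ℝ (Fin d))‖ ≤ e ∧ b ∈ K

theorem measurableSet_accepted (e : ℝ) {K : Set Θ} (hK : MeasurableSet K) :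
    MeasurableSet {q : Bar Θ × Bar Θ | Accepted e K q.1 q.2} := by
  have hi : MeasurableEmbedding (Sum.inl : Θ → Bar Θ) :=
    ⟨Sum.inl_injective, measurable_inl, fun _ hs => measurableSet_inl_image.2 hs⟩
  have hE : MeasurableEmbedding (Prod.map Sum.inl Sum.inl : Θ × Θ → Bar Θ × Bar Θ) :=
    hi.prodMap hi
  have hA : MeasurableSet {p : Θ × Θ |
      ‖(p.2 : EuclideanSpace ℝ (Fin d)) - (p.1 : EuclideanSpace ℝ (Fin d))‖ ≤ e ∧ p.2 ∈ K} := by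
    have h1 : Measurable fun p : Θ × Θ =>
        ‖(p.2 : EuclideanSpace ℝ (Fin d)) - (p.1 : EuclideanSpace ℝ (Fin d))‖ := by fun_prop
    exact (measurableSet_le h1 measurable_const).inter (measurable_snd hK)
  convert hE.measurableSet_image.2 hA using 1
  ext ⟨u, v⟩
  simp only [Accepted, Set.mem_ofPred_eq, Set.mem_image, Prod.exists, Prod.map_apply,
    Prod.mk.injEq]
  constructor
  · rintro ⟨a, b, rfl, rfl, h⟩; exact ⟨a, b, h, rfl, rfl⟩
  · rintro ⟨a, b, h, rfl, rfl⟩; exact ⟨a, b, rfl, rfl, h⟩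

open Classical in
/-- The new state, given the old state `z` and the new pair `q = (X_{n+1}, θ_{n+1})`. The increment
is measured from the point from which the step was made. As `φ(ν) > -ν` and `ζ ≥ ν` throughout,
`ζ + φ(ν)` is a natural number along every run. -/
def update (S : Scheme 𝒳 Θ) (ε : ℕ → ℝ) (z : S.State) (q : 𝒳 × Bar Θ) : S.State :=
  if Accepted (ε z.2.2.2) (S.K z.2.1) (S.start z).2 q.2 then
    (q, z.2.1, z.2.2.1 + 1, z.2.2.2 + 1)
  else
    (q, z.2.1 + 1, 0, ((z.2.2.2 : ℤ) + S.φ z.2.2.1).toNat)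

theorem measurable_update (S : Scheme 𝒳 Θ) (ε : ℕ → ℝ) :
    Measurable fun q : S.State × (𝒳 × Bar Θ) => S.update ε q.1 q.2 := by
  classical
  have hc : Measurable fun q : S.State × (𝒳 × Bar Θ) => q.1.2 :=
    measurable_snd.comp measurable_fst
  have hsnd : Measurable fun q : S.State × (𝒳 × Bar Θ) => q.2 := measurable_snd
  refine Measurable.ite ?_ ?_ ?_
  · have hset : {q : S.State × (𝒳 × Bar Θ) |
        Accepted (ε q.1.2.2.2) (S.K q.1.2.1) (S.start q.1).2 q.2.2} =
        ⋃ c : ℕ × ℕ × ℕ, (fun q : S.State × (𝒳 × Bar Θ) => q.1.2) ⁻¹' {c} ∩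
          (fun q : S.State × (𝒳 × Bar Θ) => ((S.start q.1).2, q.2.2)) ⁻¹'
            {r | Accepted (ε c.2.2) (S.K c.1) r.1 r.2} := by
      ext q; simp
    rw [hset]
    refine MeasurableSet.iUnion fun c => (hc (measurableSet_singleton c)).inter ?_
    refine Measurable.prodMk ?_ (measurable_snd.comp measurable_snd)
      (measurableSet_accepted _ (S.K_compact _).isClosed.measurableSet)
    exact measurable_snd.comp (S.measurable_start.comp measurable_fst)
  · exact hsnd.prodMk ((measurable_of_countable
      fun c : ℕ × ℕ × ℕ => (c.1, c.2.1 + 1, c.2.2 + 1)).comp hc)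
  · exact hsnd.prodMk ((measurable_of_countable
      fun c : ℕ × ℕ × ℕ => (c.1 + 1, 0, ((c.2.2 : ℤ) + S.φ c.2.1).toNat)).comp hc)

/-- The transition kernel of the algorithm: draw `(X_{n+1}, θ_{n+1})` from `Q_{γ_ζ}` at the starting
point of the step, then update the counters. -/
def algKernel (S : Scheme 𝒳 Θ) (γ ε : ℕ → ℝ) : Kernel S.State S.State :=
  (Kernel.id ×ₖ S.QJoint.comap (fun z : S.State => (γ z.2.2.2, S.start z))
    (((measurable_of_countable fun c : ℕ × ℕ × ℕ => γ c.2.2).comp measurable_snd).prodMk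
      S.measurable_start)).map
    fun q : S.State × (𝒳 × Bar Θ) => S.update ε q.1 q.2

instance (S : Scheme 𝒳 Θ) (γ ε : ℕ → ℝ) : IsMarkovKernel (S.algKernel γ ε) := by
  unfold algKernel
  exact Kernel.IsMarkovKernel.map _ (S.measurable_update ε)

/-- The law of the algorithm started at `(x, θ)` with `κ_0 = ν_0 = ζ_0 = 0`. -/
def algLaw (S : Scheme 𝒳 Θ) (γ ε : ℕ → ℝ) (x : 𝒳) (θ : Θ) : Measure (ℕ → S.State) :=
  chainLaw (fun _ => S.algKernel γ ε) ((x, Sum.inl θ), 0, 0, 0)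

/-- The parameter `θ_n` of the algorithm. -/
def param (S : Scheme 𝒳 Θ) (n : ℕ) (ω : ℕ → S.State) : Bar Θ := (ω n).1.2

/-- The index `κ_n` of the active truncation set. -/
def kap (S : Scheme 𝒳 Θ) (n : ℕ) (ω : ℕ → S.State) : ℕ := (ω n).2.1

/-- The number `ν_n` of iterations since the last truncation. -/
def nu (S : Scheme 𝒳 Θ) (n : ℕ) (ω : ℕ → S.State) : ℕ := (ω n).2.2.1

/-! ### Stopping times, partial sums of the noise and the quantity `A` -/

/-- `σ(K) = inf {k ≥ 1 | θ_k ∉ K}`, with `inf ∅ = ∞`. -/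
def exitTime (K : Set Θ) (ω : ℕ → 𝒳 × Bar Θ) : ℕ∞ :=
  sInf ((fun k : ℕ => (k : ℕ∞)) '' {k | 1 ≤ k ∧ (ω k).2 ∉ Sum.inl '' K})

/-- `ν(ε) = inf {k ≥ 1 | ‖θ_k - θ_{k-1}‖ ≥ ε_k}`, with `inf ∅ = ∞`. (No distance to the cemetery
point is defined; a jump there is an exit from every subset of `Θ`.) -/
def jumpTime (ε : ℕ → ℝ) (ω : ℕ → 𝒳 × Bar Θ) : ℕ∞ :=
  sInf ((fun k : ℕ => (k : ℕ∞)) '' {k | 1 ≤ k ∧ ∃ a b : Θ, (ω (k - 1)).2 = Sum.inl a ∧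
    (ω k).2 = Sum.inl b ∧
      ε k ≤ ‖(b : EuclideanSpace ℝ (Fin d)) - (a : EuclideanSpace ℝ (Fin d))‖})

/-- The noise `H(y, θ) - h(θ)` (irrelevant value `0` at the cemetery point). -/
def noise (S : Scheme 𝒳 Θ) (y : 𝒳) : Bar Θ → EuclideanSpace ℝ (Fin d)
  | Sum.inl θ => S.H y θ - S.h θ
  | Sum.inr _ => 0

open Classical in
/-- `S_{l,n}(γ, ε, K)`, the sum over `l ≤ k ≤ n` of `γ_k (H(X_k, θ_{k-1}) - h(θ_{k-1}))` on the event
`n ≤ σ(K) ∧ ν(ε)`, and zero off this event. -/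
def partialSum (S : Scheme 𝒳 Θ) (γ ε : ℕ → ℝ) (K : Set Θ) (l n : ℕ) (ω : ℕ → 𝒳 × Bar Θ) :
    EuclideanSpace ℝ (Fin d) :=
  if (n : ℕ∞) ≤ min (exitTime K ω) (jumpTime ε ω) then
    ∑ k ∈ Finset.Icc l n, γ k • S.noise (ω k).1 (ω (k - 1)).2
  else 0

/-- The supremum, over all points `Φ(x, θ)` from which the algorithm can be re-initialized, of
`ℙ^γ(sup_{n ≥ 1} ‖S_{1,n}(γ, ε, V)‖ > δ) + ℙ^γ(ν(ε) < σ(V))`. -/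
def A (S : Scheme 𝒳 Θ) (δ : ℝ) (V : Set Θ) (γ ε : ℕ → ℝ) : ℝ≥0∞ :=
  ⨆ q : 𝒳 × Bar Θ,
    (S.pathLaw γ (S.Φ q)
        {ω | ENNReal.ofReal δ < ⨆ n : ℕ, ⨆ _ : 1 ≤ n, ‖S.partialSum γ ε V 1 n ω‖ₑ} +
      S.pathLaw γ (S.Φ q) {ω | jumpTime ε ω < exitTime V ω})

/-! ### The assumptions -/

/-- The sublevel set `W_M = {θ ∈ Θ | w(θ) ≤ M}`. -/
def sublevel (Θ : Set (EuclideanSpace ℝ (Fin d))) (w : EuclideanSpace ℝ (Fin d) → ℝ) (M : ℝ) :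
    Set Θ := {θ | w θ ≤ M}

/-- The set `L = {θ ∈ Θ | ⟨h(θ), ∇w(θ)⟩ = 0}`. -/
def critSet (S : Scheme 𝒳 Θ) (w : EuclideanSpace ℝ (Fin d) → ℝ) : Set Θ :=
  {θ | ⟪S.h θ, gradient w θ⟫ = 0}

/-- The mean field is well defined and continuous, and `w : Θ → [0, ∞)` is a `C¹` Lyapunov function
for it with levels `M₀ < M₁` (values of `w` outside `Θ` play no role). -/
structure Lyapunov (S : Scheme 𝒳 Θ) (w : EuclideanSpace ℝ (Fin d) → ℝ) (M₀ M₁ : ℝ) : Prop where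
  integrable : ∀ θ, Integrable (fun x => S.H x θ) (S.P θ)
  continuous_h : Continuous S.h
  contDiffOn : ContDiffOn ℝ 1 w Θ
  nonneg : ∀ θ ∈ Θ, 0 ≤ w θ
  M₀_pos : 0 < M₀
  M₀_lt_M₁ : M₀ < M₁
  critSet_lt : ∀ θ ∈ S.critSet w, w θ < M₀
  compact : IsCompact (sublevel Θ w M₁)
  neg : ∀ θ, θ ∉ S.critSet w → ⟪S.h θ, gradient w θ⟫ < 0
  interior_empty : interior (closure ((fun θ : Θ => w θ) '' S.critSet w)) = ∅

/-- For every compact `K ⊆ Θ`, `‖H(x, θ)‖^p ≤ C_K w_x(θ) W(x)^p` for all `x` and all `θ ∈ K`, where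
`w_x(θ) = φ_{θ_ref}(x) / φ_θ(x)` is the likelihood ratio and `W ∈ L_p(θ_ref)`. The inequality is
cleared of denominators. -/
structure MomentBound (S : Scheme 𝒳 Θ) (p : ℝ) (W : 𝒳 → ℝ) : Prop where
  one_lt : 1 < p
  memLp : MemLp W (ENNReal.ofReal p) (S.P S.θref)
  bound : ∀ K : Set Θ, IsCompact K → ∃ C : ℝ, ∀ x, ∀ θ ∈ K,
    ‖S.H x θ‖ ^ p * S.dens θ x ≤ C * (S.dens S.θref x * |W x| ^ p)

/-- `ε_n → 0`, `∑ γ_n = ∞` and `∑ (γ_n² + (γ_n / ε_n)^p) < ∞` (for positive sequences). -/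
structure StepSizes (p : ℝ) (γ ε : ℕ → ℝ) : Prop where
  tendsto_eps : Tendsto ε atTop (𝓝 0)
  not_summable : ¬ Summable γ
  summable : Summable fun n => γ n ^ 2 + (γ n / ε n) ^ p

end Scheme

/-- The shifted sequence `a^{←k} = (a_{l+k})_l`. -/
def shift (a : ℕ → ℝ) (k : ℕ) : ℕ → ℝ := fun l => a (l + k)

/-- The distance from a point of `Θ̄` to a subset of `Θ`, infinite at the cemetery point. -/
def distTo {d : ℕ} {Θ : Set (EuclideanSpace ℝ (Fin d))} (L : Set Θ) : Bar Θ → ℝ≥0∞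
  | Sum.inl θ => Metric.infEDist θ L
  | Sum.inr _ => ⊤

end AdaptiveTruncation

end

/-! Call the stretch of a run between two truncations a block. A block starts at a value of `S.Φ`,
hence in {w ≤ M₀}, and until it ends it is the chain without truncation, with step sequences shifted
according to the current index ζ. The proof bounds the probability that a block ends, multiplies
these bounds, and then studies the last block.

Stability (`exists_stability`). Subtracting the accumulated noise from the parameters leaves a
sequence driven by h alone, with h evaluated at a nearby point. On the compact set {w ≤ M₀} the
drift points strictly inward where w = M₀, so for small steps this sequence is trapped there, and
the parameters themselves stay in {w ≤ M}. Hence, once the steps are small and the active truncation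
set contains W_M, a block can end only on the two events measured by A (`pathLaw_reject_le_A`).

Geometric bound (`reachProb_le_pow`). Since φ(ν) > -ν, the relation κ + ν ≤ ζ persists, so after
enough truncations every block meets these two requirements and uses shifts in the range of the
supremum of A. The Markov property at the truncations gives one factor sup A per block; the finitely
many early blocks cost a constant.

Smallness of A (`MomentLE.A_le`). Only moments of some order p > 1 are available, so the moves γH
are cut off at level ε₀ and centered. The result is a martingale difference sequence of variance
O(γ² + γ^p), controlled by Kolmogorov's inequality; the bias is O(γ^p); moves of size at least ε_n
have total probability O(∑ (γ/ε)^p). All bounds are tails of convergent series, which yields tails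
of κ of every geometric ratio. At M = M₀ no room is left for noise, and the bound in terms of A is
deduced from these tails or, if A vanishes for all δ > 0, from stability with zero noise.

Convergence. Almost surely there are finitely many truncations. In the last block the parameters
stay in a compact set and the noise series converges. Adding the noise still to come gives a
noise-free sequence v. The values w(v) converge, since levels outside the closure of w(L) cannot be
crossed upwards infinitely often (`exists_tendsto_lyapunov`); and since the steps have infinite sum,
w(v) would drop by a fixed amount at arbitrarily late times near a cluster point outside L
(`not_mapClusterPt_of_lt`). -/

namespace AdaptiveTruncation

/-! ### Square-integrable martingales with bounded increments -/

section Martingale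

variable {Ω : Type*} {mΩ : MeasurableSpace Ω} {μ : Measure Ω} [IsProbabilityMeasure μ]
  {ℱ : Filtration ℕ mΩ} {D : ℕ → Ω → ℝ}

theorem stronglyMeasurable_sum_range (hD : ∀ k, StronglyMeasurable[ℱ (k + 1)] (D k)) (n : ℕ) :
    StronglyMeasurable[ℱ n] fun ω => ∑ k ∈ Finset.range n, D k ω := by
  refine Finset.stronglyMeasurable_fun_sum _ fun k hk => (hD k).mono (ℱ.mono ?_)
  have := Finset.mem_range.1 hk
  omega

theorem exists_abs_sum_range_le (hb : ∀ k, ∃ c, ∀ ω, |D k ω| ≤ c) (n : ℕ) :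
    ∃ c, ∀ ω, |∑ k ∈ Finset.range n, D k ω| ≤ c := by
  choose c hc using hb
  exact ⟨∑ k ∈ Finset.range n, c k, fun ω =>
    (Finset.abs_sum_le_sum_abs _ _).trans (Finset.sum_le_sum fun k _ => hc k ω)⟩

theorem integrable_of_abs_le {f : Ω → ℝ} (hf : StronglyMeasurable f) (hb : ∃ c, ∀ ω, |f ω| ≤ c) :
    Integrable f μ := by
  obtain ⟨c, hc⟩ := hb
  exact Integrable.of_bound hf.aestronglyMeasurable c (ae_of_all _ fun ω => by simpa using hc ω)

theorem exists_abs_mul_le {f g : Ω → ℝ} (hf : ∃ c, ∀ ω, |f ω| ≤ c) (hg : ∃ c, ∀ ω, |g ω| ≤ c) :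
    ∃ c, ∀ ω, |f ω * g ω| ≤ c := by
  obtain ⟨c, hc⟩ := hf
  obtain ⟨c', hc'⟩ := hg
  refine ⟨c * c', fun ω => ?_⟩
  rw [abs_mul]
  exact mul_le_mul (hc ω) (hc' ω) (abs_nonneg _) ((abs_nonneg _).trans (hc ω))

theorem condExp_sum_range_mul (hD : ∀ k, StronglyMeasurable[ℱ (k + 1)] (D k))
    (hb : ∀ k, ∃ c, ∀ ω, |D k ω| ≤ c) (h0 : ∀ k, μ[D k | ℱ k] =ᵐ[μ] 0) (n : ℕ) :
    μ[(fun ω => ∑ k ∈ Finset.range n, D k ω) * D n | ℱ n] =ᵐ[μ] 0 := by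
  have hS := stronglyMeasurable_sum_range hD n
  have hD' := (hD n).mono (ℱ.le _)
  have := condExp_mul_of_stronglyMeasurable_left (μ := μ) hS
    (integrable_of_abs_le ((hS.mono (ℱ.le _)).mul hD')
      (exists_abs_mul_le (exists_abs_sum_range_le hb n) (hb n)))
    (integrable_of_abs_le hD' (hb n))
  filter_upwards [this, h0 n] with ω h1 h2
  simp [h1, h2]

theorem integrable_sum_range (hD : ∀ k, StronglyMeasurable[ℱ (k + 1)] (D k))
    (hb : ∀ k, ∃ c, ∀ ω, |D k ω| ≤ c) (n : ℕ) :
    Integrable (fun ω => ∑ k ∈ Finset.range n, D k ω) μ :=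
  integrable_of_abs_le ((stronglyMeasurable_sum_range hD n).mono (ℱ.le _))
    (exists_abs_sum_range_le hb n)

theorem integrable_sum_range_sq (hD : ∀ k, StronglyMeasurable[ℱ (k + 1)] (D k))
    (hb : ∀ k, ∃ c, ∀ ω, |D k ω| ≤ c) (n : ℕ) :
    Integrable (fun ω => (∑ k ∈ Finset.range n, D k ω) ^ 2) μ := by
  have hS := (stronglyMeasurable_sum_range hD n).mono (ℱ.le _)
  refine integrable_of_abs_le (hS.pow 2) ?_
  simpa only [sq] using exists_abs_mul_le (exists_abs_sum_range_le hb n)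
    (exists_abs_sum_range_le hb n)

/-- Orthogonality of the increments: the past sum is measurable at time n and factors out of the
conditional expectation of `D n`, so the cross terms integrate to zero. -/
theorem integral_sum_range_sq (hD : ∀ k, StronglyMeasurable[ℱ (k + 1)] (D k))
    (hb : ∀ k, ∃ c, ∀ ω, |D k ω| ≤ c) (h0 : ∀ k, μ[D k | ℱ k] =ᵐ[μ] 0) (n : ℕ) :
    ∫ ω, (∑ k ∈ Finset.range n, D k ω) ^ 2 ∂μ = ∑ k ∈ Finset.range n, ∫ ω, D k ω ^ 2 ∂μ := by
  induction n with
  | zero => simp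
  | succ n ih =>
    have hS := (stronglyMeasurable_sum_range hD n).mono (ℱ.le _)
    have hD' := (hD n).mono (ℱ.le _)
    have hi : Integrable (fun ω => (∑ k ∈ Finset.range n, D k ω) * D n ω) μ :=
      integrable_of_abs_le (hS.mul hD') (exists_abs_mul_le (exists_abs_sum_range_le hb n) (hb n))
    have hi2 : Integrable (fun ω => D n ω ^ 2) μ := by
      refine integrable_of_abs_le (hD'.pow 2) ?_
      simpa only [sq] using exists_abs_mul_le (hb n) (hb n)
    have hz : ∫ ω, (∑ k ∈ Finset.range n, D k ω) * D n ω ∂μ = 0 := by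
      have h1 := integral_condExp (μ := μ) (f := (fun ω => ∑ k ∈ Finset.range n, D k ω) * D n)
        (ℱ.le n)
      rw [integral_congr_ae (condExp_sum_range_mul hD hb h0 n)] at h1
      simpa using h1.symm
    calc ∫ ω, (∑ k ∈ Finset.range (n + 1), D k ω) ^ 2 ∂μ
        = ∫ ω, ((∑ k ∈ Finset.range n, D k ω) ^ 2 + 2 * ((∑ k ∈ Finset.range n, D k ω) * D n ω)) +
            D n ω ^ 2 ∂μ := by
          congr with ω
          rw [Finset.sum_range_succ]; ring
      _ = _ := by
          have h12 : Integrable (fun ω => (∑ k ∈ Finset.range n, D k ω) ^ 2 +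
              2 * ((∑ k ∈ Finset.range n, D k ω) * D n ω)) μ :=
            (integrable_sum_range_sq hD hb n).add (hi.const_mul 2)
          rw [integral_add h12 hi2, integral_add (integrable_sum_range_sq hD hb n) (hi.const_mul 2), integral_const_mul, hz,
            ih, Finset.sum_range_succ]
          ring

theorem martingale_sum_range (hD : ∀ k, StronglyMeasurable[ℱ (k + 1)] (D k))
    (hb : ∀ k, ∃ c, ∀ ω, |D k ω| ≤ c) (h0 : ∀ k, μ[D k | ℱ k] =ᵐ[μ] 0) :
    Martingale (fun n ω => ∑ k ∈ Finset.range n, D k ω) ℱ μ := by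
  refine martingale_nat (stronglyMeasurable_sum_range hD) (integrable_sum_range hD hb) fun n => ?_
  have h1 : (fun ω => ∑ k ∈ Finset.range (n + 1), D k ω) =
      (fun ω => ∑ k ∈ Finset.range n, D k ω) + D n := by
    ext ω; simp [Finset.sum_range_succ]
  rw [h1]
  have h2 := condExp_add (μ := μ) (integrable_sum_range hD hb n)
    (integrable_of_abs_le ((hD n).mono (ℱ.le _)) (hb n)) (ℱ n)
  rw [condExp_of_stronglyMeasurable (ℱ.le n) (stronglyMeasurable_sum_range hD n)
    (integrable_sum_range hD hb n)] at h2
  filter_upwards [h2, h0 n] with ω h3 h4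
  simp [h3, h4]

theorem submartingale_sum_range_sq (hD : ∀ k, StronglyMeasurable[ℱ (k + 1)] (D k))
    (hb : ∀ k, ∃ c, ∀ ω, |D k ω| ≤ c) (h0 : ∀ k, μ[D k | ℱ k] =ᵐ[μ] 0) :
    Submartingale (fun n ω => (∑ k ∈ Finset.range n, D k ω) ^ 2) ℱ μ := by
  refine submartingale_nat (fun n => (stronglyMeasurable_sum_range hD n).pow 2)
    (integrable_sum_range_sq hD hb) fun n => ?_
  have hS := (stronglyMeasurable_sum_range hD n).mono (ℱ.le _)
  have hD' := (hD n).mono (ℱ.le _)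
  have hi : Integrable ((fun ω => ∑ k ∈ Finset.range n, D k ω) * D n) μ :=
    integrable_of_abs_le (hS.mul hD') (exists_abs_mul_le (exists_abs_sum_range_le hb n) (hb n))
  -- Expand the square of the next sum and drop `D n ^ 2`; the cross term that remains has
  -- conditional expectation zero.
  have hle : (fun ω => (∑ k ∈ Finset.range n, D k ω) ^ 2) +
      (2 : ℝ) • ((fun ω => ∑ k ∈ Finset.range n, D k ω) * D n) ≤ᵐ[μ]
      fun ω => (∑ k ∈ Finset.range (n + 1), D k ω) ^ 2 := by
    refine ae_of_all _ fun ω => ?_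
    simp only [Pi.add_apply, Pi.smul_apply, Pi.mul_apply, smul_eq_mul, Finset.sum_range_succ]
    nlinarith [sq_nonneg (D n ω)]
  have h1 := condExp_mono (m := ℱ n) (μ := μ)
    ((integrable_sum_range_sq hD hb n).add (hi.smul (2 : ℝ)))
    (integrable_sum_range_sq hD hb (n + 1)) hle
  have h2 := condExp_add (μ := μ) (integrable_sum_range_sq hD hb n) (hi.smul (2 : ℝ)) (ℱ n)
  have h3 := condExp_smul (μ := μ) (2 : ℝ) ((fun ω => ∑ k ∈ Finset.range n, D k ω) * D n) (ℱ n)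
  have hS2 : StronglyMeasurable[ℱ n] fun ω => (∑ k ∈ Finset.range n, D k ω) ^ 2 :=
    (stronglyMeasurable_sum_range hD n).pow 2
  rw [condExp_of_stronglyMeasurable (ℱ.le n) hS2 (integrable_sum_range_sq hD hb n)] at h2
  filter_upwards [h1, h2, h3, condExp_sum_range_mul hD hb h0 n] with ω k1 k2 k3 k4
  rw [k2, Pi.add_apply, k3, Pi.smul_apply, k4] at k1
  simpa using k1

/-- Kolmogorov's maximal inequality for martingales. -/
theorem measure_exists_le_abs_sum_range (hD : ∀ k, StronglyMeasurable[ℱ (k + 1)] (D k))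
    (hb : ∀ k, ∃ c, ∀ ω, |D k ω| ≤ c) (h0 : ∀ k, μ[D k | ℱ k] =ᵐ[μ] 0) {a : ℝ} (ha : 0 < a)
    {c : ℝ} (hc : ∀ n, ∑ k ∈ Finset.range n, ∫ ω, D k ω ^ 2 ∂μ ≤ c) :
    μ {ω | ∃ n, a ≤ |∑ k ∈ Finset.range n, D k ω|} ≤ ENNReal.ofReal (c / a ^ 2) := by
  have hset : {ω | ∃ n, a ≤ |∑ k ∈ Finset.range n, D k ω|} =
      ⋃ N, {ω | ∃ n ≤ N, a ≤ |∑ k ∈ Finset.range n, D k ω|} := by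
    ext ω
    simp only [Set.mem_ofPred_eq, Set.mem_iUnion]
    exact ⟨fun ⟨n, hn⟩ => ⟨n, n, le_rfl, hn⟩, fun ⟨_, n, _, hn⟩ => ⟨n, hn⟩⟩
  have hmono : Monotone fun N => {ω | ∃ n ≤ N, a ≤ |∑ k ∈ Finset.range n, D k ω|} :=
    fun N N' h ω ⟨n, hn, h'⟩ => ⟨n, hn.trans h, h'⟩
  rw [hset, hmono.measure_iUnion]
  refine iSup_le fun N => ?_
  -- Doob's inequality has a finite horizon, so it is applied to the squared sums at level `a ^ 2`
  -- up to time N; the events increase with N.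
  have hmax := maximal_ineq (submartingale_sum_range_sq hD hb h0)
    (fun n ω => by positivity) (ε := ⟨a ^ 2, by positivity⟩) N
  have hmax2 : ENNReal.ofReal (a ^ 2) * μ {ω | ∃ n ≤ N, a ≤ |∑ k ∈ Finset.range n, D k ω|} ≤
      ENNReal.ofReal c := by
    have he : ENNReal.ofReal (a ^ 2) = (NNReal.mk (a ^ 2) (sq_nonneg a) : ℝ≥0∞) :=
      ENNReal.ofReal_eq_coe_nnreal (sq_nonneg a)
    rw [he]
    refine le_trans (mul_le_mul_right (measure_mono ?_) _) (hmax.trans (ENNReal.ofReal_le_ofReal ?_))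
    · rintro ω ⟨n, hn, h⟩
      have h' : a ^ 2 ≤ (∑ k ∈ Finset.range n, D k ω) ^ 2 := by
        rw [← sq_abs (∑ k ∈ Finset.range n, D k ω)]
        gcongr
      exact h'.trans (Finset.le_sup' (fun m => (∑ k ∈ Finset.range m, D k ω) ^ 2)
        (Finset.mem_range.2 (Nat.lt_succ_of_le hn)))
    · refine (setIntegral_le_integral (integrable_sum_range_sq hD hb N)
        (ae_of_all _ fun ω => by positivity)).trans ?_
      rw [integral_sum_range_sq hD hb h0]
      exact hc N
  rw [ENNReal.ofReal_div_of_pos (by positivity), ENNReal.le_div_iff_mul_le (by left; simp [ha.ne'])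
    (by left; simp), mul_comm]
  exact hmax2

/-- By orthogonality the second moments are at most c; as |s| ≤ 1 + s², the martingale is bounded in
L¹ and Doob's convergence theorem applies. -/
theorem ae_exists_tendsto_sum_range (hD : ∀ k, StronglyMeasurable[ℱ (k + 1)] (D k))
    (hb : ∀ k, ∃ c, ∀ ω, |D k ω| ≤ c) (h0 : ∀ k, μ[D k | ℱ k] =ᵐ[μ] 0)
    {c : ℝ} (hc : ∀ n, ∑ k ∈ Finset.range n, ∫ ω, D k ω ^ 2 ∂μ ≤ c) :
    ∀ᵐ ω ∂μ, ∃ l, Tendsto (fun n => ∑ k ∈ Finset.range n, D k ω) atTop (𝓝 l) := by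
  refine (martingale_sum_range hD hb h0).submartingale.exists_ae_tendsto_of_bdd
    (R := (1 + c).toNNReal) fun n => ?_
  rw [eLpNorm_one_eq_lintegral_enorm, ← ofReal_integral_norm_eq_lintegral_enorm
    (integrable_sum_range hD hb n)]
  refine ENNReal.ofReal_le_ofReal ?_
  calc ∫ ω, ‖∑ k ∈ Finset.range n, D k ω‖ ∂μ
      ≤ ∫ ω, 1 + (∑ k ∈ Finset.range n, D k ω) ^ 2 ∂μ := by
        refine integral_mono (integrable_sum_range hD hb n).norm
          ((integrable_const _).add (integrable_sum_range_sq hD hb n)) fun ω => ?_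
        simp only [Real.norm_eq_abs]
        rw [← sq_abs (∑ k ∈ Finset.range n, D k ω)]
        nlinarith [sq_nonneg (|∑ k ∈ Finset.range n, D k ω| - 1),
          abs_nonneg (∑ k ∈ Finset.range n, D k ω)]
    _ ≤ 1 + c := by
        rw [integral_add (integrable_const _) (integrable_sum_range_sq hD hb n),
          integral_sum_range_sq hD hb h0]
        simpa using hc n

end Martingale

end AdaptiveTruncation

namespace AdaptiveTruncation

/-! ### The Markov property -/

section Chain

variable {Z : Type*} [MeasurableSpace Z] (T : ℕ → Kernel Z Z) [∀ n, IsMarkovKernel (T n)] (z : Z)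

instance : IsProbabilityMeasure (chainLaw T z) := by
  unfold chainLaw; infer_instance

/-- In the Ionescu-Tulcea construction the law of (history up to n, next state) is the composition
product of the law of the history with `T n` at the last coordinate. The forms of the Markov
property used below rest on this. -/
theorem lintegral_chainLaw_history {n : ℕ} {f : (Π _ : Finset.Iic n, Z) × Z → ℝ≥0∞}
    (hf : Measurable f) :
    ∫⁻ ω, f (Preorder.frestrictLe n ω, ω (n + 1)) ∂(chainLaw T z) =
      ∫⁻ ω, ∫⁻ y, f (Preorder.frestrictLe n ω, y) ∂(T n (ω n)) ∂(chainLaw T z) := by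
  have h := Kernel.partialTraj_compProd_eq_map_traj (X := fun _ => Z)
    (κ := fun n => (T n).comap (fun x : (Π _ : Finset.Iic n, Z) => x ⟨n, Finset.mem_Iic.2 le_rfl⟩)
      (measurable_pi_apply _)) (Nat.zero_le n) (x₀ := fun _ => z)
  have hm : Measurable fun ω : ℕ → Z => (Preorder.frestrictLe (π := fun _ => Z) n ω, ω (n + 1)) := by
    fun_prop
  unfold chainLaw
  rw [← lintegral_map hf hm, ← h, Measure.lintegral_compProd hf,
    ← Kernel.traj_map_frestrictLe_apply, lintegral_map _ (by fun_prop)]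
  · rfl
  · exact hf.lintegral_kernel_prod_right'

theorem lintegral_chainLaw {n : ℕ} {f : Z × Z → ℝ≥0∞} (hf : Measurable f) :
    ∫⁻ ω, f (ω n, ω (n + 1)) ∂(chainLaw T z) =
      ∫⁻ ω, ∫⁻ y, f (ω n, y) ∂(T n (ω n)) ∂(chainLaw T z) :=
  lintegral_chainLaw_history T z
    (f := fun q : (Π _ : Finset.Iic n, Z) × Z => f (q.1 ⟨n, Finset.mem_Iic.2 le_rfl⟩, q.2))
    (by fun_prop)

theorem setLIntegral_chainLaw {n : ℕ} {s : Set (Π _ : Finset.Iic n, Z)} (hs : MeasurableSet s)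
    {f : Z × Z → ℝ≥0∞} (hf : Measurable f) :
    ∫⁻ ω in Preorder.frestrictLe n ⁻¹' s, f (ω n, ω (n + 1)) ∂(chainLaw T z) =
      ∫⁻ ω in Preorder.frestrictLe n ⁻¹' s, ∫⁻ y, f (ω n, y) ∂(T n (ω n)) ∂(chainLaw T z) := by
  have h1 := lintegral_chainLaw_history T z (f := fun q : (Π _ : Finset.Iic n, Z) × Z =>
    s.indicator 1 q.1 * f (q.1 ⟨n, Finset.mem_Iic.2 le_rfl⟩, q.2))
    (((measurable_one.indicator hs).comp measurable_fst).mul (by fun_prop))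
  have hs' : MeasurableSet (Preorder.frestrictLe (π := fun _ : ℕ => Z) n ⁻¹' s) :=
    (Preorder.measurable_frestrictLe n) hs
  rw [← lintegral_indicator hs', ← lintegral_indicator hs']
  convert h1 using 3 with ω ω
  · by_cases h : Preorder.frestrictLe (π := fun _ : ℕ => Z) n ω ∈ s <;> simp [h]
  · by_cases h : Preorder.frestrictLe (π := fun _ : ℕ => Z) n ω ∈ s <;> simp [h]

theorem ae_chainLaw_zero {s : Set Z} (hs : MeasurableSet s) (hz : z ∈ s) :
    ∀ᵐ ω ∂(chainLaw T z), ω 0 ∈ s := by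
  have h := Kernel.traj_map_frestrictLe_apply (X := fun _ => Z)
    (κ := fun n => (T n).comap (fun x : (Π _ : Finset.Iic n, Z) => x ⟨n, Finset.mem_Iic.2 le_rfl⟩)
      (measurable_pi_apply _)) 0 0 (fun _ => z)
  rw [Kernel.partialTraj_self, Kernel.id_apply] at h
  have hs' : MeasurableSet {x : Π _ : Finset.Iic 0, Z | x ⟨0, Finset.mem_Iic.2 le_rfl⟩ ∈ s} :=
    measurable_pi_apply _ hs
  have h2 : ∀ᵐ x ∂((chainLaw T z).map (Preorder.frestrictLe 0)),
      x ∈ {x : Π _ : Finset.Iic 0, Z | x ⟨0, Finset.mem_Iic.2 le_rfl⟩ ∈ s} := by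
    unfold chainLaw
    rw [h]
    exact (ae_dirac_iff hs').2 hz
  exact ae_of_ae_map (Preorder.measurable_frestrictLe (X := fun _ : ℕ => Z) 0).aemeasurable h2

/-- The Chapman-Kolmogorov equation for functions of the current state. -/
theorem lintegral_chainLaw_succ {n : ℕ} {f : Z → ℝ≥0∞} (hf : Measurable f) :
    ∫⁻ ω, f (ω (n + 1)) ∂(chainLaw T z) =
      ∫⁻ ω, ∫⁻ y, f y ∂(T n (ω n)) ∂(chainLaw T z) :=
  lintegral_chainLaw T z (f := fun q => f q.2) (by fun_prop)

theorem lintegral_chainLaw_zero {f : Z → ℝ≥0∞} (hf : Measurable f) :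
    ∫⁻ ω, f (ω 0) ∂(chainLaw T z) = f z := by
  have h : ∀ᵐ ω ∂(chainLaw T z), f (ω 0) = f z :=
    ae_chainLaw_zero T z (s := f ⁻¹' {f z}) (hf (measurableSet_singleton _)) rfl
  rw [lintegral_congr_ae h]
  simp

theorem ae_chainLaw_succ {n : ℕ} {p : Z × Z → Prop} (hp : MeasurableSet {q | p q})
    (h : ∀ x, ∀ᵐ y ∂(T n x), p (x, y)) : ∀ᵐ ω ∂(chainLaw T z), p (ω n, ω (n + 1)) := by
  have h1 := lintegral_chainLaw T z (n := n) (f := {q | p q}ᶜ.indicator 1)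
    (measurable_one.indicator hp.compl)
  have h2 : ∀ x, ∫⁻ y, {q | p q}ᶜ.indicator (1 : Z × Z → ℝ≥0∞) (x, y) ∂(T n x) = 0 := by
    intro x
    rw [lintegral_eq_zero_iff (by
      exact (measurable_one.indicator hp.compl).comp measurable_prodMk_left)]
    filter_upwards [h x] with y hy
    simp [hy]
  simp only [h2, lintegral_zero] at h1
  rw [lintegral_eq_zero_iff (by
    exact (measurable_one.indicator hp.compl).comp (by fun_prop))] at h1
  filter_upwards [h1] with ω hω
  by_contra hc
  simp [hc] at hω

/-- Conditional expectations along the chain of functions with vanishing kernel integrals. -/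
theorem condExp_chainLaw_eq_zero {n : ℕ} {g : Z × Z → ℝ} (hg : Measurable g)
    (hb : ∃ c, ∀ q, |g q| ≤ c) (h0 : ∀ x, ∫ y, g (x, y) ∂(T n x) = 0) :
    (chainLaw T z)[fun ω => g (ω n, ω (n + 1)) |
      Filtration.piLE (X := fun _ : ℕ => Z) n] =ᵐ[chainLaw T z] 0 := by
  obtain ⟨c, hc⟩ := hb
  have hm : Measurable fun ω : ℕ → Z => (Preorder.frestrictLe (π := fun _ => Z) n ω, ω (n + 1)) := by
    fun_prop
  refine (ae_eq_condExp_of_forall_setIntegral_eq (Filtration.piLE.le n) ?_ ?_ ?_ ?_).symm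
  · exact Integrable.of_bound (Measurable.aestronglyMeasurable (by fun_prop)) c (ae_of_all _ fun ω => hc _)
  · intros; exact (integrable_zero _ _ _).integrableOn
  · intro s hs _
    rw [Filtration.piLE_eq_comap_frestrictLe] at hs
    obtain ⟨t, ht, rfl⟩ := hs
    have h := Kernel.partialTraj_compProd_eq_map_traj (X := fun _ => Z)
      (κ := fun n => (T n).comap (fun x : (Π _ : Finset.Iic n, Z) =>
        x ⟨n, Finset.mem_Iic.2 le_rfl⟩) (measurable_pi_apply _)) (Nat.zero_le n) (x₀ := fun _ => z)
    -- An event of the past is a rectangle `t ×ˢ univ` for the pair (history, next state), so the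
    -- next state can be integrated out first, which gives zero.
    have h1 := setIntegral_map (μ := chainLaw T z) (s := t ×ˢ (Set.univ : Set Z))
      (f := fun q : (Π _ : Finset.Iic n, Z) × Z => g (q.1 ⟨n, Finset.mem_Iic.2 le_rfl⟩, q.2))
      (ht.prod .univ) (Measurable.aestronglyMeasurable (by fun_prop)) hm.aemeasurable
    have h2 : (fun ω : ℕ → Z => (Preorder.frestrictLe (π := fun _ => Z) n ω, ω (n + 1))) ⁻¹'
      (t ×ˢ (Set.univ : Set Z)) = Preorder.frestrictLe (π := fun _ => Z) n ⁻¹' t := by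
      ext; simp
    rw [h2] at h1
    simp only [Pi.zero_apply, integral_zero]
    refine Eq.trans ?_ h1
    unfold chainLaw
    rw [← h, Measure.setIntegral_compProd ht .univ]
    · simp [h0]
    · exact (Integrable.of_bound (Measurable.aestronglyMeasurable (by fun_prop)) c
        (ae_of_all _ fun ω => hc _)).integrableOn
  · exact stronglyMeasurable_zero.aestronglyMeasurable

/-! ### Vector-valued noise along a Markov chain -/

section Noise

variable {d : ℕ} {g : ℕ → Z × Z → EuclideanSpace ℝ (Fin d)}

theorem sum_lintegral_coord_le (hg : ∀ n, Measurable (g n)) (hb : ∀ n, ∃ c, ∀ q, ‖g n q‖ ≤ c)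
    {c : ℝ≥0} (hc : ∀ N, ∑ n ∈ Finset.range N,
      ∫⁻ ω, ‖g n (ω n, ω (n + 1))‖ₑ ^ 2 ∂(chainLaw T z) ≤ c) (i : Fin d) (N : ℕ) :
    ∑ n ∈ Finset.range N, ∫ ω, g n (ω n, ω (n + 1)) i ^ 2 ∂(chainLaw T z) ≤ c := by
  have h1 : ∀ n, ENNReal.ofReal (∫ ω, g n (ω n, ω (n + 1)) i ^ 2 ∂(chainLaw T z)) ≤
      ∫⁻ ω, ‖g n (ω n, ω (n + 1))‖ₑ ^ 2 ∂(chainLaw T z) := by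
    intro n
    obtain ⟨b, hb⟩ := hb n
    have hm : Measurable fun ω : ℕ → Z => g n (ω n, ω (n + 1)) i ^ 2 := by
      have := hg n; fun_prop
    rw [ofReal_integral_eq_lintegral_ofReal]
    · refine lintegral_mono fun ω => ?_
      rw [← ofReal_norm, ← ENNReal.ofReal_pow (norm_nonneg _)]
      refine ENNReal.ofReal_le_ofReal ?_
      rw [← sq_abs, ← Real.norm_eq_abs]
      gcongr
      exact PiLp.norm_apply_le _ _
    · refine Integrable.of_bound hm.aestronglyMeasurable (b ^ 2) (ae_of_all _ fun ω => ?_)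
      rw [norm_pow]
      gcongr
      exact (PiLp.norm_apply_le _ _).trans (hb _)
    · exact ae_of_all _ fun ω => sq_nonneg _
  have h2 : ENNReal.ofReal (∑ n ∈ Finset.range N,
      ∫ ω, g n (ω n, ω (n + 1)) i ^ 2 ∂(chainLaw T z)) ≤ c := by
    rw [ENNReal.ofReal_sum_of_nonneg fun n _ => integral_nonneg fun ω => sq_nonneg _]
    exact (Finset.sum_le_sum fun n _ => h1 n).trans (hc N)
  simpa using (ENNReal.ofReal_le_iff_le_toReal ENNReal.coe_ne_top).1 h2

theorem stronglyMeasurable_piLE_coord (hg : ∀ n, Measurable (g n)) (i : Fin d) (n : ℕ) :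
    StronglyMeasurable[Filtration.piLE (X := fun _ : ℕ => Z) (n + 1)]
      fun ω : ℕ → Z => g n (ω n, ω (n + 1)) i := by
  have h1 : Measurable fun x : (Π _ : Finset.Iic (n + 1), Z) =>
      g n (x ⟨n, Finset.mem_Iic.2 n.le_succ⟩, x ⟨n + 1, Finset.mem_Iic.2 le_rfl⟩) i := by
    have := hg n; fun_prop
  rw [Filtration.piLE_eq_comap_frestrictLe]
  exact (h1.comp (comap_measurable (Preorder.frestrictLe (π := fun _ => Z) (n + 1)))).stronglyMeasurable

theorem condExp_coord_eq_zero (hg : ∀ n, Measurable (g n)) (hb : ∀ n, ∃ c, ∀ q, ‖g n q‖ ≤ c)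
    (h0 : ∀ n x, ∫ y, g n (x, y) ∂(T n x) = 0) (i : Fin d) (n : ℕ) :
    (chainLaw T z)[fun ω => g n (ω n, ω (n + 1)) i |
      Filtration.piLE (X := fun _ : ℕ => Z) n] =ᵐ[chainLaw T z] 0 := by
  obtain ⟨c, hc⟩ := hb n
  have hm := hg n
  refine condExp_chainLaw_eq_zero T z (g := fun q => g n q i) (by fun_prop)
    ⟨c, fun q => (PiLp.norm_apply_le _ _).trans (hc q)⟩ fun x => ?_
  have h1 := (EuclideanSpace.proj (𝕜 := ℝ) i).integral_comp_comm (μ := T n x)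
    (φ := fun y => g n (x, y)) (Integrable.of_bound (Measurable.aestronglyMeasurable (by fun_prop)) c
      (ae_of_all _ fun y => hc _))
  rw [h0 n x, map_zero] at h1
  exact h1

/-- The norm is at most the sum of the absolute values of the coordinates, so if it exceeds a then
some coordinate reaches a / d. The scalar maximal inequality and a union over the d coordinates give
the bound. -/
theorem measure_exists_lt_norm_sum_chainLaw (hg : ∀ n, Measurable (g n))
    (hb : ∀ n, ∃ c, ∀ q, ‖g n q‖ ≤ c) (h0 : ∀ n x, ∫ y, g n (x, y) ∂(T n x) = 0)
    {c : ℝ≥0} (hc : ∀ N, ∑ n ∈ Finset.range N,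
      ∫⁻ ω, ‖g n (ω n, ω (n + 1))‖ₑ ^ 2 ∂(chainLaw T z) ≤ c) {a : ℝ} (ha : 0 < a) :
    chainLaw T z {ω | ∃ N, a < ‖∑ n ∈ Finset.range N, g n (ω n, ω (n + 1))‖} ≤
      ENNReal.ofReal (d * (c / (a / d) ^ 2)) := by
  have hsub : {ω : ℕ → Z | ∃ N, a < ‖∑ n ∈ Finset.range N, g n (ω n, ω (n + 1))‖} ⊆
      ⋃ i : Fin d, {ω | ∃ N, a / d ≤ |∑ n ∈ Finset.range N, g n (ω n, ω (n + 1)) i|} := by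
    rintro ω ⟨N, hN⟩
    by_contra hcon
    simp only [Set.mem_iUnion, Set.mem_ofPred_eq, not_exists, not_le] at hcon
    have h1 : ‖∑ n ∈ Finset.range N, g n (ω n, ω (n + 1))‖ ≤
        ∑ i : Fin d, |∑ n ∈ Finset.range N, g n (ω n, ω (n + 1)) i| := by
      have h2 := norm_sum_le (Finset.univ : Finset (Fin d)) (fun i =>
        EuclideanSpace.single i ((∑ n ∈ Finset.range N, g n (ω n, ω (n + 1))) i))
      have h3 : ∑ i : Fin d, EuclideanSpace.single i
          ((∑ n ∈ Finset.range N, g n (ω n, ω (n + 1))) i) =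
          ∑ n ∈ Finset.range N, g n (ω n, ω (n + 1)) := by
        ext j
        simp [Finset.sum_apply, Pi.single_apply]
      rw [h3] at h2
      simpa using h2
    have h2 : ∑ i : Fin d, |∑ n ∈ Finset.range N, g n (ω n, ω (n + 1)) i| ≤
        ∑ i : Fin d, a / d := Finset.sum_le_sum fun i _ => (hcon i N).le
    have h3 : ∑ i : Fin d, a / d ≤ a := by
      rcases Nat.eq_zero_or_pos d with rfl | hd
      · simp [ha.le]
      · have : (d : ℝ) ≠ 0 := by positivity
        simp only [Finset.sum_const, Finset.card_univ, Fintype.card_fin, nsmul_eq_mul]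
        exact (mul_div_cancel₀ _ this).le
    linarith
  refine (measure_mono hsub).trans ((measure_iUnion_le _).trans ?_)
  rw [tsum_fintype]
  have h1 : ∀ i : Fin d, chainLaw T z
      {ω | ∃ N, a / d ≤ |∑ n ∈ Finset.range N, g n (ω n, ω (n + 1)) i|} ≤
        ENNReal.ofReal (c / (a / d) ^ 2) := by
    intro i
    have hd : 0 < (d : ℝ) := Nat.cast_pos.2 (i.pos)
    exact measure_exists_le_abs_sum_range (stronglyMeasurable_piLE_coord hg i)
      (fun n => (hb n).imp fun c hc ω => (PiLp.norm_apply_le _ _).trans (hc _))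
      (condExp_coord_eq_zero T z hg hb h0 i) (by positivity)
      (sum_lintegral_coord_le T z hg hb hc i)
  refine (Finset.sum_le_sum fun i _ => h1 i).trans ?_
  rw [Finset.sum_const, Finset.card_univ, Fintype.card_fin, nsmul_eq_mul,
    ENNReal.ofReal_mul (by positivity), ENNReal.ofReal_natCast]

theorem ae_exists_tendsto_sum_chainLaw (hg : ∀ n, Measurable (g n))
    (hb : ∀ n, ∃ c, ∀ q, ‖g n q‖ ≤ c) (h0 : ∀ n x, ∫ y, g n (x, y) ∂(T n x) = 0)
    {c : ℝ≥0} (hc : ∀ N, ∑ n ∈ Finset.range N,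
      ∫⁻ ω, ‖g n (ω n, ω (n + 1))‖ₑ ^ 2 ∂(chainLaw T z) ≤ c) :
    ∀ᵐ ω ∂(chainLaw T z), ∃ l,
      Tendsto (fun N => ∑ n ∈ Finset.range N, g n (ω n, ω (n + 1))) atTop (𝓝 l) := by
  have h1 : ∀ i : Fin d, ∀ᵐ ω ∂(chainLaw T z), ∃ l,
      Tendsto (fun N => ∑ n ∈ Finset.range N, g n (ω n, ω (n + 1)) i) atTop (𝓝 l) := fun i =>
    ae_exists_tendsto_sum_range (stronglyMeasurable_piLE_coord hg i)
      (fun n => (hb n).imp fun c hc ω => (PiLp.norm_apply_le _ _).trans (hc _))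
      (condExp_coord_eq_zero T z hg hb h0 i) (sum_lintegral_coord_le T z hg hb hc i)
  filter_upwards [ae_all_iff.2 h1] with ω hω
  choose l hl using hω
  refine ⟨WithLp.toLp 2 l, ?_⟩
  have h2 : Tendsto (fun N i => ∑ n ∈ Finset.range N, g n (ω n, ω (n + 1)) i) atTop (𝓝 l) :=
    tendsto_pi_nhds.2 hl
  have h3 := ((PiLp.continuous_toLp 2 (fun _ : Fin d => ℝ)).tendsto l).comp h2
  refine h3.congr fun N => ?_
  ext i
  simp

end Noise

end Chain

end AdaptiveTruncation

namespace AdaptiveTruncation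

/-! ### Perturbed descent along a Lyapunov function -/

section Step

variable {E : Type*} [NormedAddCommGroup E]

/-- A compact subset of an open set has a closed thickening inside it; here the compact set is the
diagonal of C at step size 0. In the triple `((y, x), γ)`, y is the noise-free position, x the
nearby point at which the drift is evaluated, and γ the step. -/
theorem exists_uniform_of_isCompact {C : Set E} (hC : IsCompact C)
    {P : (E × E) × ℝ → Prop} (hP : ∀ y ∈ C, ∀ᶠ q in 𝓝 ((y, y), (0 : ℝ)), P q) :
    ∃ δ > 0, ∀ y ∈ C, ∀ x γ, ‖x - y‖ ≤ δ → 0 ≤ γ → γ ≤ δ → P ((y, x), γ) := by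
  have hD : IsCompact ((fun y : E => ((y, y), (0 : ℝ))) '' C) := hC.image (by fun_prop)
  obtain ⟨δ, hδ, hsub⟩ := hD.exists_cthickening_subset_open (t := interior {q | P q})
    isOpen_interior (by
      rintro _ ⟨y, hy, rfl⟩
      exact mem_interior_iff_mem_nhds.2 (hP y hy))
  refine ⟨δ, hδ, fun y hy x γ hx hγ hγδ => interior_subset (hsub ?_)⟩
  refine Metric.mem_cthickening_of_dist_le _ ((y, y), 0) _ _ ⟨y, hy, rfl⟩ ?_
  simp only [Prod.dist_eq, dist_self, Real.dist_eq, sub_zero, abs_of_nonneg hγ]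
  rw [dist_eq_norm]
  exact max_le (max_le hδ.le hx) hγδ

theorem tendsto_step [NormedSpace ℝ E] {Θ : Set E} {h : E → E} (hΘ : IsOpen Θ) (hh : ContinuousOn h Θ) {y : E} (hy : y ∈ Θ) :
    Tendsto (fun q : (E × E) × ℝ => q.1.1 + q.2 • h q.1.2) (𝓝 ((y, y), 0)) (𝓝 y) := by
  have hc : ContinuousAt h y := hh.continuousAt (hΘ.mem_nhds hy)
  have h1 : ContinuousAt (fun q : (E × E) × ℝ => h q.1.2) ((y, y), 0) :=
    ContinuousAt.comp (f := fun q : (E × E) × ℝ => q.1.2) (g := h) hc (by fun_prop)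
  have h2 : ContinuousAt (fun q : (E × E) × ℝ => q.1.1 + q.2 • h q.1.2) ((y, y), 0) := by fun_prop
  simpa [ContinuousAt] using h2

end Step

section Descent

variable {E : Type*} [NormedAddCommGroup E] [InnerProductSpace ℝ E] [CompleteSpace E]
  {Θ : Set E} {h : E → E} {w : E → ℝ}

/-- A C¹ function is strictly differentiable, so its linearization at y is valid for increments
between any two points near y. This is needed because both the base point and the point of
evaluation of h vary. -/
theorem eventually_descent (hΘ : IsOpen Θ) (hh : ContinuousOn h Θ) (hw : ContDiffOn ℝ 1 w Θ)
    {y : E} (hy : y ∈ Θ) {c : ℝ} (hc : ⟪h y, gradient w y⟫ < -c) :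
    ∀ᶠ q : (E × E) × ℝ in 𝓝 ((y, y), 0),
      0 ≤ q.2 → w (q.1.1 + q.2 • h q.1.2) ≤ w q.1.1 - q.2 * c := by
  have hcd : ContDiffAt ℝ 1 w y := hw.contDiffAt (hΘ.mem_nhds hy)
  have hstrict : HasStrictFDerivAt w (fderiv ℝ w y) y := hcd.hasStrictFDerivAt one_ne_zero
  have hfd : fderiv ℝ w y (h y) < -c := by
    have h1 := (hcd.differentiableAt one_ne_zero).hasGradientAt.hasFDerivAt.fderiv
    rw [h1, InnerProductSpace.toDual_apply_apply, real_inner_comm]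
    exact hc
  have hcont : ContinuousAt h y := hh.continuousAt (hΘ.mem_nhds hy)
  -- The linearization error e ‖h y‖ may use up at most half of the gap between the directional
  -- derivative and -c; the `+ 1` in the denominator covers h y = 0.
  obtain ⟨e, he, hlt⟩ : ∃ e > 0, fderiv ℝ w y (h y) + e * ‖h y‖ < -c := by
    have h0 := norm_nonneg (h y)
    refine ⟨(-c - fderiv ℝ w y (h y)) / 2 / (‖h y‖ + 1), div_pos (by linarith) (by linarith), ?_⟩
    have h1 : (-c - fderiv ℝ w y (h y)) / 2 / (‖h y‖ + 1) * ‖h y‖ ≤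
        (-c - fderiv ℝ w y (h y)) / 2 := by
      rw [div_mul_eq_mul_div, div_le_iff₀ (by positivity)]
      nlinarith [norm_nonneg (h y)]
    linarith
  have hev : ∀ᶠ x in 𝓝 y, fderiv ℝ w y (h x) + e * ‖h x‖ < -c := by
    have h1 : ContinuousAt (fun x => fderiv ℝ w y (h x) + e * ‖h x‖) y := by fun_prop
    exact h1.eventually_lt continuousAt_const hlt
  have hpair : Tendsto (fun q : (E × E) × ℝ => (q.1.1 + q.2 • h q.1.2, q.1.1))
      (𝓝 ((y, y), 0)) (𝓝 (y, y)) := by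
    rw [nhds_prod_eq (x := y) (y := y)]
    refine (tendsto_step hΘ hh hy).prodMk ?_
    exact (continuous_fst.comp continuous_fst).tendsto' _ _ rfl
  have hsnd : Tendsto (fun q : (E × E) × ℝ => q.1.2) (𝓝 ((y, y), 0)) (𝓝 y) :=
    (continuous_snd.comp continuous_fst).tendsto' _ _ rfl
  filter_upwards [hpair.eventually (hstrict.isLittleO.def he), hsnd.eventually hev] with q h1 h2 h3
  simp only [add_sub_cancel_left, map_smul, smul_eq_mul, norm_smul, Real.norm_eq_abs,
    abs_of_nonneg h3] at h1
  have h4 := (abs_le.1 h1).2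
  nlinarith

/-- Strictly below level M continuity suffices; on the level itself the strict descent with c = 0
prevents an increase of w. -/
theorem eventually_step_mem_sublevel (hΘ : IsOpen Θ) (hh : ContinuousOn h Θ)
    (hw : ContDiffOn ℝ 1 w Θ) {y : E} (hy : y ∈ Θ) {M : ℝ} (hM : w y ≤ M)
    (hneg : w y = M → ⟪h y, gradient w y⟫ < 0) :
    ∀ᶠ q : (E × E) × ℝ in 𝓝 ((y, y), 0), 0 ≤ q.2 → w q.1.1 ≤ M →
      q.1.1 + q.2 • h q.1.2 ∈ Θ ∧ w (q.1.1 + q.2 • h q.1.2) ≤ M := by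
  have h1 := (tendsto_step hΘ hh hy).eventually (hΘ.mem_nhds hy)
  rcases hM.lt_or_eq with hlt | heq
  · have hcw : ContinuousAt w y := (hw.continuousOn).continuousAt (hΘ.mem_nhds hy)
    have h2 := (tendsto_step hΘ hh hy).eventually (hcw.eventually_lt continuousAt_const hlt)
    filter_upwards [h1, h2] with q k1 k2 _ _
    exact ⟨k1, k2.le⟩
  · filter_upwards [h1, eventually_descent hΘ hh hw hy (c := 0) (by simpa using hneg heq)]
      with q k1 k2 k3 k4
    exact ⟨k1, by linarith [k2 k3]⟩

theorem exists_step_mem_sublevel (hΘ : IsOpen Θ) (hh : ContinuousOn h Θ)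
    (hw : ContDiffOn ℝ 1 w Θ) {C : Set E} (hC : IsCompact C) (hCΘ : C ⊆ Θ) {M : ℝ}
    (hCM : ∀ y ∈ C, w y ≤ M) (hneg : ∀ y ∈ C, w y = M → ⟪h y, gradient w y⟫ < 0) :
    ∃ δ > 0, ∀ y ∈ C, ∀ x γ, ‖x - y‖ ≤ δ → 0 ≤ γ → γ ≤ δ →
      y + γ • h x ∈ Θ ∧ w (y + γ • h x) ≤ M := by
  obtain ⟨δ, hδ, H⟩ := exists_uniform_of_isCompact hC fun y hy =>
    eventually_step_mem_sublevel hΘ hh hw (hCΘ hy) (hCM y hy) (hneg y hy)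
  exact ⟨δ, hδ, fun y hy x γ hx hγ hγδ => H y hy x γ hx hγ hγδ hγ (hCM y hy)⟩

/-- Stability: with small steps and small cumulated noise the recursion started in `{w ≤ M₀}` does
not leave `{w ≤ M}`. -/
theorem exists_stability (hΘ : IsOpen Θ) (hh : ContinuousOn h Θ) (hw : ContDiffOn ℝ 1 w Θ)
    {M₀ M : ℝ} (hM : M₀ < M) (hC : IsCompact {y ∈ Θ | w y ≤ M₀})
    (hneg : ∀ y ∈ Θ, w y = M₀ → ⟪h y, gradient w y⟫ < 0) :
    ∃ δ > 0, ∀ (n : ℕ) (θ ξ : ℕ → E) (γ : ℕ → ℝ), θ 0 ∈ Θ → w (θ 0) ≤ M₀ →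
      (∀ k < n, θ (k + 1) = θ k + γ (k + 1) • (h (θ k) + ξ (k + 1))) →
      (∀ k, 0 ≤ γ k) → (∀ k, γ k ≤ δ) →
      (∀ k, 1 ≤ k → k ≤ n → ‖∑ i ∈ Finset.Icc 1 k, γ i • ξ i‖ ≤ δ) →
      θ n ∈ Θ ∧ w (θ n) ≤ M := by
  obtain ⟨δ₁, hδ₁, H₁⟩ := exists_step_mem_sublevel hΘ hh hw hC (fun y hy => hy.1)
    (fun y hy => hy.2) (fun y hy => hneg y hy.1)
  -- `δ₁` traps the noise-free sequence in {w ≤ M₀}; `δ₂` is such that points within `δ₂` of this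
  -- set lie in {w ≤ M}. Only the second point of the triple matters here.
  obtain ⟨δ₂, hδ₂, H₂⟩ := exists_uniform_of_isCompact hC
    (P := fun q => q.1.2 ∈ Θ ∧ w q.1.2 ≤ M) (by
      intro y hy
      have hsnd : Tendsto (fun q : (E × E) × ℝ => q.1.2) (𝓝 ((y, y), 0)) (𝓝 y) :=
        (continuous_snd.comp continuous_fst).tendsto' _ _ rfl
      have hcw : ContinuousAt w y := (hw.continuousOn).continuousAt (hΘ.mem_nhds hy.1)
      filter_upwards [hsnd.eventually (hΘ.mem_nhds hy.1), hsnd.eventually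
        (hcw.eventually_lt continuousAt_const (hy.2.trans_lt hM))] with q k1 k2
      exact ⟨k1, k2.le⟩)
  refine ⟨min δ₁ δ₂, lt_min hδ₁ hδ₂, fun n θ ξ γ h0 h0' hrec hγ0 hγ hs => ?_⟩
  have hs' : ∀ k ≤ n, ‖∑ i ∈ Finset.Icc 1 k, γ i • ξ i‖ ≤ min δ₁ δ₂ := by
    intro k hk
    rcases Nat.eq_zero_or_pos k with rfl | hk0
    · simpa using (lt_min hδ₁ hδ₂).le
    · exact hs k hk0 hk
  -- With the cumulated noise removed, each step is a pure drift step with h evaluated at `θ k`, at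
  -- distance at most the size of that noise.
  have key : ∀ k ≤ n, θ k - ∑ i ∈ Finset.Icc 1 k, γ i • ξ i ∈ {y ∈ Θ | w y ≤ M₀} := by
    intro k
    induction k with
    | zero => intro _; simpa using ⟨h0, h0'⟩
    | succ k ih =>
      intro hk
      have h1 := H₁ _ (ih (by omega)) (θ k) (γ (k + 1))
        (by simpa using (hs' k (by omega)).trans (min_le_left _ _)) (hγ0 _)
        ((hγ _).trans (min_le_left _ _))
      have h2 : θ (k + 1) - ∑ i ∈ Finset.Icc 1 (k + 1), γ i • ξ i =
          θ k - ∑ i ∈ Finset.Icc 1 k, γ i • ξ i + γ (k + 1) • h (θ k) := by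
        rw [hrec k (by omega), Finset.sum_Icc_succ_top (by omega), smul_add]
        abel
      rw [h2]
      exact h1
  exact H₂ _ (key n le_rfl) (θ n) 0
    (by simpa using (hs' n le_rfl).trans (min_le_right _ _)) le_rfl hδ₂.le

/-- Convergence of the values of the Lyapunov function. -/
theorem exists_tendsto_lyapunov [ProperSpace E] (hΘ : IsOpen Θ) (hh : ContinuousOn h Θ)
    (hw : ContDiffOn ℝ 1 w Θ)
    (hneg : ∀ y ∈ Θ, ⟪h y, gradient w y⟫ ≠ 0 → ⟪h y, gradient w y⟫ < 0)
    (hint : interior (closure (w '' {y ∈ Θ | ⟪h y, gradient w y⟫ = 0})) = ∅)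
    {K : Set E} (hK : IsCompact K) (hKΘ : K ⊆ Θ) {u v : ℕ → E} {a : ℕ → ℝ}
    (hu : ∀ n, u n ∈ K) (huv : Tendsto (fun n => u n - v n) atTop (𝓝 0))
    (hv : ∀ n, v (n + 1) = v n + a n • h (u n)) (ha0 : ∀ n, 0 ≤ a n)
    (ha : Tendsto a atTop (𝓝 0)) :
    ∃ l, Tendsto (fun n => w (v n)) atTop (𝓝 l) := by
  -- Only u lies in K; v is eventually in a compact thickening of K that is still inside Θ.
  obtain ⟨r, hr, hrsub⟩ := hK.exists_cthickening_subset_open hΘ hKΘ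
  have hK' : IsCompact (Metric.cthickening r K) := hK.cthickening
  have hsmall : ∀ e > 0, ∀ᶠ n in atTop, ‖u n - v n‖ ≤ e := by
    intro e he
    have := (tendsto_zero_iff_norm_tendsto_zero.1 huv).eventually (ge_mem_nhds he)
    exact this
  have hvK : ∀ᶠ n in atTop, v n ∈ Metric.cthickening r K := by
    filter_upwards [hsmall r hr] with n hn
    exact Metric.mem_cthickening_of_dist_le _ _ _ _ (hu n) (by
      rwa [dist_comm, dist_eq_norm])
  have hwK : ContinuousOn w (Metric.cthickening r K) := hw.continuousOn.mono hrsub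
  have hbdd := hK'.image_of_continuousOn hwK
  -- Between α and β there is a level c outside the closure of the critical values, as this closure
  -- has empty interior. The drift is strictly inward on {w = c}, so once w(v) is below c at a late
  -- time it stays at most c and never exceeds β again.
  refine tendsto_of_no_upcrossings dense_univ (fun α _ β _ hαβ hup => ?_) ?_ ?_
  · obtain ⟨c, hc, hcL⟩ : ∃ c ∈ Set.Ioo α β,
        c ∉ closure (w '' {y ∈ Θ | ⟪h y, gradient w y⟫ = 0}) := by
      by_contra hcon
      push Not at hcon
      have h1 : Set.Ioo α β ⊆ interior (closure (w '' {y ∈ Θ | ⟪h y, gradient w y⟫ = 0})) :=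
        interior_maximal hcon isOpen_Ioo
      rw [hint] at h1
      exact (Set.nonempty_Ioo.2 hαβ).ne_empty (Set.subset_empty_iff.1 h1)
    have hC : IsCompact (Metric.cthickening r K ∩ w ⁻¹' Set.Iic c) :=
      hK'.of_isClosed_subset (hwK.preimage_isClosed_of_isClosed hK'.isClosed isClosed_Iic)
        Set.inter_subset_left
    obtain ⟨δ, hδ, H⟩ := exists_step_mem_sublevel hΘ hh hw hC (fun y hy => hrsub hy.1)
      (fun y hy => hy.2) (fun y hy hyc => hneg y (hrsub hy.1) fun h0 =>
        hcL (subset_closure ⟨y, ⟨hrsub hy.1, h0⟩, hyc⟩))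
    have hstep : ∀ᶠ n in atTop, w (v n) ≤ c → w (v (n + 1)) ≤ c := by
      filter_upwards [hvK, hsmall δ hδ, ha.eventually (ge_mem_nhds hδ)] with n h1 h2 h3 h4
      rw [hv n]
      exact (H (v n) ⟨h1, h4⟩ (u n) (a n) h2 (ha0 n) h3).2
    obtain ⟨N, hN⟩ := eventually_atTop.1 hstep
    obtain ⟨n, hn, hlt⟩ := frequently_atTop.1 hup.1 N
    have hle : ∀ m ≥ n, w (v m) ≤ c := by
      intro m hm
      induction m, hm using Nat.le_induction with
      | base => exact (hlt.trans hc.1).le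
      | succ m hm ih => exact hN m (le_trans hn hm) ih
    obtain ⟨m, hm, hgt⟩ := frequently_atTop.1 hup.2 n
    linarith [hle m hm, hc.2]
  · obtain ⟨B, hB⟩ := hbdd.bddAbove
    exact isBoundedUnder_of_eventually_le (a := B) (hvK.mono fun n hn => hB ⟨_, hn, rfl⟩)
  · obtain ⟨B, hB⟩ := hbdd.bddBelow
    exact isBoundedUnder_of_eventually_ge (a := B) (hvK.mono fun n hn => hB ⟨_, hn, rfl⟩)

/-- Stop at the first index where the sum reaches τ / 2; the last term overshoots by at most τ / 2.
This provides a window of controlled length in the time scale of the step sizes. -/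
theorem exists_sum_range_mem_Icc {b : ℕ → ℝ} (hb0 : ∀ n, 0 ≤ b n) (hb : ¬ Summable b) {τ : ℝ}
    (hτ : 0 < τ) (hbτ : ∀ n, b n ≤ τ / 2) :
    ∃ m, τ / 2 ≤ ∑ k ∈ Finset.range m, b k ∧ ∑ k ∈ Finset.range m, b k ≤ τ := by
  classical
  have h1 := (not_summable_iff_tendsto_nat_atTop_of_nonneg hb0).1 hb
  have hex : ∃ m, τ / 2 ≤ ∑ k ∈ Finset.range m, b k :=
    (h1.eventually (eventually_ge_atTop (τ / 2))).exists
  refine ⟨Nat.find hex, Nat.find_spec hex, ?_⟩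
  rcases hm : Nat.find hex with _ | m
  · simpa using hτ.le
  · have h2 : ¬ τ / 2 ≤ ∑ k ∈ Finset.range m, b k := Nat.find_min hex (by omega)
    rw [Finset.sum_range_succ]
    linarith [hbτ m]

/-- The limit points of the recursion are critical. -/
theorem not_mapClusterPt_of_lt [ProperSpace E] (hΘ : IsOpen Θ) (hh : ContinuousOn h Θ)
    (hw : ContDiffOn ℝ 1 w Θ) {u v : ℕ → E} {a : ℕ → ℝ}
    (huv : Tendsto (fun n => u n - v n) atTop (𝓝 0))
    (hv : ∀ n, v (n + 1) = v n + a n • h (u n)) (ha0 : ∀ n, 0 ≤ a n)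
    (ha : Tendsto a atTop (𝓝 0)) (hsum : ¬ Summable a) {l : ℝ}
    (hl : Tendsto (fun n => w (v n)) atTop (𝓝 l))
    {y : E} (hy : y ∈ Θ) (hneg : ⟪h y, gradient w y⟫ < 0) : ¬ MapClusterPt y atTop u := by
  intro hcl
  obtain ⟨c, hc, hcneg⟩ : ∃ c > 0, ⟪h y, gradient w y⟫ < -c :=
    ⟨-⟪h y, gradient w y⟫ / 2, by linarith, by linarith⟩
  have hcont : ContinuousAt h y := hh.continuousAt (hΘ.mem_nhds hy)
  have hB : ∀ᶠ x in 𝓝 y, ‖h x‖ ≤ ‖h y‖ + 1 := by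
    have h1 : ContinuousAt (fun x => ‖h x‖) y := hcont.norm
    exact (h1.eventually_lt continuousAt_const (lt_add_one _)).mono fun x hx => hx.le
  set B := ‖h y‖ + 1 with hBdef
  have hBpos : 0 < B := by positivity
  obtain ⟨ρ₁, hρ₁, H₁⟩ := Metric.eventually_nhds_iff.1 (eventually_descent hΘ hh hw hy hcneg)
  obtain ⟨ρ₂, hρ₂, H₂⟩ := Metric.eventually_nhds_iff.1 hB
  set ρ := min ρ₁ ρ₂ with hρdef
  have hρ : 0 < ρ := lt_min hρ₁ hρ₂
  -- During a window of length τ the sequence v moves by at most B τ = ρ / 4, so u and v stay in the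
  -- ball of radius ρ about y, where the descent estimate and the bound on h hold.
  set τ := ρ / (4 * B) with hτdef
  have hτ : 0 < τ := by positivity
  have hBτ : B * τ = ρ / 4 := by rw [hτdef]; field_simp
  -- The window lasts at least τ / 2, so w(v) falls by at least c τ / 2 in it. Two values within c τ
  -- / 4 of a common one differ by less, which is the final contradiction.
  have hcau := Metric.cauchySeq_iff'.1 hl.cauchySeq (c * τ / 4) (by positivity)
  obtain ⟨N₁, hN₁⟩ := hcau
  obtain ⟨N₂, hN₂⟩ := eventually_atTop.1
    ((tendsto_zero_iff_norm_tendsto_zero.1 huv).eventually (gt_mem_nhds (show 0 < ρ / 8 by positivity)))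
  obtain ⟨N₃, hN₃⟩ := eventually_atTop.1 (ha.eventually (gt_mem_nhds
    (show 0 < min (τ / 2) ρ by positivity)))
  obtain ⟨n, hn, hun⟩ := frequently_atTop.1
    (hcl.frequently (Metric.ball_mem_nhds y (show 0 < ρ / 8 by positivity))) (max N₁ (max N₂ N₃))
  have hn₁ : N₁ ≤ n := (le_max_left _ _).trans hn
  have hn₂ : N₂ ≤ n := ((le_max_left _ _).trans (le_max_right _ _)).trans hn
  have hn₃ : N₃ ≤ n := ((le_max_right _ _).trans (le_max_right _ _)).trans hn
  obtain ⟨m, hm₁, hm₂⟩ := exists_sum_range_mem_Icc (b := fun k => a (k + n)) (fun k => ha0 _)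
    (fun hs => hsum ((summable_nat_add_iff n).1 hs)) hτ
    (fun k => ((hN₃ (k + n) (by omega)).le.trans (min_le_left _ _)))
  have hvn : ‖v n - y‖ < ρ / 4 := by
    have h1 := hN₂ n hn₂
    rw [dist_eq_norm] at hun
    calc ‖v n - y‖ = ‖(u n - y) - (u n - v n)‖ := by congr 1; abel
      _ ≤ ‖u n - y‖ + ‖u n - v n‖ := norm_sub_le _ _
      _ < ρ / 4 := by linarith
  have key : ∀ k ≤ m, ‖v (k + n) - v n‖ ≤ B * ∑ i ∈ Finset.range k, a (i + n) ∧
      w (v (k + n)) ≤ w (v n) - c * ∑ i ∈ Finset.range k, a (i + n) := by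
    intro k
    induction k with
    | zero => intro _; simp
    | succ k ih =>
      intro hk
      obtain ⟨ih₁, ih₂⟩ := ih (by omega)
      have hmono : ∑ i ∈ Finset.range k, a (i + n) ≤ τ :=
        (Finset.sum_le_sum_of_subset_of_nonneg (Finset.range_mono (by omega))
          fun i _ _ => ha0 _).trans hm₂
      have hvk : ‖v (k + n) - y‖ < ρ / 2 := by
        calc ‖v (k + n) - y‖ = ‖(v (k + n) - v n) + (v n - y)‖ := by congr 1; abel
          _ ≤ ‖v (k + n) - v n‖ + ‖v n - y‖ := norm_add_le _ _
          _ < ρ / 2 := by nlinarith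
      have huk : ‖u (k + n) - y‖ < ρ := by
        have h1 := hN₂ (k + n) (by omega)
        calc ‖u (k + n) - y‖ = ‖(v (k + n) - y) + (u (k + n) - v (k + n))‖ := by congr 1; abel
          _ ≤ ‖v (k + n) - y‖ + ‖u (k + n) - v (k + n)‖ := norm_add_le _ _
          _ < ρ := by linarith
      have hak := hN₃ (k + n) (by omega)
      have hB' : ‖h (u (k + n))‖ ≤ B := H₂ (by
        rw [dist_eq_norm]; exact huk.trans_le (min_le_right _ _))
      have hd := H₁ (y := ((v (k + n), u (k + n)), a (k + n))) (by
        simp only [Prod.dist_eq, Real.dist_eq, sub_zero, abs_of_nonneg (ha0 _)]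
        rw [dist_eq_norm, dist_eq_norm]
        have h3 : ρ ≤ ρ₁ := min_le_left _ _
        refine max_lt (max_lt (by linarith) (by linarith)) ?_
        exact (hak.trans_le (min_le_right _ _)).trans_le h3) (ha0 _)
      have hvs : v (k + 1 + n) = v (k + n) + a (k + n) • h (u (k + n)) := by
        rw [← hv (k + n)]; congr 1; omega
      rw [Finset.sum_range_succ, hvs]
      constructor
      · calc ‖v (k + n) + a (k + n) • h (u (k + n)) - v n‖
            = ‖(v (k + n) - v n) + a (k + n) • h (u (k + n))‖ := by congr 1; abel
          _ ≤ ‖v (k + n) - v n‖ + ‖a (k + n) • h (u (k + n))‖ := norm_add_le _ _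
          _ ≤ B * ∑ i ∈ Finset.range k, a (i + n) + a (k + n) * B := by
            rw [norm_smul, Real.norm_eq_abs, abs_of_nonneg (ha0 _)]
            exact add_le_add ih₁ (mul_le_mul_of_nonneg_left hB' (ha0 _))
          _ = _ := by ring
      · simp only at hd
        linarith
  have hfin := (key m le_rfl).2
  have h1 := hN₁ (m + n) (by omega)
  have h2 := hN₁ n hn₁
  rw [Real.dist_eq] at h1 h2
  have h3 := abs_lt.1 h1
  have h4 := abs_lt.1 h2
  nlinarith

end Descent

end AdaptiveTruncation

namespace AdaptiveTruncation

/-! ### Truncation of vectors -/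

section Trunc

variable {E : Type*} [NormedAddCommGroup E]

open Classical in
/-- The vector `v`, replaced by `0` if its norm exceeds `e`. -/
noncomputable def trunc (e : ℝ) (v : E) : E := if ‖v‖ ≤ e then v else 0

theorem trunc_of_le {e : ℝ} {v : E} (h : ‖v‖ ≤ e) : trunc e v = v := if_pos h

theorem norm_trunc_le {e : ℝ} (he : 0 ≤ e) (v : E) : ‖trunc e v‖ ≤ e := by
  unfold trunc
  split_ifs with h
  · exact h
  · simpa using he

theorem measurable_trunc [MeasurableSpace E] [BorelSpace E] (e : ℝ) :
    Measurable (trunc e : E → E) :=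
  Measurable.ite (measurableSet_le measurable_norm measurable_const) measurable_id
    measurable_const

/-- An error occurs only if ‖v‖ > e, and there ‖v‖ = ‖v‖^(1-p) ‖v‖^p with a nonpositive first
exponent. -/
theorem norm_trunc_sub_le {e p : ℝ} (he : 0 < e) (hp : 1 ≤ p) (v : E) :
    ‖trunc e v - v‖ ≤ e ^ (1 - p) * ‖v‖ ^ p := by
  unfold trunc
  split_ifs with h
  · simp only [sub_self, norm_zero]; positivity
  · push Not at h
    have hv : 0 < ‖v‖ := he.trans h
    rw [zero_sub, norm_neg]
    calc ‖v‖ = ‖v‖ ^ (1 - p) * ‖v‖ ^ p := by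
          rw [← Real.rpow_add hv]; simp
      _ ≤ _ := by
          gcongr ?_ * _
          exact Real.rpow_le_rpow_of_nonpos he h.le (by linarith)

/-- Trades a second moment for a p-th one. For p ≥ 2 one has ‖v‖² ≤ 1 + ‖v‖^p, which costs a²; for p
≤ 2 the cut-off bounds the factor (a ‖v‖)^(2-p), which costs a^p. The product on the right covers
both cases. -/
theorem norm_trunc_smul_sq_le [NormedSpace ℝ E] {e p a : ℝ} (he : 0 < e) (hp : 1 ≤ p)
    (ha : 0 ≤ a) (v : E) :
    ‖trunc e (a • v)‖ ^ 2 ≤ (1 + e ^ (2 - p)) * (a ^ 2 + a ^ p) * (1 + ‖v‖ ^ p) := by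
  have hs := norm_nonneg v
  have hsp : 0 ≤ ‖v‖ ^ p := by positivity
  have hap : 0 ≤ a ^ p := by positivity
  have hep : 0 ≤ e ^ (2 - p) := by positivity
  unfold trunc
  split_ifs with h
  · rw [norm_smul, Real.norm_eq_abs, abs_of_nonneg ha] at h ⊢
    rcases le_total 2 p with h2 | h2
    · have h3 : ‖v‖ ^ 2 ≤ 1 + ‖v‖ ^ p := by
        rcases le_total ‖v‖ 1 with h4 | h4
        · nlinarith
        · have h5 := Real.rpow_le_rpow_of_exponent_le h4 h2
          rw [Real.rpow_two] at h5
          linarith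
      calc (a * ‖v‖) ^ 2 = 1 * a ^ 2 * ‖v‖ ^ 2 := by ring
        _ ≤ (1 + e ^ (2 - p)) * (a ^ 2 + a ^ p) * (1 + ‖v‖ ^ p) := by
          gcongr <;> linarith
    · have ht : 0 ≤ a * ‖v‖ := by positivity
      calc (a * ‖v‖) ^ 2 = (a * ‖v‖) ^ (2 - p) * (a * ‖v‖) ^ p := by
            rw [← Real.rpow_add_of_nonneg ht (by linarith) (by linarith), ← Real.rpow_two]
            congr 1; ring
        _ ≤ e ^ (2 - p) * (a * ‖v‖) ^ p := by
            gcongr ?_ * _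
            exact Real.rpow_le_rpow ht h (by linarith)
        _ = e ^ (2 - p) * a ^ p * ‖v‖ ^ p := by
            rw [Real.mul_rpow ha hs]; ring
        _ ≤ _ := by
          gcongr
          · linarith
          · nlinarith
          · linarith
  · rw [norm_zero, zero_pow two_ne_zero]
    positivity

end Trunc

namespace Scheme

variable {𝒳 : Type*} [MeasurableSpace 𝒳] {d : ℕ} {Θ : Set (EuclideanSpace ℝ (Fin d))}
  (S : Scheme 𝒳 Θ)

/-! ### The transition kernels as images of the sampling kernel -/

theorem measurable_move_left (a : ℝ) (u : Bar Θ) : Measurable fun y => S.move a y u :=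
  S.measurable_move.comp (f := fun y : 𝒳 => ((a, y), u)) (by fun_prop)

theorem QJoint_apply (a : ℝ) (q : 𝒳 × Bar Θ) :
    S.QJoint (a, q) = (S.sample q).map fun y => (y, S.move a y q.2) := by
  have hm : Measurable fun q : (ℝ × (𝒳 × Bar Θ)) × 𝒳 => (q.2, S.move q.1.1 q.2 q.1.2.2) :=
    measurable_snd.prodMk (S.measurable_move.comp
      (f := fun q : (ℝ × (𝒳 × Bar Θ)) × 𝒳 => ((q.1.1, q.2), q.1.2.2)) (by fun_prop))
  unfold QJoint
  rw [Kernel.map_apply _ hm, Kernel.prod_apply, Kernel.id_apply, Measure.dirac_prod,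
    Measure.map_map hm measurable_prodMk_left, Kernel.comap_apply]
  rfl

theorem Q_apply (a : ℝ) (q : 𝒳 × Bar Θ) :
    S.Q a q = (S.sample q).map fun y => (y, S.move a y q.2) :=
  S.QJoint_apply a q

theorem algKernel_apply_QJoint (γ ε : ℕ → ℝ) (z : S.State) :
    S.algKernel γ ε z = (S.QJoint (γ z.2.2.2, S.start z)).map (S.update ε z) := by
  unfold algKernel
  rw [Kernel.map_apply _ (S.measurable_update ε), Kernel.prod_apply, Kernel.id_apply,
    Measure.dirac_prod, Measure.map_map (S.measurable_update ε) measurable_prodMk_left,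
    Kernel.comap_apply]
  rfl

theorem measurable_update_right (ε : ℕ → ℝ) (z : S.State) : Measurable (S.update ε z) :=
  (S.measurable_update ε).comp measurable_prodMk_left

theorem measurable_prodMk_move (a : ℝ) (u : Bar Θ) :
    Measurable fun y : 𝒳 => (y, S.move a y u) :=
  measurable_id.prodMk (S.measurable_move_left a u)

theorem algKernel_apply (γ ε : ℕ → ℝ) (z : S.State) :
    S.algKernel γ ε z = (S.sample (S.start z)).map fun y =>
      S.update ε z (y, S.move (γ z.2.2.2) y (S.start z).2) := by
  rw [algKernel_apply_QJoint, QJoint_apply,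
    Measure.map_map (S.measurable_update_right ε z) (S.measurable_prodMk_move _ _)]
  rfl

theorem lintegral_algKernel (γ ε : ℕ → ℝ) (z : S.State) {f : S.State → ℝ≥0∞} (hf : Measurable f) :
    ∫⁻ z', f z' ∂(S.algKernel γ ε z) =
      ∫⁻ q, f (S.update ε z q) ∂(S.Q (γ z.2.2.2) (S.start z)) := by
  rw [algKernel_apply_QJoint, lintegral_map hf (S.measurable_update_right ε z)]
  rfl

theorem update_fst (ε : ℕ → ℝ) (z : S.State) (q : 𝒳 × Bar Θ) : (S.update ε z q).1 = q := by
  unfold update; split_ifs <;> rfl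

/-! ### The truncated noise -/

/-- The centered truncation of `a H(y, θ)` at level `e`, on `θ ∈ V`. -/
noncomputable def truncNoise (V : Set Θ) (e a : ℝ) (y : 𝒳) : Bar Θ → EuclideanSpace ℝ (Fin d) :=
  Sum.elim (V.indicator fun θ => trunc e (a • S.H y θ) - ∫ y', trunc e (a • S.H y' θ) ∂(S.P θ))
    fun _ => 0

theorem measurable_truncNoise {V : Set Θ} (hV : MeasurableSet V) (e : ℝ) :
    Measurable fun q : (ℝ × 𝒳) × Bar Θ => S.truncNoise V e q.1.1 q.1.2 q.2 := by
  have hT : Measurable fun q : (ℝ × Θ) × 𝒳 => trunc e (q.1.1 • S.H q.2 q.1.2) := by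
    refine (measurable_trunc e).comp ((measurable_fst.comp measurable_fst).smul ?_)
    exact S.H_measurable.comp (measurable_snd.prodMk (measurable_snd.comp measurable_fst))
  have hI : Measurable fun q : ℝ × Θ => ∫ y', trunc e (q.1 • S.H y' q.2) ∂(S.P q.2) :=
    (StronglyMeasurable.integral_kernel_prod_right
      (κ := S.P.comap (Prod.snd : ℝ × Θ → Θ) measurable_snd)
      (f := fun q y => trunc e (q.1 • S.H y q.2)) hT.stronglyMeasurable).measurable
  refine measurable_prod_sum ?_ measurable_const
  have h1 : Measurable fun q : (ℝ × 𝒳) × Θ => trunc e (q.1.1 • S.H q.1.2 q.2) -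
      ∫ y', trunc e (q.1.1 • S.H y' q.2) ∂(S.P q.2) :=
    (hT.comp (g := fun q : (ℝ × Θ) × 𝒳 => trunc e (q.1.1 • S.H q.2 q.1.2))
      (f := fun q : (ℝ × 𝒳) × Θ => ((q.1.1, q.2), q.1.2)) (by fun_prop)).sub
      (hI.comp (f := fun q : (ℝ × 𝒳) × Θ => (q.1.1, q.2)) (by fun_prop))
  have h2 := h1.indicator (measurable_snd hV)
  convert h2 using 2 with q
  by_cases h : q.2 ∈ V <;> simp [truncNoise, h]

theorem measurable_trunc_H (e a : ℝ) (θ : Θ) : Measurable fun y => trunc e (a • S.H y θ) :=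
  (measurable_trunc e).comp
    ((S.H_measurable.comp (measurable_id.prodMk measurable_const)).const_smul a)

theorem integrable_trunc_H {e : ℝ} (he : 0 ≤ e) (a : ℝ) (θ : Θ) :
    Integrable (fun y => trunc e (a • S.H y θ)) (S.P θ) :=
  Integrable.of_bound (S.measurable_trunc_H e a θ).aestronglyMeasurable e
    (ae_of_all _ fun _ => norm_trunc_le he _)

theorem norm_integral_trunc_H_le {e : ℝ} (he : 0 ≤ e) (a : ℝ) (θ : Θ) :
    ‖∫ y, trunc e (a • S.H y θ) ∂(S.P θ)‖ ≤ e := by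
  simpa using norm_integral_le_of_norm_le_const (μ := S.P θ)
    (ae_of_all _ fun y => norm_trunc_le he (a • S.H y θ))

theorem norm_truncNoise_le {e : ℝ} (he : 0 ≤ e) (V : Set Θ) (a : ℝ) (y : 𝒳) (u : Bar Θ) :
    ‖S.truncNoise V e a y u‖ ≤ 2 * e := by
  rcases u with θ | _
  · by_cases h : θ ∈ V
    · simp only [truncNoise, Sum.elim_inl, Set.indicator_of_mem h]
      refine (norm_sub_le _ _).trans ?_
      linarith [norm_trunc_le he (a • S.H y θ), S.norm_integral_trunc_H_le he a θ]
    · simpa [truncNoise, h] using he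
  · simpa [truncNoise] using he

theorem integral_truncNoise {e : ℝ} (he : 0 ≤ e) (V : Set Θ) (a : ℝ) (q : 𝒳 × Bar Θ) :
    ∫ y, S.truncNoise V e a y q.2 ∂(S.sample q) = 0 := by
  obtain ⟨x, θ | _⟩ := q
  · rw [sample_inl]
    by_cases h : θ ∈ V
    · simp only [truncNoise, Sum.elim_inl, Set.indicator_of_mem h]
      rw [integral_sub (S.integrable_trunc_H he a θ) (integrable_const _)]
      simp
    · simp [truncNoise, h]
  · simp [truncNoise]

/-- `∫ ‖H(y, θ)‖^p P_θ(dy) ≤ m` for all `θ ∈ V`. -/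
def MomentLE (V : Set Θ) (p m : ℝ) : Prop :=
  ∀ θ ∈ V, Integrable (fun y => ‖S.H y θ‖ ^ p) (S.P θ) ∧ ∫ y, ‖S.H y θ‖ ^ p ∂(S.P θ) ≤ m

variable {S}

theorem measurable_H (S : Scheme 𝒳 Θ) (θ : Θ) : Measurable fun y => S.H y θ :=
  S.H_measurable.comp (measurable_id.prodMk measurable_const)

/-- Integrated against λ, the bound with the likelihood ratio turns all moments under P_θ, θ ∈ V,
into a multiple of the single moment of W under the reference law. -/
theorem MomentBound.exists_momentLE {p : ℝ} {W : 𝒳 → ℝ} (hW : S.MomentBound p W) {V : Set Θ}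
    (hV : IsCompact V) : ∃ m, 0 ≤ m ∧ S.MomentLE V p m := by
  have hp : 0 < p := one_pos.trans hW.one_lt
  obtain ⟨C, hC⟩ := hW.bound V hV
  have hWint : ∫⁻ x, ENNReal.ofReal (|W x| ^ p) ∂(S.P S.θref) < ∞ := by
    have h1 := (hW.memLp.integrable_norm_rpow (by simpa using hp) ENNReal.ofReal_ne_top)
    rw [ENNReal.toReal_ofReal hp.le] at h1
    exact h1.lintegral_lt_top
  set I := ∫⁻ x, ENNReal.ofReal (|W x| ^ p) ∂(S.P S.θref) with hI
  -- The constant C is not known to be nonnegative, hence `max C 0`.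
  have hbound : ∀ θ ∈ V, ∫⁻ y, ENNReal.ofReal (‖S.H y θ‖ ^ p) ∂(S.P θ) ≤
      ENNReal.ofReal (max C 0) * I := by
    intro θ hθ
    rw [hI, S.P_eq, S.P_eq, lintegral_withDensity_eq_lintegral_mul_non_measurable _
      (S.dens_measurable θ).ennreal_ofReal (ae_of_all _ fun _ => ENNReal.ofReal_lt_top),
      lintegral_withDensity_eq_lintegral_mul_non_measurable _
      (S.dens_measurable _).ennreal_ofReal (ae_of_all _ fun _ => ENNReal.ofReal_lt_top),
      ← lintegral_const_mul' _ _ ENNReal.ofReal_ne_top]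
    refine lintegral_mono fun y => ?_
    simp only [Pi.mul_apply]
    rw [← ENNReal.ofReal_mul (S.dens_nonneg _ _), ← ENNReal.ofReal_mul (S.dens_nonneg _ _),
      ← ENNReal.ofReal_mul (le_max_right _ _)]
    refine ENNReal.ofReal_le_ofReal ?_
    rw [mul_comm]
    refine (hC y θ hθ).trans (mul_le_mul_of_nonneg_right (le_max_left _ _) ?_)
    exact mul_nonneg (S.dens_nonneg _ _) (by positivity)
  have htop : ENNReal.ofReal (max C 0) * I ≠ ∞ := ENNReal.mul_ne_top ENNReal.ofReal_ne_top hWint.ne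
  refine ⟨(ENNReal.ofReal (max C 0) * I).toReal, ENNReal.toReal_nonneg, fun θ hθ => ?_⟩
  have hm : Measurable fun y => ‖S.H y θ‖ ^ p := (S.measurable_H θ).norm.pow_const p
  have h0 : 0 ≤ᵐ[S.P θ] fun y => ‖S.H y θ‖ ^ p := ae_of_all _ fun y => by positivity
  refine ⟨(lintegral_ofReal_ne_top_iff_integrable hm.aestronglyMeasurable h0).1
    (ne_top_of_le_ne_top htop (hbound θ hθ)), ?_⟩
  rw [integral_eq_lintegral_of_nonneg_ae h0 hm.aestronglyMeasurable]
  exact ENNReal.toReal_mono htop (hbound θ hθ)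

/-- The variance is at most the second moment of the cut-off move, and that is controlled by the
p-th moment. -/
theorem MomentLE.integral_truncNoise_sq_le {V : Set Θ} {p m : ℝ} (hm : S.MomentLE V p m)
    (hp : 1 ≤ p) {e a : ℝ} (he : 0 < e) (ha : 0 ≤ a) {θ : Θ} (hθ : θ ∈ V) :
    ∫⁻ y, ‖S.truncNoise V e a y (Sum.inl θ)‖ₑ ^ 2 ∂(S.P θ) ≤
      ENNReal.ofReal ((1 + e ^ (2 - p)) * (1 + m) * (a ^ 2 + a ^ p)) := by
  set T := fun y => trunc e (a • S.H y θ) with hT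
  set c := ∫ y, T y ∂(S.P θ) with hc
  have hTi : Integrable T (S.P θ) := S.integrable_trunc_H he.le a θ
  have hTm : Measurable T := S.measurable_trunc_H e a θ
  have hTsq : Integrable (fun y => ‖T y‖ ^ 2) (S.P θ) := by
    refine Integrable.of_bound (hTm.norm.pow_const 2).aestronglyMeasurable (e ^ 2)
      (ae_of_all _ fun y => ?_)
    rw [norm_pow, norm_norm]
    have := norm_trunc_le he.le (a • S.H y θ)
    gcongr
  have hTc : Integrable (fun y => ⟪c, T y⟫) (S.P θ) := hTi.const_inner c
  have h1 : ∀ y, ‖S.truncNoise V e a y (Sum.inl θ)‖ₑ ^ 2 = ENNReal.ofReal (‖T y - c‖ ^ 2) := by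
    intro y
    simp only [truncNoise, Sum.elim_inl, Set.indicator_of_mem hθ]
    rw [ENNReal.ofReal_pow (norm_nonneg _), ofReal_norm]
  have h2 : ∀ y, ‖T y - c‖ ^ 2 = ‖T y‖ ^ 2 - 2 * ⟪c, T y⟫ + ‖c‖ ^ 2 := by
    intro y
    rw [norm_sub_sq_real, real_inner_comm]
  have h12 : Integrable (fun y => ‖T y‖ ^ 2 - 2 * ⟪c, T y⟫) (S.P θ) := hTsq.sub (hTc.const_mul 2)
  have h3 : ∫ y, ‖T y - c‖ ^ 2 ∂(S.P θ) = ∫ y, ‖T y‖ ^ 2 ∂(S.P θ) - ‖c‖ ^ 2 := by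
    simp only [h2]
    rw [integral_add h12 (integrable_const _), integral_sub hTsq (hTc.const_mul 2),
      integral_const_mul, integral_inner hTi, ← hc, real_inner_self_eq_norm_sq]
    simp
    ring
  have hint : Integrable (fun y => ‖T y - c‖ ^ 2) (S.P θ) := by
    simp only [h2]
    exact h12.add (integrable_const _)
  simp only [h1]
  rw [← ofReal_integral_eq_lintegral_ofReal hint (ae_of_all _ fun y => by positivity)]
  refine ENNReal.ofReal_le_ofReal ?_
  obtain ⟨hmi, hmle⟩ := hm θ hθ
  calc ∫ y, ‖T y - c‖ ^ 2 ∂(S.P θ) ≤ ∫ y, ‖T y‖ ^ 2 ∂(S.P θ) := by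
        rw [h3]; linarith [sq_nonneg ‖c‖]
    _ ≤ ∫ y, (1 + e ^ (2 - p)) * (a ^ 2 + a ^ p) * (1 + ‖S.H y θ‖ ^ p) ∂(S.P θ) :=
        integral_mono hTsq (((integrable_const _).add hmi).const_mul _) fun y =>
          norm_trunc_smul_sq_le he hp ha _
    _ = (1 + e ^ (2 - p)) * (a ^ 2 + a ^ p) * (1 + ∫ y, ‖S.H y θ‖ ^ p ∂(S.P θ)) := by
        rw [integral_const_mul, integral_add (integrable_const _) hmi]
        simp
    _ ≤ _ := by
        rw [mul_right_comm]
        have : 0 ≤ e ^ (2 - p) := by positivity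
        have : 0 ≤ a ^ p := by positivity
        gcongr

theorem MomentLE.lintegral_sample_truncNoise_sq_le {V : Set Θ} {p m : ℝ} (hm : S.MomentLE V p m)
    (hp : 1 ≤ p) {e a : ℝ} (he : 0 < e) (ha : 0 ≤ a) (q : 𝒳 × Bar Θ) :
    ∫⁻ y, ‖S.truncNoise V e a y q.2‖ₑ ^ 2 ∂(S.sample q) ≤
      ENNReal.ofReal ((1 + e ^ (2 - p)) * (1 + m) * (a ^ 2 + a ^ p)) := by
  obtain ⟨x, θ | _⟩ := q
  · rw [sample_inl]
    by_cases h : θ ∈ V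
    · exact hm.integral_truncNoise_sq_le hp he ha h
    · simp [truncNoise, h]
  · simp [truncNoise]

/-- The bias of the cut-off: a h(θ) is the mean of the uncut move, so only the removed part
contributes, and this is of order a^p. -/
theorem MomentLE.norm_integral_trunc_sub_le {V : Set Θ} {p m : ℝ} (hm : S.MomentLE V p m)
    (hp : 1 ≤ p) {e a : ℝ} (he : 0 < e) (ha : 0 ≤ a) {θ : Θ} (hθ : θ ∈ V)
    (hi : Integrable (fun x => S.H x θ) (S.P θ)) :
    ‖∫ y, trunc e (a • S.H y θ) ∂(S.P θ) - a • S.h θ‖ ≤ e ^ (1 - p) * m * a ^ p := by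
  obtain ⟨hmi, hmle⟩ := hm θ hθ
  have h1 : ∫ y, trunc e (a • S.H y θ) ∂(S.P θ) - a • S.h θ =
      ∫ y, (trunc e (a • S.H y θ) - a • S.H y θ) ∂(S.P θ) := by
    have hia : Integrable (fun y => a • S.H y θ) (S.P θ) := hi.smul a
    rw [integral_sub (S.integrable_trunc_H he.le a θ) hia, integral_smul]
    rfl
  rw [h1]
  calc ‖∫ y, (trunc e (a • S.H y θ) - a • S.H y θ) ∂(S.P θ)‖
      ≤ ∫ y, e ^ (1 - p) * a ^ p * ‖S.H y θ‖ ^ p ∂(S.P θ) := by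
        refine norm_integral_le_of_norm_le (hmi.const_mul _) (ae_of_all _ fun y => ?_)
        refine (norm_trunc_sub_le he hp _).trans_eq ?_
        rw [norm_smul, Real.norm_eq_abs, abs_of_nonneg ha, Real.mul_rpow ha (norm_nonneg _)]
        ring
    _ ≤ _ := by
        rw [integral_const_mul, mul_right_comm]
        gcongr

theorem MomentLE.measure_le_norm_smul {V : Set Θ} {p m : ℝ} (hm : S.MomentLE V p m)
    (hp : 1 ≤ p) {a b : ℝ} (hb : 0 < b) (ha : 0 < a) {θ : Θ} (hθ : θ ∈ V) :
    S.P θ {y | b ≤ ‖a • S.H y θ‖} ≤ ENNReal.ofReal (m * (a / b) ^ p) := by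
  obtain ⟨hmi, hmle⟩ := hm θ hθ
  have h1 := mul_meas_ge_le_integral_of_nonneg (ae_of_all _ fun y => by positivity) hmi
    ((b / a) ^ p)
  have hpos : 0 < (b / a) ^ p := by positivity
  have hsub : {y | b ≤ ‖a • S.H y θ‖} ⊆ {y | (b / a) ^ p ≤ ‖S.H y θ‖ ^ p} := by
    intro y hy
    simp only [Set.mem_ofPred_eq, norm_smul, Real.norm_eq_abs, abs_of_pos ha] at hy ⊢
    refine Real.rpow_le_rpow (by positivity) ?_ (by linarith)
    rw [div_le_iff₀ ha]
    linarith
  refine (measure_mono hsub).trans ?_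
  rw [← ofReal_measureReal]
  refine ENNReal.ofReal_le_ofReal ?_
  have h2 : (a / b) ^ p = ((b / a) ^ p)⁻¹ := by
    rw [← Real.inv_rpow (by positivity), inv_div]
  rw [h2, ← div_eq_mul_inv, le_div_iff₀ hpos]
  linarith

end Scheme

end AdaptiveTruncation

namespace AdaptiveTruncation

namespace Scheme

/-- Exhibits the rejection event as an event of the history up to time n, as the Markov property
requires. -/
theorem setOf_reject_eq_biUnion {𝒴 : Type*} {d : ℕ} {Θ : Set (EuclideanSpace ℝ (Fin d))} (ε : ℕ → ℝ)
    (K : Set Θ) (k n : ℕ) :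
    {ω : ℕ → 𝒴 × Bar Θ | ∃ l < n, ¬ Accepted (ε (k + l)) K (ω l).2 (ω (l + 1)).2} =
      Preorder.frestrictLe (π := fun _ : ℕ => 𝒴 × Bar Θ) n ⁻¹'
        ⋃ (l : ℕ) (hl : l < n), {x | ¬ Accepted (ε (k + l)) K (x ⟨l, Finset.mem_Iic.2 hl.le⟩).2
          (x ⟨l + 1, Finset.mem_Iic.2 hl⟩).2} := by
  ext ω
  simp [Preorder.frestrictLe]

variable {𝒳 : Type*} [MeasurableSpace 𝒳] {d : ℕ} {Θ : Set (EuclideanSpace ℝ (Fin d))}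
  (S : Scheme 𝒳 Θ) (γ ε : ℕ → ℝ)

/-! ### Backward recursions for the probability of a truncation -/

open Classical in
/-- The probability that one of the first `R` moves of the chain started at `q`, with step sizes
`γ_k, γ_{k+1}, …`, is not accepted. -/
noncomputable def rejectProb (K : Set Θ) : ℕ → ℕ → 𝒳 × Bar Θ → ℝ≥0∞
  | 0, _, _ => 0
  | R + 1, k, q => ∫⁻ q', (if Accepted (ε k) K q.2 q'.2 then rejectProb K R (k + 1) q' else 1)
      ∂(S.Q (γ k) q)

/-- The probability that the algorithm started in the state `z` has reached the truncation index `j`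
after `R` steps. -/
noncomputable def reachProb (j : ℕ) : ℕ → S.State → ℝ≥0∞
  | 0, z => if j ≤ z.2.1 then 1 else 0
  | R + 1, z => ∫⁻ z', reachProb j R z' ∂(S.algKernel γ ε z)

theorem measurableSet_accepted_pair (e : ℝ) {K : Set Θ} (hK : MeasurableSet K) :
    MeasurableSet {q : (𝒳 × Bar Θ) × (𝒳 × Bar Θ) | Accepted e K q.1.2 q.2.2} :=
  (measurableSet_accepted e hK).preimage
    (f := fun q : (𝒳 × Bar Θ) × (𝒳 × Bar Θ) => (q.1.2, q.2.2)) (by fun_prop)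

theorem measurable_rejectProb {K : Set Θ} (hK : MeasurableSet K) (R k : ℕ) :
    Measurable (S.rejectProb γ ε K R k) := by
  classical
  induction R generalizing k with
  | zero => exact measurable_const
  | succ R ih =>
    refine Measurable.lintegral_kernel_prod_right' (κ := S.Q (γ k))
      (f := fun q : (𝒳 × Bar Θ) × (𝒳 × Bar Θ) =>
        if Accepted (ε k) K q.1.2 q.2.2 then S.rejectProb γ ε K R (k + 1) q.2 else 1) ?_
    exact Measurable.ite (measurableSet_accepted_pair _ hK) ((ih _).comp measurable_snd)
      measurable_const

theorem measurable_reachProb (j R : ℕ) : Measurable (S.reachProb γ ε j R) := by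
  induction R with
  | zero =>
    exact (measurable_of_countable fun c : ℕ × ℕ × ℕ => if j ≤ c.1 then (1 : ℝ≥0∞) else 0).comp
      measurable_snd
  | succ R ih => exact ih.lintegral_kernel

section Reach

variable {S γ ε}

theorem reachProb_eq_one {j : ℕ} (R : ℕ) {z : S.State} (h : j ≤ z.2.1) :
    S.reachProb γ ε j R z = 1 := by
  induction R generalizing z with
  | zero => exact if_pos h
  | succ R ih =>
    change ∫⁻ z', S.reachProb γ ε j R z' ∂(S.algKernel γ ε z) = 1
    rw [lintegral_algKernel _ _ _ _ (S.measurable_reachProb γ ε j R)]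
    have h1 : ∀ q, S.reachProb γ ε j R (S.update ε z q) = 1 := fun q => ih (by
      unfold update
      split_ifs
      · exact h
      · exact h.trans (Nat.le_succ _))
    simp [h1]

theorem reachProb_le_one (j R : ℕ) (z : S.State) : S.reachProb γ ε j R z ≤ 1 := by
  induction R generalizing z with
  | zero => unfold reachProb; split_ifs <;> simp
  | succ R ih =>
    change ∫⁻ z', S.reachProb γ ε j R z' ∂(S.algKernel γ ε z) ≤ 1
    exact (lintegral_mono ih).trans (by simp)

/-- Until the next truncation the algorithm is the chain without truncation: the active set is
fixed, ζ advances by one per move, and after an accepted move ν is nonzero, so the next step starts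
from the current point. The two backward recursions therefore coincide. -/
theorem reachProb_succ_eq_rejectProb (R : ℕ) (z : S.State) :
    S.reachProb γ ε (z.2.1 + 1) R z =
      S.rejectProb γ ε (S.K z.2.1) R z.2.2.2 (S.start z) := by
  induction R generalizing z with
  | zero => simp [reachProb, rejectProb]
  | succ R ih =>
    change ∫⁻ z', S.reachProb γ ε (z.2.1 + 1) R z' ∂(S.algKernel γ ε z) = _
    rw [lintegral_algKernel _ _ _ _ (S.measurable_reachProb γ ε _ R), rejectProb]
    refine lintegral_congr fun q => ?_
    by_cases h : Accepted (ε z.2.2.2) (S.K z.2.1) (S.start z).2 q.2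
    · have hu : S.update ε z q = (q, z.2.1, z.2.2.1 + 1, z.2.2.2 + 1) := by simp [update, h]
      have h2 := ih (S.update ε z q)
      rw [hu] at h2 ⊢
      simp only [h, if_true]
      rw [h2]
      simp [start]
    · have hu : S.update ε z q = (q, z.2.1 + 1, 0, ((z.2.2.2 : ℤ) + S.φ z.2.2.1).toNat) := by
        simp [update, h]
      rw [if_neg h, hu]
      exact reachProb_eq_one R le_rfl

/-- The relation `κ + ν ≤ ζ` between the counters. -/
def CountersLE (z : S.State) : Prop := z.2.1 + z.2.2.1 ≤ z.2.2.2

/-- At a truncation φ(ν) ≥ 1 - ν gives ζ + φ(ν) ≥ κ + 1, so `toNat` changes nothing there. The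
invariant forces ζ to be at least the number of truncations. -/
theorem CountersLE.update {z : S.State} (hz : CountersLE z) (ε : ℕ → ℝ) (q : 𝒳 × Bar Θ) :
    CountersLE (S.update ε z q) := by
  unfold CountersLE at *
  unfold Scheme.update
  split_ifs
  · simp only; omega
  · have := S.φ_gt z.2.2.1
    simp only; omega

/-- The strong Markov property at truncations, as an induction on the remaining steps. An accepted
move keeps κ and r; a rejected one opens a block at κ + 1 with ν = 0, whose end has probability at
most B, and lowers r by one. The last factor on the right stands for the end of the block already
under way, to which B need not apply. -/
theorem reachProb_le_pow_mul {m : ℕ} {B : ℝ≥0∞}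
    (hB : ∀ z : S.State, CountersLE z → m ≤ z.2.1 → z.2.2.1 = 0 → ∀ R,
      S.reachProb γ ε (z.2.1 + 1) R z ≤ B) (R r : ℕ) (z : S.State) (hz : CountersLE z)
    (hm : m ≤ z.2.1) :
    S.reachProb γ ε (z.2.1 + 1 + r) R z ≤ B ^ r * S.reachProb γ ε (z.2.1 + 1) R z := by
  induction R generalizing z r with
  | zero =>
    have : ¬ z.2.1 + 1 + r ≤ z.2.1 := by omega
    simp [reachProb, this]
  | succ R ih =>
    change ∫⁻ z', S.reachProb γ ε _ R z' ∂(S.algKernel γ ε z) ≤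
      B ^ r * ∫⁻ z', S.reachProb γ ε _ R z' ∂(S.algKernel γ ε z)
    rw [lintegral_algKernel _ _ _ _ (S.measurable_reachProb γ ε _ R),
      lintegral_algKernel _ _ _ _ (S.measurable_reachProb γ ε _ R), ← lintegral_const_mul _
      (show Measurable fun q => S.reachProb γ ε (z.2.1 + 1) R (S.update ε z q) from
        (S.measurable_reachProb γ ε _ R).comp (S.measurable_update_right ε z))]
    refine lintegral_mono fun q => ?_
    have hz' := hz.update ε q
    by_cases h : Accepted (ε z.2.2.2) (S.K z.2.1) (S.start z).2 q.2
    · have hu : S.update ε z q = (q, z.2.1, z.2.2.1 + 1, z.2.2.2 + 1) := by simp [Scheme.update, h]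
      have h2 := ih r (S.update ε z q) hz' (by rw [hu]; exact hm)
      rw [hu] at h2 ⊢
      exact h2
    · have hu : S.update ε z q = (q, z.2.1 + 1, 0, ((z.2.2.2 : ℤ) + S.φ z.2.2.1).toNat) := by
        simp [Scheme.update, h]
      have h1 : S.reachProb γ ε (z.2.1 + 1) R (S.update ε z q) = 1 :=
        reachProb_eq_one R (by rw [hu])
      simp only
      rw [h1, mul_one]
      rcases r with _ | r
      · simpa using reachProb_le_one _ _ _
      · have hm' : m ≤ (S.update ε z q).2.1 := by rw [hu]; exact hm.trans (Nat.le_succ _)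
        have h2 := ih r (S.update ε z q) hz' hm'
        have h3 := hB (S.update ε z q) hz' hm' (by rw [hu]) R
        have h4 : (S.update ε z q).2.1 = z.2.1 + 1 := by rw [hu]
        rw [h4] at h2 h3
        rw [show z.2.1 + 1 + (r + 1) = z.2.1 + 1 + 1 + r by omega, pow_succ]
        exact h2.trans (mul_le_mul_right h3 _)

/-- Covers the blocks below index m, for which no bound is available. As κ grows by one at a time
and ν is then reset, index m can only be entered at the start of a block. -/
theorem reachProb_le_pow {m : ℕ} {B : ℝ≥0∞}
    (hB : ∀ z : S.State, CountersLE z → m ≤ z.2.1 → z.2.2.1 = 0 → ∀ R,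
      S.reachProb γ ε (z.2.1 + 1) R z ≤ B) (R r : ℕ) (z : S.State) (hz : CountersLE z)
    (hm : z.2.1 < m ∨ z.2.1 = m ∧ z.2.2.1 = 0) :
    S.reachProb γ ε (m + r) R z ≤ B ^ r := by
  have hstart : ∀ R (z : S.State), CountersLE z → z.2.1 = m → z.2.2.1 = 0 →
      S.reachProb γ ε (m + r) R z ≤ B ^ r := by
    intro R z hz h1 h2
    rcases r with _ | r
    · simpa using reachProb_le_one _ _ _
    · have h3 := reachProb_le_pow_mul hB R r z hz h1.ge
      rw [h1] at h3
      rw [show m + (r + 1) = m + 1 + r by omega, pow_succ]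
      refine h3.trans (mul_le_mul_right ?_ _)
      simpa [h1] using hB z hz h1.ge h2 R
  induction R generalizing z with
  | zero =>
    rcases hm with hm | ⟨h1, h2⟩
    · have : ¬ m + r ≤ z.2.1 := by omega
      simp [reachProb, this]
    · exact hstart 0 z hz h1 h2
  | succ R ih =>
    rcases hm with hm | ⟨h1, h2⟩
    · change ∫⁻ z', S.reachProb γ ε _ R z' ∂(S.algKernel γ ε z) ≤ _
      rw [lintegral_algKernel _ _ _ _ (S.measurable_reachProb γ ε _ R)]
      refine (lintegral_mono (g := fun _ => B ^ r) fun q => ?_).trans (by simp)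
      refine ih _ (hz.update ε q) ?_
      unfold Scheme.update
      split_ifs
      · exact Or.inl hm
      · have : z.2.1 + 1 < m ∨ z.2.1 + 1 = m := by omega
        simpa using this
    · exact hstart _ z hz h1 h2

end Reach

theorem algLaw_reach (x : 𝒳) (θ : Θ) (j N : ℕ) :
    S.algLaw γ ε x θ {ω | j ≤ S.kap N ω} =
      S.reachProb γ ε j N ((x, Sum.inl θ), 0, 0, 0) := by
  -- By Chapman-Kolmogorov, a step of the path can be exchanged for a step of the backward
  -- recursion.
  have h1 : ∀ R n, ∫⁻ ω, S.reachProb γ ε j R (ω n) ∂(S.algLaw γ ε x θ) =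
      S.reachProb γ ε j (R + n) ((x, Sum.inl θ), 0, 0, 0) := by
    intro R n
    induction n generalizing R with
    | zero => exact lintegral_chainLaw_zero _ _ (S.measurable_reachProb γ ε j R)
    | succ n ih =>
      have h2 := lintegral_chainLaw_succ (fun _ => S.algKernel γ ε) ((x, Sum.inl θ), 0, 0, 0)
        (n := n) (S.measurable_reachProb γ ε j R)
      refine h2.trans ?_
      have h3 := ih (R + 1)
      rw [show R + (n + 1) = R + 1 + n by omega, ← h3]
      rfl
  have hmeas : MeasurableSet {ω : ℕ → S.State | j ≤ S.kap N ω} :=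
    ((measurable_fst.comp measurable_snd).comp (measurable_pi_apply N)) (measurableSet_Ici (a := j))
  have h2 := h1 0 N
  rw [zero_add] at h2
  rw [← h2, ← lintegral_indicator_one hmeas]
  refine lintegral_congr fun ω => ?_
  by_cases h : j ≤ S.kap N ω
  · simp [h, reachProb_eq_one 0 (show j ≤ (ω N).2.1 from h)]
  · have h' : ¬ j ≤ (ω N).2.1 := h
    simp [h, reachProb, h']

/-! ### Comparison with the chain without truncation -/

theorem measurableSet_history_reject {K : Set Θ} (hK : MeasurableSet K) (k n : ℕ) :
    MeasurableSet (⋃ (l : ℕ) (hl : l < n), {x : Π _ : Finset.Iic n, 𝒳 × Bar Θ |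
      ¬ Accepted (ε (k + l)) K (x ⟨l, Finset.mem_Iic.2 hl.le⟩).2
        (x ⟨l + 1, Finset.mem_Iic.2 hl⟩).2}) := by
  refine MeasurableSet.iUnion fun l => MeasurableSet.iUnion fun hl => MeasurableSet.compl ?_
  exact (measurableSet_accepted_pair (ε (k + l)) hK).preimage
    (f := fun x : Π _ : Finset.Iic n, 𝒳 × Bar Θ =>
      (x ⟨l, Finset.mem_Iic.2 hl.le⟩, x ⟨l + 1, Finset.mem_Iic.2 hl⟩)) (by fun_prop)

/-- Identifies the backward recursion with a probability on path space. The first move under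
sequences shifted by k uses index k + 1, which is why the recursion starts there. -/
theorem pathLaw_reject {K : Set Θ} (hK : MeasurableSet K) (k : ℕ) (q : 𝒳 × Θ) (N : ℕ) :
    S.pathLaw (shift γ k) q
      {ω | ∃ l < N, ¬ Accepted (ε (k + 1 + l)) K (ω l).2 (ω (l + 1)).2} =
      S.rejectProb γ ε K N (k + 1) (q.1, Sum.inl q.2) := by
  classical
  set P := S.pathLaw (shift γ k) q with hP
  set s : ℕ → Set (ℕ → 𝒳 × Bar Θ) := fun n =>
    {ω | ∃ l < n, ¬ Accepted (ε (k + 1 + l)) K (ω l).2 (ω (l + 1)).2} with hs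
  have hsm : ∀ n, MeasurableSet (s n) := by
    intro n
    rw [hs]
    simp only
    rw [setOf_reject_eq_biUnion ε K (k + 1) n]
    exact (measurableSet_history_reject ε hK (k + 1) n).preimage (by fun_prop)
  -- Interpolates between path event and recursion: a rejection occurs among the first n moves, or
  -- else the recursion accounts for the remaining R moves from `ω n`. The case n = 0 is the claim.
  have key : ∀ R n, P (s (n + R)) =
      P (s n) + ∫⁻ ω in (s n)ᶜ, S.rejectProb γ ε K R (k + 1 + n) (ω n) ∂P := by
    intro R
    induction R with
    | zero => intro n; simp [rejectProb]
    | succ R ih =>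
      intro n
      rw [show n + (R + 1) = n + 1 + R by omega, ih (n + 1)]
      set a : Set (ℕ → 𝒳 × Bar Θ) :=
        {ω | Accepted (ε (k + 1 + n)) K (ω n).2 (ω (n + 1)).2} with ha
      have ham : MeasurableSet a :=
        (measurableSet_accepted_pair (ε (k + 1 + n)) hK).preimage
          (f := fun ω : ℕ → 𝒳 × Bar Θ => (ω n, ω (n + 1))) (by fun_prop)
      have hsucc : s (n + 1) = s n ∪ ((s n)ᶜ ∩ aᶜ) := by
        ext ω
        simp only [hs, ha, Set.mem_union, Set.mem_inter_iff, Set.mem_compl_iff, Set.mem_ofPred_eq]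
        constructor
        · rintro ⟨l, hl, h⟩
          by_cases hc : ∃ l < n, ¬ Accepted (ε (k + 1 + l)) K (ω l).2 (ω (l + 1)).2
          · exact Or.inl hc
          · rcases Nat.lt_succ_iff_lt_or_eq.1 hl with h1 | rfl
            · exact absurd ⟨l, h1, h⟩ hc
            · exact Or.inr ⟨hc, h⟩
        · rintro (⟨l, hl, h⟩ | ⟨-, h⟩)
          · exact ⟨l, by omega, h⟩
          · exact ⟨n, by omega, h⟩
      have hcompl : (s (n + 1))ᶜ = (s n)ᶜ ∩ a := by
        rw [hsucc, Set.compl_union, Set.compl_inter, compl_compl, compl_compl,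
          Set.inter_union_distrib_left]
        simp
      have h1 : P (s (n + 1)) = P (s n) + P ((s n)ᶜ ∩ aᶜ) := by
        rw [hsucc, measure_union _ ((hsm n).compl.inter ham.compl)]
        exact Set.disjoint_left.2 fun ω h1 h2 => h2.1 h1
      have hF : Measurable fun r : (𝒳 × Bar Θ) × (𝒳 × Bar Θ) =>
          if Accepted (ε (k + 1 + n)) K r.1.2 r.2.2 then
            S.rejectProb γ ε K R (k + 1 + n + 1) r.2 else 1 :=
        Measurable.ite (measurableSet_accepted_pair _ hK)
          ((S.measurable_rejectProb γ ε hK R _).comp measurable_snd) measurable_const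
      have hset : (s n)ᶜ = Preorder.frestrictLe (π := fun _ : ℕ => 𝒳 × Bar Θ) n ⁻¹'
          (⋃ (l : ℕ) (hl : l < n), {x : Π _ : Finset.Iic n, 𝒳 × Bar Θ |
            ¬ Accepted (ε (k + 1 + l)) K (x ⟨l, Finset.mem_Iic.2 hl.le⟩).2
              (x ⟨l + 1, Finset.mem_Iic.2 hl⟩).2})ᶜ := by
        rw [Set.preimage_compl, ← setOf_reject_eq_biUnion ε K (k + 1) n]
      have h2 := setLIntegral_chainLaw (fun n => S.Q (shift γ k (n + 1))) (q.1, Sum.inl q.2)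
        (measurableSet_history_reject ε hK (k + 1) n).compl hF
      rw [← hset] at h2
      have h3 : ∫⁻ ω in (s n)ᶜ, S.rejectProb γ ε K (R + 1) (k + 1 + n) (ω n) ∂P =
          ∫⁻ ω in (s n)ᶜ, (if Accepted (ε (k + 1 + n)) K (ω n).2 (ω (n + 1)).2 then
            S.rejectProb γ ε K R (k + 1 + n + 1) (ω (n + 1)) else 1) ∂P := by
        refine Eq.trans ?_ h2.symm
        refine lintegral_congr fun ω => ?_
        rw [rejectProb, show shift γ k (n + 1) = γ (k + 1 + n) by unfold shift; congr 1; omega]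
      rw [h1, add_assoc, h3]
      congr 1
      rw [← lintegral_inter_add_sdiff _ (s n)ᶜ ham, add_comm, hcompl, Set.sdiff_eq]
      congr 1
      · refine setLIntegral_congr_fun ((hsm n).compl.inter ham) fun ω hω => ?_
        exact (if_pos hω.2).symm
      · rw [← setLIntegral_one]
        refine setLIntegral_congr_fun ((hsm n).compl.inter ham.compl) fun ω hω => ?_
        exact (if_neg hω.2).symm
  have h0 := key N 0
  have hs0 : s 0 = ∅ := by simp [hs]
  rw [zero_add, hs0, measure_empty, zero_add, Set.compl_empty, setLIntegral_univ] at h0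
  change P (s N) = _
  rw [h0]
  exact lintegral_chainLaw_zero _ _ (S.measurable_rejectProb γ ε hK N _)

end Scheme

end AdaptiveTruncation

namespace AdaptiveTruncation

/-- Θ̄ embeds measurably into a Euclidean space times ℝ, the last coordinate separating the cemetery
point, and equality of functions is a measurable event there. -/
theorem measurableSet_eq_bar {d : ℕ} {Θ : Set (EuclideanSpace ℝ (Fin d))} {α : Type*}
    [MeasurableSpace α] {f g : α → Bar Θ} (hf : Measurable f) (hg : Measurable g) :
    MeasurableSet {a | f a = g a} := by
  set ι : Bar Θ → EuclideanSpace ℝ (Fin d) × ℝ :=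
    Sum.elim (fun θ => ((θ : EuclideanSpace ℝ (Fin d)), 1)) (fun _ => (0, 0)) with hι
  have hm : Measurable ι :=
    (measurable_subtype_coe.prodMk measurable_const).sumElim measurable_const
  have hinj : Function.Injective ι := by
    rintro (θ | u) (θ' | u') h
    · simp only [hι, Sum.elim_inl, Prod.mk.injEq, and_true] at h
      rw [Subtype.ext h]
    · simp [hι] at h
    · simp [hι] at h
    · rfl
  have h1 := measurableSet_eq_fun (hm.comp hf) (hm.comp hg)
  convert h1 using 1
  ext a
  exact hinj.eq_iff.symm

namespace Scheme

/-! ### Elementary properties of the exit and jump times -/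

section StoppingTimes

variable {𝒳 : Type*} {d : ℕ} {Θ : Set (EuclideanSpace ℝ (Fin d))}

theorem exists_eq_exitTime {K : Set Θ} {ω : ℕ → 𝒳 × Bar Θ} (h : exitTime K ω ≠ ⊤) :
    ∃ n : ℕ, exitTime K ω = n ∧ 1 ≤ n ∧ (ω n).2 ∉ Sum.inl '' K := by
  have hne : ((fun k : ℕ => (k : ℕ∞)) '' {k | 1 ≤ k ∧ (ω k).2 ∉ Sum.inl '' K}).Nonempty := by
    by_contra hcon
    rw [Set.not_nonempty_iff_eq_empty] at hcon
    rw [exitTime, hcon, sInf_empty] at h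
    exact h rfl
  obtain ⟨n, hn, he⟩ := csInf_mem hne
  exact ⟨n, he.symm, hn.1, hn.2⟩

theorem mem_of_lt_exitTime {K : Set Θ} {ω : ℕ → 𝒳 × Bar Θ} {k : ℕ} (hk : 1 ≤ k)
    (h : (k : ℕ∞) < exitTime K ω) : (ω k).2 ∈ Sum.inl '' K := by
  by_contra hcon
  have h1 : exitTime K ω ≤ k := sInf_le ⟨k, ⟨hk, hcon⟩, rfl⟩
  exact absurd h1 (not_le.2 h)

theorem norm_lt_of_lt_jumpTime {ε : ℕ → ℝ} {ω : ℕ → 𝒳 × Bar Θ} {k : ℕ}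
    (h : ((k + 1 : ℕ) : ℕ∞) < jumpTime ε ω) {a b : Θ} (ha : (ω k).2 = Sum.inl a)
    (hb : (ω (k + 1)).2 = Sum.inl b) :
    ‖(b : EuclideanSpace ℝ (Fin d)) - (a : EuclideanSpace ℝ (Fin d))‖ < ε (k + 1) := by
  by_contra hcon
  have h1 : jumpTime ε ω ≤ (k + 1 : ℕ) :=
    sInf_le ⟨k + 1, ⟨by omega, a, b, by simpa using ha, hb, not_lt.1 hcon⟩, rfl⟩
  exact absurd h1 (not_le.2 h)

end StoppingTimes

variable {𝒳 : Type*} [MeasurableSpace 𝒳] {d : ℕ} {Θ : Set (EuclideanSpace ℝ (Fin d))}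
  {S : Scheme 𝒳 Θ}

/-! ### The mean field on the whole space -/

open Classical in
/-- The mean field, extended by zero outside `Θ`. -/
noncomputable def meanField (S : Scheme 𝒳 Θ) (x : EuclideanSpace ℝ (Fin d)) :
    EuclideanSpace ℝ (Fin d) := if hx : x ∈ Θ then S.h ⟨x, hx⟩ else 0

theorem meanField_coe (S : Scheme 𝒳 Θ) (θ : Θ) : S.meanField θ = S.h θ := by
  simp [meanField]

/-! ### Consequences of the Lyapunov condition -/

section Lyapunov

variable {w : EuclideanSpace ℝ (Fin d) → ℝ} {M₀ M₁ : ℝ}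

theorem Lyapunov.continuousOn_meanField (hw : S.Lyapunov w M₀ M₁) : ContinuousOn S.meanField Θ := by
  rw [continuousOn_iff_continuous_domRestrict]
  convert hw.continuous_h using 1
  ext1 θ
  exact S.meanField_coe θ

theorem Lyapunov.isCompact_sublevel (hw : S.Lyapunov w M₀ M₁) {M : ℝ} (hM : M ≤ M₁) :
    IsCompact (sublevel Θ w M) := by
  have hc : Continuous fun θ : Θ => w θ :=
    continuousOn_iff_continuous_domRestrict.1 hw.contDiffOn.continuousOn
  exact hw.compact.of_isClosed_subset (isClosed_le hc continuous_const)
    fun θ (hθ : w θ ≤ M) => hθ.trans hM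

theorem Lyapunov.isCompact_setOf_le (hw : S.Lyapunov w M₀ M₁) {M : ℝ} (hM : M ≤ M₁) :
    IsCompact {y ∈ Θ | w y ≤ M} := by
  have h1 := (hw.isCompact_sublevel hM).image (continuous_subtype_val (p := (· ∈ Θ)))
  convert h1 using 1
  ext y
  simp [sublevel, and_comm]

theorem Lyapunov.inner_neg (hw : S.Lyapunov w M₀ M₁) {y : EuclideanSpace ℝ (Fin d)} (hy : y ∈ Θ)
    (hne : ⟪S.meanField y, gradient w y⟫ ≠ 0) : ⟪S.meanField y, gradient w y⟫ < 0 := by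
  have h1 := S.meanField_coe ⟨y, hy⟩
  simp only at h1
  rw [h1] at hne ⊢
  exact hw.neg ⟨y, hy⟩ hne

theorem Lyapunov.inner_neg_of_eq (hw : S.Lyapunov w M₀ M₁) {y : EuclideanSpace ℝ (Fin d)}
    (hy : y ∈ Θ) (hM : w y = M₀) : ⟪S.meanField y, gradient w y⟫ < 0 := by
  refine hw.inner_neg hy fun h0 => ?_
  have h1 := S.meanField_coe ⟨y, hy⟩
  simp only at h1
  rw [h1] at h0
  exact (hw.critSet_lt ⟨y, hy⟩ h0).ne hM

theorem exists_sublevel_subset_K (S : Scheme 𝒳 Θ) {V : Set Θ} (hV : IsCompact V) :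
    ∃ m, ∀ j ≥ m, V ⊆ S.K j := by
  have hmono : Monotone S.K := monotone_nat_of_le_succ fun j =>
    (S.K_subset j).trans interior_subset
  have hcov : V ⊆ ⋃ j, interior (S.K j) := by
    intro θ _
    have h1 : θ ∈ ⋃ j, S.K j := by rw [S.K_union]; trivial
    obtain ⟨j, hj⟩ := Set.mem_iUnion.1 h1
    exact Set.mem_iUnion.2 ⟨j + 1, S.K_subset j hj⟩
  obtain ⟨m, hm⟩ := hV.elim_directed_cover _ (fun j => isOpen_interior) hcov
    (Monotone.directed_le fun i j hij => interior_mono (hmono hij))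
  exact ⟨m, fun j hj => hm.trans (interior_subset.trans (hmono hj))⟩

/-- With steps at most `lam` and cumulated noise at most `δ`, the recursion driven by the mean field
and started in `{w ≤ M₀}` stays in `{w ≤ M}`. -/
def StableRec (S : Scheme 𝒳 Θ) (w : EuclideanSpace ℝ (Fin d) → ℝ) (M₀ M δ lam : ℝ) : Prop :=
  ∀ (n : ℕ) (θ ξ : ℕ → EuclideanSpace ℝ (Fin d)) (γ : ℕ → ℝ), θ 0 ∈ Θ → w (θ 0) ≤ M₀ →
    (∀ k < n, θ (k + 1) = θ k + γ (k + 1) • (S.meanField (θ k) + ξ (k + 1))) →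
    (∀ k, 0 ≤ γ k) → (∀ k, γ k ≤ lam) →
    (∀ k, 1 ≤ k → k ≤ n → ‖∑ i ∈ Finset.Icc 1 k, γ i • ξ i‖ ≤ δ) →
    θ n ∈ Θ ∧ w (θ n) ≤ M

theorem Lyapunov.exists_stableRec (hw : S.Lyapunov w M₀ M₁) {M : ℝ} (hM : M₀ < M) :
    ∃ δ > 0, S.StableRec w M₀ M δ δ :=
  exists_stability S.isOpen hw.continuousOn_meanField hw.contDiffOn hM
    (hw.isCompact_setOf_le hw.M₀_lt_M₁.le) fun _ hy h => hw.inner_neg_of_eq hy h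

/-- If all cumulated noise vanishes, so does each noise term, and the recursion never leaves {w ≤
M₀}. No gap between M₀ and M is needed, which is what the case M = M₀ requires. -/
theorem Lyapunov.exists_stableRec_zero (hw : S.Lyapunov w M₀ M₁) {M : ℝ} (hM : M₀ ≤ M) :
    ∃ lam > 0, S.StableRec w M₀ M 0 lam := by
  obtain ⟨lam, hlam, H⟩ := exists_step_mem_sublevel S.isOpen hw.continuousOn_meanField hw.contDiffOn
    (hw.isCompact_setOf_le hw.M₀_lt_M₁.le) (fun y hy => hy.1) (fun y hy => hy.2)
    (fun y hy h => hw.inner_neg_of_eq hy.1 h)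
  refine ⟨lam, hlam, fun n θ ξ γ h0 h0' hrec hγ0 hγ hs => ?_⟩
  have hs' : ∀ k ≤ n, ∑ i ∈ Finset.Icc 1 k, γ i • ξ i = 0 := by
    intro k hk
    rcases Nat.eq_zero_or_pos k with rfl | hk0
    · simp
    · exact norm_le_zero_iff.1 (hs k hk0 hk)
  have key : ∀ k ≤ n, θ k ∈ Θ ∧ w (θ k) ≤ M₀ := by
    intro k
    induction k with
    | zero => intro _; exact ⟨h0, h0'⟩
    | succ k ih =>
      intro hk
      have h1 := hs' (k + 1) hk
      rw [Finset.sum_Icc_succ_top (by omega), hs' k (by omega), zero_add] at h1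
      rw [hrec k (by omega), smul_add, h1, add_zero]
      exact H _ (ih (by omega)) (θ k) _ (by simpa using hlam.le) (hγ0 _) (hγ _)
  exact ⟨(key n le_rfl).1, (key n le_rfl).2.trans hM⟩

end Lyapunov

/-! ### Paths of the chain without truncation -/

/-- The parameters of the path `ω` start at `θ` and follow the moves with step sizes `γ`. -/
def FollowsMoves (S : Scheme 𝒳 Θ) (γ : ℕ → ℝ) (θ : Θ) (ω : ℕ → 𝒳 × Bar Θ) : Prop :=
  (ω 0).2 = Sum.inl θ ∧ ∀ n, (ω (n + 1)).2 = S.move (γ (n + 1)) (ω (n + 1)).1 (ω n).2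

theorem ae_followsMoves (S : Scheme 𝒳 Θ) (γ : ℕ → ℝ) (q : 𝒳 × Θ) :
    ∀ᵐ ω ∂(S.pathLaw γ q), S.FollowsMoves γ q.2 ω := by
  have h0 : ∀ᵐ ω ∂(S.pathLaw γ q), (ω 0).2 = Sum.inl q.2 :=
    ae_chainLaw_zero _ _ (s := {r : 𝒳 × Bar Θ | r.2 = Sum.inl q.2})
      (measurableSet_eq_bar measurable_snd measurable_const) rfl
  have h1 : ∀ n, ∀ᵐ ω ∂(S.pathLaw γ q),
      (ω (n + 1)).2 = S.move (γ (n + 1)) (ω (n + 1)).1 (ω n).2 := by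
    intro n
    have hm : MeasurableSet {r : (𝒳 × Bar Θ) × (𝒳 × Bar Θ) |
        r.2.2 = S.move (γ (n + 1)) r.2.1 r.1.2} :=
      measurableSet_eq_bar (by fun_prop) (S.measurable_move.comp
        (f := fun r : (𝒳 × Bar Θ) × (𝒳 × Bar Θ) => ((γ (n + 1), r.2.1), r.1.2)) (by fun_prop))
    refine ae_chainLaw_succ (fun n => S.Q (γ (n + 1))) (q.1, Sum.inl q.2) (n := n)
      (p := fun r => r.2.2 = S.move (γ (n + 1)) r.2.1 r.1.2) hm fun x => ?_
    rw [Q_apply]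
    exact (ae_map_iff (S.measurable_prodMk_move _ _).aemeasurable
      (hm.preimage measurable_prodMk_left)).2 (ae_of_all _ fun y => rfl)
  filter_upwards [h0, ae_all_iff.2 h1] with ω k0 k1 using ⟨k0, k1⟩

section Paths

variable {γ ε : ℕ → ℝ} {θ₀ : Θ} {ω : ℕ → 𝒳 × Bar Θ}

/-- Before the exit time the parameters of the path stay in `K`. -/
theorem FollowsMoves.exists_mem (hω : S.FollowsMoves γ θ₀ ω) {K : Set Θ} (hθ₀ : θ₀ ∈ K) {k : ℕ}
    (h : (k : ℕ∞) < exitTime K ω) : ∃ θ ∈ K, (ω k).2 = Sum.inl θ := by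
  rcases Nat.eq_zero_or_pos k with rfl | hk
  · exact ⟨θ₀, hθ₀, hω.1⟩
  · obtain ⟨θ, hθ, he⟩ := mem_of_lt_exitTime hk h
    exact ⟨θ, hθ, he.symm⟩

theorem move_inl_of_mem (S : Scheme 𝒳 Θ) {a : ℝ} {y : 𝒳} {θ : Θ}
    (h : (θ : EuclideanSpace ℝ (Fin d)) + a • S.H y θ ∈ Θ) :
    S.move a y (Sum.inl θ) = Sum.inl ⟨_, h⟩ := by
  simp [move, h]

theorem coe_of_move_eq_inl {a : ℝ} {y : 𝒳} {θ θ' : Θ} (h : S.move a y (Sum.inl θ) = Sum.inl θ') :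
    (θ' : EuclideanSpace ℝ (Fin d)) = (θ : EuclideanSpace ℝ (Fin d)) + a • S.H y θ := by
  simp only [move] at h
  split_ifs at h with hm
  · rw [← Sum.inl_injective h]

/-- If the noise stays small until the exit from the sublevel set, then there is no exit. -/
theorem FollowsMoves.exitTime_eq_top {w : EuclideanSpace ℝ (Fin d) → ℝ} {M₀ M δ lam : ℝ}
    (hω : S.FollowsMoves γ θ₀ ω) (hst : S.StableRec w M₀ M δ lam) (hM : M₀ ≤ M)
    (hθ₀ : w θ₀ ≤ M₀) (hγ0 : ∀ k, 0 ≤ γ k) (hγ : ∀ k, γ k ≤ lam)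
    (hle : exitTime (sublevel Θ w M) ω ≤ jumpTime ε ω)
    (hS : ∀ n, 1 ≤ n → ‖S.partialSum γ ε (sublevel Θ w M) 1 n ω‖ ≤ δ) :
    exitTime (sublevel Θ w M) ω = ⊤ := by
  by_contra hne
  obtain ⟨n, hn, hn1, hexit⟩ := exists_eq_exitTime hne
  have hmem : ∀ k < n, ∃ θ ∈ sublevel Θ w M, (ω k).2 = Sum.inl θ := fun k hk =>
    hω.exists_mem (show w θ₀ ≤ M from hθ₀.trans hM) (by rw [hn]; exact_mod_cast hk)
  -- Up to and including the exit time n the indicator in the partial sums equals one, as exit does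
  -- not come after the first large jump.
  have hsum : ∀ k, 1 ≤ k → k ≤ n →
      ‖∑ i ∈ Finset.Icc 1 k, γ i • S.noise (ω i).1 (ω (i - 1)).2‖ ≤ δ := by
    intro k hk1 hkn
    have h1 := hS k hk1
    have h2 : (k : ℕ∞) ≤ min (exitTime (sublevel Θ w M) ω) (jumpTime ε ω) := by
      rw [min_eq_left hle, hn]; exact_mod_cast hkn
    rwa [partialSum, if_pos h2] at h1
  set c : Bar Θ → EuclideanSpace ℝ (Fin d) := Sum.elim (fun θ => θ) fun _ => 0 with hc
  set Hb : 𝒳 → Bar Θ → EuclideanSpace ℝ (Fin d) := fun y => Sum.elim (S.H y) fun _ => 0 with hHb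
  -- Equal to the parameter before the exit; at time n it is the update θ + γ H in ℝ^d, even if the
  -- path has gone to the cemetery point. Stability applies to v up to time n and shows that this
  -- update lies in the sublevel set after all.
  set v : ℕ → EuclideanSpace ℝ (Fin d) := fun k =>
    if k = 0 then c (ω 0).2 else c (ω (k - 1)).2 + γ k • Hb (ω k).1 (ω (k - 1)).2 with hv
  have hvk : ∀ k < n, v k = c (ω k).2 := by
    intro k hk
    rcases k with _ | k
    · simp [hv]
    · obtain ⟨a, -, ha⟩ := hmem k (by omega)
      obtain ⟨b, -, hb⟩ := hmem (k + 1) hk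
      have h1 := hω.2 k
      rw [ha, hb] at h1
      have h2 := coe_of_move_eq_inl h1.symm
      simp only [hv, hc, hHb, Nat.add_sub_cancel, ha, hb, Sum.elim_inl, h2]
      simp
  have hrec : ∀ k < n, v (k + 1) = v k + γ (k + 1) • (S.meanField (v k) +
      S.noise (ω (k + 1)).1 (ω (k + 1 - 1)).2) := by
    intro k hk
    obtain ⟨a, -, ha⟩ := hmem k hk
    rw [hvk k hk, Nat.add_sub_cancel, ha]
    simp only [hc, Sum.elim_inl, meanField_coe, noise]
    simp [hv, hc, hHb, ha]
  have hfin := hst n v (fun i => S.noise (ω i).1 (ω (i - 1)).2) γ (by simp [hv, hc, hω.1])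
    (by simpa [hv, hc, hω.1] using hθ₀) hrec hγ0 hγ hsum
  obtain ⟨k, rfl⟩ : ∃ k, n = k + 1 := ⟨n - 1, by omega⟩
  obtain ⟨a, -, ha⟩ := hmem k (by omega)
  have hveq : v (k + 1) = (a : EuclideanSpace ℝ (Fin d)) + γ (k + 1) • S.H (ω (k + 1)).1 a := by
    simp [hv, hc, hHb, ha]
  rw [hveq] at hfin
  refine hexit ⟨⟨_, hfin.1⟩, hfin.2, ?_⟩
  rw [hω.2 k, ha, move_inl_of_mem S hfin.1]

/-- A path which leaves neither the sublevel set nor makes a large jump is always accepted. -/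
theorem FollowsMoves.accepted {V K : Set Θ} (hω : S.FollowsMoves γ θ₀ ω) (hVK : V ⊆ K)
    (hθ₀ : θ₀ ∈ V) (hσ : exitTime V ω = ⊤) (hν : jumpTime ε ω = ⊤) (l : ℕ) :
    Accepted (ε (l + 1)) K (ω l).2 (ω (l + 1)).2 := by
  obtain ⟨a, -, ha⟩ := hω.exists_mem hθ₀ (k := l) (by rw [hσ]; exact ENat.natCast_lt_top _)
  obtain ⟨b, hbV, hb⟩ := hω.exists_mem hθ₀ (k := l + 1) (by rw [hσ]; exact ENat.natCast_lt_top _)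
  exact ⟨a, b, ha, hb, (norm_lt_of_lt_jumpTime (by rw [hν]; exact ENat.natCast_lt_top _) ha hb).le,
    hVK hbV⟩

end Paths

/-- Off the two events in the definition of A, stability rules out an exit, the absence of an exit
rules out a large jump, and so every move is accepted. -/
theorem pathLaw_reject_le_A (S : Scheme 𝒳 Θ) {γ ε : ℕ → ℝ}
    {w : EuclideanSpace ℝ (Fin d) → ℝ} {M₀ M δ lam : ℝ} (hK₀ : S.K 0 ⊆ sublevel Θ w M₀)
    (hst : S.StableRec w M₀ M δ lam) (hδ : 0 ≤ δ) (hM : M₀ ≤ M) (hγ0 : ∀ k, 0 ≤ γ k)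
    (hγ : ∀ k, γ k ≤ lam) {K : Set Θ} (hK : sublevel Θ w M ⊆ K) (q : 𝒳 × Bar Θ) (N : ℕ) :
    S.pathLaw γ (S.Φ q) {ω | ∃ l < N, ¬ Accepted (ε (l + 1)) K (ω l).2 (ω (l + 1)).2} ≤
      S.A δ (sublevel Θ w M) γ ε := by
  have hθ₀ : w (S.Φ q).2 ≤ M₀ := hK₀ (S.Φ_mem q).2
  refine le_trans ?_ (le_iSup (fun q : 𝒳 × Bar Θ => S.pathLaw γ (S.Φ q)
    {ω | ENNReal.ofReal δ < ⨆ n : ℕ, ⨆ _ : 1 ≤ n, ‖S.partialSum γ ε (sublevel Θ w M) 1 n ω‖ₑ} +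
      S.pathLaw γ (S.Φ q) {ω | jumpTime ε ω < exitTime (sublevel Θ w M) ω}) q)
  refine le_trans (measure_mono_ae ?_) (measure_union_le _ _)
  filter_upwards [S.ae_followsMoves γ (S.Φ q)] with ω hω hrej
  obtain ⟨l, -, hl⟩ := hrej
  by_contra hcon
  have hcon' : ¬ ((ENNReal.ofReal δ < ⨆ n : ℕ, ⨆ _ : 1 ≤ n,
      ‖S.partialSum γ ε (sublevel Θ w M) 1 n ω‖ₑ) ∨
      jumpTime ε ω < exitTime (sublevel Θ w M) ω) := hcon
  rw [not_or, not_lt, not_lt] at hcon'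
  obtain ⟨h1, h2⟩ := hcon'
  have h3 := hω.exitTime_eq_top hst hM hθ₀ hγ0 hγ h2 fun n hn => by
    have h4 := le_trans (le_iSup₂ (f := fun (n : ℕ) (_ : 1 ≤ n) =>
      ‖S.partialSum γ ε (sublevel Θ w M) 1 n ω‖ₑ) n hn) h1
    rw [← ofReal_norm] at h4
    exact (ENNReal.ofReal_le_ofReal_iff hδ).1 h4
  rw [h3, top_le_iff] at h2
  exact hl (hω.accepted hK (show w (S.Φ q).2 ≤ M from hθ₀.trans hM) h3 h2 l)

/-! ### The geometric bound -/

theorem ae_update (S : Scheme 𝒳 Θ) (γ ε : ℕ → ℝ) (x : 𝒳) (θ : Θ) :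
    ∀ᵐ ω ∂(S.algLaw γ ε x θ), ∀ n, (ω (n + 1)).2 = (S.update ε (ω n) (ω (n + 1)).1).2 ∧
      (ω (n + 1)).1.2 = S.move (γ (ω n).2.2.2) (ω (n + 1)).1.1 (S.start (ω n)).2 := by
  refine ae_all_iff.2 fun n => ?_
  have hm1 : MeasurableSet {r : S.State × S.State | r.2.2 = (S.update ε r.1 r.2.1).2} :=
    measurableSet_eq_fun (by fun_prop) (measurable_snd.comp ((S.measurable_update ε).comp
      (f := fun r : S.State × S.State => (r.1, r.2.1)) (by fun_prop)))
  have hm2 : MeasurableSet {r : S.State × S.State |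
      r.2.1.2 = S.move (γ r.1.2.2.2) r.2.1.1 (S.start r.1).2} := by
    refine measurableSet_eq_bar (by fun_prop) (S.measurable_move.comp
      (f := fun r : S.State × S.State => ((γ r.1.2.2.2, r.2.1.1), (S.start r.1).2)) ?_)
    have h1 : Measurable fun r : S.State × S.State => γ r.1.2.2.2 :=
      (measurable_of_countable fun c : ℕ × ℕ × ℕ => γ c.2.2).comp
        (measurable_snd.comp measurable_fst)
    have h2 : Measurable fun r : S.State × S.State => (S.start r.1).2 :=
      measurable_snd.comp (S.measurable_start.comp measurable_fst)
    fun_prop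
  refine ae_chainLaw_succ (fun _ => S.algKernel γ ε) ((x, Sum.inl θ), 0, 0, 0) (n := n)
    (p := fun r => r.2.2 = (S.update ε r.1 r.2.1).2 ∧
      r.2.1.2 = S.move (γ r.1.2.2.2) r.2.1.1 (S.start r.1).2) (hm1.inter hm2) fun z => ?_
  rw [algKernel_apply]
  refine (ae_map_iff ((S.measurable_update_right ε z).comp
    (S.measurable_prodMk_move _ _)).aemeasurable
    ((hm1.inter hm2).preimage measurable_prodMk_left)).2 (ae_of_all _ fun y => ?_)
  set q := (y, S.move (γ z.2.2.2) y (S.start z).2) with hq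
  have h1 : (S.update ε z q).1 = q := S.update_fst ε z q
  change (S.update ε z q).2 = (S.update ε z (S.update ε z q).1).2 ∧
    (S.update ε z q).1.2 = S.move (γ z.2.2.2) (S.update ε z q).1.1 (S.start z).2
  rw [h1]
  exact ⟨rfl, rfl⟩

theorem update_kap_le (S : Scheme 𝒳 Θ) (ε : ℕ → ℝ) (z : S.State) (q : 𝒳 × Bar Θ) :
    z.2.1 ≤ (S.update ε z q).2.1 := by
  unfold update
  split_ifs
  · exact le_rfl
  · exact Nat.le_succ _

theorem ae_monotone_kap (S : Scheme 𝒳 Θ) (γ ε : ℕ → ℝ) (x : 𝒳) (θ : Θ) :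
    ∀ᵐ ω ∂(S.algLaw γ ε x θ), Monotone fun n => S.kap n ω := by
  filter_upwards [S.ae_update γ ε x θ] with ω hω
  refine monotone_nat_of_le_succ fun n => ?_
  unfold kap
  rw [(hω n).1]
  exact S.update_kap_le ε _ _

theorem algLaw_iSup_kap_le (S : Scheme 𝒳 Θ) (γ ε : ℕ → ℝ) (x : 𝒳) (θ : Θ) {j : ℕ} (hj : 0 < j)
    {B : ℝ≥0∞} (hB : ∀ N, S.reachProb γ ε j N ((x, Sum.inl θ), 0, 0, 0) ≤ B) :
    S.algLaw γ ε x θ {ω | (j : ℕ∞) ≤ ⨆ k : ℕ, ⨆ _ : 1 ≤ k, (S.kap k ω : ℕ∞)} ≤ B := by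
  have hsub : {ω : ℕ → S.State | (j : ℕ∞) ≤ ⨆ k : ℕ, ⨆ _ : 1 ≤ k, (S.kap k ω : ℕ∞)} ⊆
      ⋃ N, {ω | ∃ k ≤ N, j ≤ S.kap k ω} := by
    intro ω hω
    by_contra hcon
    simp only [Set.mem_iUnion, Set.mem_ofPred_eq, not_exists, not_and, not_le] at hcon
    have h1 : ⨆ k : ℕ, ⨆ _ : 1 ≤ k, (S.kap k ω : ℕ∞) ≤ ((j - 1 : ℕ) : ℕ∞) := by
      refine iSup₂_le fun k _ => ?_
      have := hcon k k le_rfl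
      exact_mod_cast (by omega : S.kap k ω ≤ j - 1)
    have h2 : (j : ℕ∞) ≤ ((j - 1 : ℕ) : ℕ∞) := le_trans hω h1
    have h3 : j ≤ j - 1 := by exact_mod_cast h2
    omega
  refine (measure_mono hsub).trans ?_
  have hmono : Monotone fun N => {ω : ℕ → S.State | ∃ k ≤ N, j ≤ S.kap k ω} :=
    fun N N' h ω ⟨k, hk, h'⟩ => ⟨k, hk.trans h, h'⟩
  rw [hmono.measure_iUnion]
  refine iSup_le fun N => le_trans (measure_mono_ae ?_) ((S.algLaw_reach γ ε x θ j N).trans_le (hB N))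
  filter_upwards [S.ae_monotone_kap γ ε x θ] with ω hω h
  obtain ⟨k, hk, hjk⟩ := h
  exact le_trans hjk (hω hk)

/-- The probability of many truncations is geometrically small, if each of the blocks between
truncations is left with small probability. -/
theorem algLaw_le_pow (S : Scheme 𝒳 Θ) (γ ε : ℕ → ℝ) {m : ℕ} (hm : 1 ≤ m) {B : ℝ≥0∞}
    (hB : ∀ k, m ≤ k + 1 → ∀ j ≥ m, ∀ q : 𝒳 × Bar Θ, ∀ N, S.pathLaw (shift γ k) (S.Φ q)
      {ω | ∃ l < N, ¬ Accepted (ε (k + 1 + l)) (S.K j) (ω l).2 (ω (l + 1)).2} ≤ B)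
    (x : 𝒳) (θ : Θ) {j : ℕ} (hj : m ≤ j) :
    S.algLaw γ ε x θ {ω | (j : ℕ∞) ≤ ⨆ k : ℕ, ⨆ _ : 1 ≤ k, (S.kap k ω : ℕ∞)} ≤ B ^ (j - m) := by
  refine S.algLaw_iSup_kap_le γ ε x θ (by omega) fun N => ?_
  obtain ⟨r, rfl⟩ := Nat.exists_eq_add_of_le hj
  rw [Nat.add_sub_cancel_left]
  refine reachProb_le_pow (m := m) (fun z hz hmz hν R => ?_) N r _ (by simp [CountersLE])
    (Or.inl (by simp only; omega))
  rw [reachProb_succ_eq_rejectProb]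
  unfold CountersLE at hz
  -- The invariant gives ζ ≥ κ ≥ m ≥ 1. A block starting with index k + 1 is the chain with
  -- sequences shifted by k.
  obtain ⟨k, hk⟩ : ∃ k, z.2.2.2 = k + 1 := ⟨z.2.2.2 - 1, by omega⟩
  rw [hk]
  have h1 := hB k (by omega) z.2.1 hmz z.1 R
  rw [S.pathLaw_reject γ ε (S.K_compact _).isClosed.measurableSet k] at h1
  have h2 : S.start z = ((S.Φ z.1).1, Sum.inl (S.Φ z.1).2) := by
    simp [start, hν, Prod.map]
  rw [h2]
  exact h1

theorem algLaw_le_A_pow (S : Scheme 𝒳 Θ) {γ ε : ℕ → ℝ} (hγ_pos : ∀ n, 0 < γ n)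
    (hγ_zero : Tendsto γ atTop (𝓝 0))
    {w : EuclideanSpace ℝ (Fin d) → ℝ} {M₀ M₁ M δ lam : ℝ} (hw : S.Lyapunov w M₀ M₁)
    (hK₀ : S.K 0 ⊆ sublevel Θ w M₀) (hst : S.StableRec w M₀ M δ lam) (hδ : 0 ≤ δ)
    (hlam : 0 < lam) (hM : M₀ ≤ M) (hM₁ : M ≤ M₁) (n : ℕ) :
    ∃ m : ℕ, ∀ x θ, ∀ j : ℕ, m ≤ j →
      S.algLaw γ ε x θ {ω | (j : ℕ∞) ≤ ⨆ k : ℕ, ⨆ _ : 1 ≤ k, (S.kap k ω : ℕ∞)} ≤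
        (⨆ k : ℕ, ⨆ _ : n ≤ k, S.A δ (sublevel Θ w M) (shift γ k) (shift ε k)) ^ (j - m) := by
  obtain ⟨m₁, hm₁⟩ := S.exists_sublevel_subset_K (hw.isCompact_sublevel hM₁)
  obtain ⟨m₂, hm₂⟩ := eventually_atTop.1 (hγ_zero.eventually (ge_mem_nhds hlam))
  -- `m₁` puts the sublevel set into the truncation sets, `m₂` makes the steps at most `lam`, `n`
  -- puts the shift into the range of the supremum, and 1 accounts for the shift being one less than
  -- ζ.
  refine ⟨m₁ + m₂ + n + 1, fun x θ j hj => S.algLaw_le_pow γ ε (by omega) ?_ x θ hj⟩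
  intro k hk j hj q N
  refine le_trans ?_ (le_iSup₂ (f := fun (k : ℕ) (_ : n ≤ k) =>
    S.A δ (sublevel Θ w M) (shift γ k) (shift ε k)) k (by omega))
  have h1 := S.pathLaw_reject_le_A (γ := shift γ k) (ε := shift ε k) hK₀ hst hδ hM
    (fun l => (hγ_pos _).le) (fun l => hm₂ _ (by omega)) (hm₁ j (by omega)) q N
  have h2 : ∀ l, shift ε k (l + 1) = ε (k + 1 + l) := fun l => by
    unfold shift; congr 1; omega
  simpa only [h2] using h1

/-- A power with a shifted exponent is dominated by the power itself, up to a constant. -/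
theorem exists_pow_sub_le (B : ℝ≥0∞) (m : ℕ) :
    ∃ C : ℝ≥0, 0 < C ∧ ∀ j > m, B ^ (j - m) ≤ C * B ^ j := by
  -- For B = 0 the strict inequality m < j matters, since 0 ^ 0 = 1.
  rcases eq_or_ne B 0 with rfl | hB
  · refine ⟨1, one_pos, fun j hj => ?_⟩
    rw [zero_pow (by omega)]
    exact zero_le
  rcases le_total 1 B with h1 | h1
  · refine ⟨1, one_pos, fun j hj => ?_⟩
    rw [ENNReal.coe_one, one_mul]
    exact pow_le_pow_right₀ h1 (Nat.sub_le _ _)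
  · have htop : B ≠ ∞ := ne_top_of_le_ne_top ENNReal.one_ne_top h1
    have hBm : B ^ m ≠ 0 := pow_ne_zero _ hB
    have hBm' : B ^ m ≠ ∞ := ENNReal.pow_ne_top htop
    refine ⟨((B ^ m)⁻¹).toNNReal, ?_, fun j hj => ?_⟩
    · exact ENNReal.toNNReal_pos (ENNReal.inv_ne_zero.2 hBm') (ENNReal.inv_ne_top.2 hBm)
    · rw [ENNReal.coe_toNNReal (ENNReal.inv_ne_top.2 hBm)]
      obtain ⟨r, rfl⟩ := Nat.exists_eq_add_of_lt hj
      rw [show m + r + 1 - m = r + 1 by omega, show m + r + 1 = m + (r + 1) by omega, pow_add B m,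
        ← mul_assoc, ENNReal.inv_mul_cancel hBm hBm', one_mul]

end Scheme

end AdaptiveTruncation

namespace AdaptiveTruncation

theorem measure_chainLaw_le {Z : Type*} [MeasurableSpace Z] (T : ℕ → Kernel Z Z)
    [∀ n, IsMarkovKernel (T n)] (z : Z) {n : ℕ} {s : Set (Z × Z)} (hs : MeasurableSet s) {c : ℝ≥0∞}
    (h : ∀ x, T n x (Prod.mk x ⁻¹' s) ≤ c) :
    chainLaw T z {ω | (ω n, ω (n + 1)) ∈ s} ≤ c := by
  have h1 := lintegral_chainLaw T z (n := n) (f := s.indicator 1) (measurable_one.indicator hs)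
  have hm : MeasurableSet {ω : ℕ → Z | (ω n, ω (n + 1)) ∈ s} :=
    hs.preimage (f := fun ω : ℕ → Z => (ω n, ω (n + 1))) (by fun_prop)
  rw [← lintegral_indicator_one hm]
  refine Eq.trans_le ?_ ((h1.trans_le (lintegral_mono (g := fun _ => c) fun ω => ?_)).trans
    (by simp))
  · rfl
  · refine le_trans (le_of_eq ?_) (h (ω n))
    rw [← lintegral_indicator_one (measurable_prodMk_left hs)]
    rfl

namespace Scheme

variable {𝒳 : Type*} [MeasurableSpace 𝒳] {d : ℕ} {Θ : Set (EuclideanSpace ℝ (Fin d))}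

/-! ### The noise of the chain without truncation -/

/-- The norm of the move `a H(y, θ)`, on `θ ∈ V`. -/
noncomputable def moveSize (S : Scheme 𝒳 Θ) (V : Set Θ) (a : ℝ) (y : 𝒳) : Bar Θ → ℝ :=
  Sum.elim (V.indicator fun θ => ‖a • S.H y θ‖) fun _ => 0

theorem measurable_moveSize (S : Scheme 𝒳 Θ) {V : Set Θ} (hV : MeasurableSet V) (a : ℝ) :
    Measurable fun q : 𝒳 × Bar Θ => S.moveSize V a q.1 q.2 := by
  refine measurable_prod_sum ?_ measurable_const
  have h1 : Measurable fun q : 𝒳 × Θ => ‖a • S.H q.1 q.2‖ := (S.H_measurable.const_smul a).norm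
  have h2 := h1.indicator (measurable_snd hV)
  convert h2 using 2 with q
  by_cases h : q.2 ∈ V <;> simp [moveSize, h]

variable {S : Scheme 𝒳 Θ}

/-- Markov's inequality for the p-th moment at each step, then a union bound. Outside V the size is
set to 0, which is below every `ε n`. -/
theorem MomentLE.measure_exists_le_moveSize {V : Set Θ} {p m : ℝ} (hm : S.MomentLE V p m)
    (hm0 : 0 ≤ m) (hp : 1 ≤ p) (hV : MeasurableSet V) {γ ε : ℕ → ℝ} (hγ : ∀ n, 0 < γ n)
    (hε : ∀ n, 0 < ε n) {r : ℝ}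
    (hr : ∀ N, ∑ n ∈ Finset.range N, (γ (n + 1) / ε (n + 1)) ^ p ≤ r) (q : 𝒳 × Θ) :
    S.pathLaw γ q {ω | ∃ n, ε (n + 1) ≤ S.moveSize V (γ (n + 1)) (ω (n + 1)).1 (ω n).2} ≤
      ENNReal.ofReal (m * r) := by
  have h1 : ∀ n, S.pathLaw γ q
      {ω | ε (n + 1) ≤ S.moveSize V (γ (n + 1)) (ω (n + 1)).1 (ω n).2} ≤
      ENNReal.ofReal (m * (γ (n + 1) / ε (n + 1)) ^ p) := by
    intro n
    have hs : MeasurableSet {r : (𝒳 × Bar Θ) × (𝒳 × Bar Θ) |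
        ε (n + 1) ≤ S.moveSize V (γ (n + 1)) r.2.1 r.1.2} :=
      measurableSet_le measurable_const ((S.measurable_moveSize hV (γ (n + 1))).comp
        (f := fun r : (𝒳 × Bar Θ) × (𝒳 × Bar Θ) => (r.2.1, r.1.2)) (by fun_prop))
    refine measure_chainLaw_le (fun n => S.Q (γ (n + 1))) (q.1, Sum.inl q.2) hs fun x => ?_
    rw [Q_apply, Measure.map_apply (S.measurable_prodMk_move _ _) (measurable_prodMk_left hs)]
    obtain ⟨x, θ | u⟩ := x
    · rw [sample_inl]
      by_cases hθ : θ ∈ V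
      · refine le_trans (measure_mono ?_) (hm.measure_le_norm_smul hp (hε (n + 1)) (hγ (n + 1)) hθ)
        intro y hy
        simpa [moveSize, hθ] using hy
      · refine le_trans (le_of_eq ?_) zero_le
        rw [← measure_empty (μ := S.P θ)]
        congr 1
        ext y
        simpa [moveSize, hθ] using hε (n + 1)
    · refine le_trans (le_of_eq ?_) zero_le
      rw [← measure_empty (μ := S.sample (x, Sum.inr u))]
      congr 1
      ext y
      simpa [moveSize] using hε (n + 1)
  have hset : {ω : ℕ → 𝒳 × Bar Θ | ∃ n, ε (n + 1) ≤
      S.moveSize V (γ (n + 1)) (ω (n + 1)).1 (ω n).2} =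
      ⋃ n, {ω | ε (n + 1) ≤ S.moveSize V (γ (n + 1)) (ω (n + 1)).1 (ω n).2} := by
    ext; simp
  rw [hset]
  refine (measure_iUnion_le _).trans ((ENNReal.tsum_le_tsum h1).trans ?_)
  refine ENNReal.tsum_le_of_sum_range_le fun N => ?_
  have h0 : ∀ n, 0 ≤ (γ (n + 1) / ε (n + 1)) ^ p := fun n =>
    Real.rpow_nonneg (div_nonneg (hγ _).le (hε _).le) _
  rw [← ENNReal.ofReal_sum_of_nonneg fun n _ => mul_nonneg hm0 (h0 n), ← Finset.mul_sum]
  exact ENNReal.ofReal_le_ofReal (mul_le_mul_of_nonneg_left (hr N) hm0)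

theorem MomentLE.measure_exists_lt_norm_sum {V : Set Θ} {p m : ℝ} (hm : S.MomentLE V p m)
    (hm0 : 0 ≤ m) (hp : 1 ≤ p) (hV : MeasurableSet V) {γ : ℕ → ℝ} (hγ : ∀ n, 0 < γ n)
    {e : ℝ} (he : 0 < e) {t : ℝ}
    (ht : ∀ N, ∑ n ∈ Finset.range N, (γ (n + 1) ^ 2 + γ (n + 1) ^ p) ≤ t) {a : ℝ} (ha : 0 < a)
    (q : 𝒳 × Θ) :
    S.pathLaw γ q {ω | ∃ N, a < ‖∑ n ∈ Finset.range N,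
      S.truncNoise V e (γ (n + 1)) (ω (n + 1)).1 (ω n).2‖} ≤
      ENNReal.ofReal (d * ((1 + e ^ (2 - p)) * (1 + m) * t / (a / d) ^ 2)) := by
  have ht0 : 0 ≤ t := by simpa using ht 0
  have he2 : 0 ≤ e ^ (2 - p) := by positivity
  set c : ℝ≥0 := ((1 + e ^ (2 - p)) * (1 + m) * t).toNNReal with hc
  have hcr : (c : ℝ) = (1 + e ^ (2 - p)) * (1 + m) * t := Real.coe_toNNReal _ (by positivity)
  set g : ℕ → (𝒳 × Bar Θ) × (𝒳 × Bar Θ) → EuclideanSpace ℝ (Fin d) := fun n r =>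
    S.truncNoise V e (γ (n + 1)) r.2.1 r.1.2 with hg
  have hgm : ∀ n, Measurable (g n) := fun n => (S.measurable_truncNoise hV e).comp
    (f := fun r : (𝒳 × Bar Θ) × (𝒳 × Bar Θ) => ((γ (n + 1), r.2.1), r.1.2)) (by fun_prop)
  have h := measure_exists_lt_norm_sum_chainLaw (fun n => S.Q (γ (n + 1))) (q.1, Sum.inl q.2)
    (g := g) (c := c) hgm (fun n => ⟨2 * e, fun r => S.norm_truncNoise_le he.le _ _ _ _⟩) ?_ ?_ ha
  · rw [hcr] at h
    exact h
  · intro n x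
    have hgx : Measurable fun y => g n (x, y) := (hgm n).comp measurable_prodMk_left
    rw [Q_apply, integral_map (S.measurable_prodMk_move _ _).aemeasurable
      hgx.aestronglyMeasurable]
    exact S.integral_truncNoise he.le V (γ (n + 1)) x
  · intro N
    have h1 : ∀ n, ∫⁻ ω, ‖g n (ω n, ω (n + 1))‖ₑ ^ 2 ∂(chainLaw (fun n => S.Q (γ (n + 1)))
        (q.1, Sum.inl q.2)) ≤
        ENNReal.ofReal ((1 + e ^ (2 - p)) * (1 + m) * (γ (n + 1) ^ 2 + γ (n + 1) ^ p)) := by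
      intro n
      rw [lintegral_chainLaw (fun n => S.Q (γ (n + 1))) (q.1, Sum.inl q.2)
        (f := fun r => ‖g n r‖ₑ ^ 2) ((hgm n).enorm.pow_const 2)]
      refine (lintegral_mono (g := fun _ => ENNReal.ofReal ((1 + e ^ (2 - p)) * (1 + m) *
        (γ (n + 1) ^ 2 + γ (n + 1) ^ p))) fun ω => ?_).trans (by simp)
      have hgx : Measurable fun y => ‖g n (ω n, y)‖ₑ ^ 2 :=
        ((hgm n).enorm.pow_const 2).comp measurable_prodMk_left
      rw [Q_apply, lintegral_map hgx (S.measurable_prodMk_move _ _)]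
      exact hm.lintegral_sample_truncNoise_sq_le hp he (hγ _).le _
    refine (Finset.sum_le_sum fun n _ => h1 n).trans ?_
    rw [← ENNReal.ofReal_sum_of_nonneg, ← Finset.mul_sum, hc]
    · exact ENNReal.ofReal_le_ofReal (mul_le_mul_of_nonneg_left (ht N) (by positivity))
    · intro n _
      have := (hγ (n + 1)).le
      positivity

theorem truncNoise_eq {V : Set Θ} {e a : ℝ} {y : 𝒳} {θ : Θ} (hθ : θ ∈ V)
    (h : ‖a • S.H y θ‖ ≤ e) :
    S.truncNoise V e a y (Sum.inl θ) = a • S.noise y (Sum.inl θ) +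
      (a • S.h θ - ∫ y', trunc e (a • S.H y' θ) ∂(S.P θ)) := by
  simp only [truncNoise, Sum.elim_inl, Set.indicator_of_mem hθ, noise, trunc_of_le h, smul_sub]
  abel

theorem moveSize_inl {V : Set Θ} {a : ℝ} {y : 𝒳} {θ : Θ} (hθ : θ ∈ V) :
    S.moveSize V a y (Sum.inl θ) = ‖a • S.H y θ‖ := by
  simp [moveSize, hθ]

theorem FollowsMoves.exitTime_le_jumpTime {γ ε : ℕ → ℝ} {θ₀ : Θ} {ω : ℕ → 𝒳 × Bar Θ} {V : Set Θ}
    (hω : S.FollowsMoves γ θ₀ ω) (hθ₀ : θ₀ ∈ V)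
    (hb : ∀ n, S.moveSize V (γ (n + 1)) (ω (n + 1)).1 (ω n).2 < ε (n + 1)) :
    exitTime V ω ≤ jumpTime ε ω := by
  by_contra hlt
  rw [not_le] at hlt
  have hne : ((fun k : ℕ => (k : ℕ∞)) '' {k | 1 ≤ k ∧ ∃ a b : Θ, (ω (k - 1)).2 = Sum.inl a ∧
    (ω k).2 = Sum.inl b ∧
      ε k ≤ ‖(b : EuclideanSpace ℝ (Fin d)) - (a : EuclideanSpace ℝ (Fin d))‖}).Nonempty := by
    by_contra hcon
    rw [Set.not_nonempty_iff_eq_empty] at hcon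
    rw [jumpTime, hcon, sInf_empty] at hlt
    exact absurd hlt not_top_lt
  obtain ⟨k, ⟨hk1, a, b, ha, hb', hle⟩, he⟩ := csInf_mem hne
  obtain ⟨n, rfl⟩ : ∃ n, k = n + 1 := ⟨k - 1, by omega⟩
  have hlt' : ((n + 1 : ℕ) : ℕ∞) < exitTime V ω := lt_of_eq_of_lt he hlt
  obtain ⟨θ, hθ, hθe⟩ := hω.exists_mem hθ₀ (k := n)
    (lt_of_le_of_lt (by exact_mod_cast Nat.le_succ n) hlt')
  rw [Nat.add_sub_cancel] at ha
  obtain rfl : a = θ := Sum.inl_injective (ha.symm.trans hθe)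
  have h1 := hω.2 n
  rw [ha, hb'] at h1
  have h2 := coe_of_move_eq_inl h1.symm
  have h3 := hb n
  rw [ha, moveSize_inl hθ] at h3
  rw [h2, add_sub_cancel_left] at hle
  linarith

/-- While no move in V is large, the cut-off is inactive, and the true noise differs from the
centered cut-off noise only by the bias, which is summed in norm. -/
theorem FollowsMoves.norm_partialSum_le {γ ε : ℕ → ℝ} {θ₀ : Θ} {ω : ℕ → 𝒳 × Bar Θ} {V : Set Θ}
    (hω : S.FollowsMoves γ θ₀ ω) (hθ₀ : θ₀ ∈ V)
    (hb : ∀ n, S.moveSize V (γ (n + 1)) (ω (n + 1)).1 (ω n).2 < ε (n + 1))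
    {e p m : ℝ} (hm : S.MomentLE V p m) (hm0 : 0 ≤ m) (hp : 1 ≤ p) (he : 0 < e)
    (hεe : ∀ n, ε n ≤ e) (hγ : ∀ n, 0 < γ n)
    (hi : ∀ θ, Integrable (fun x => S.H x θ) (S.P θ)) {t : ℝ}
    (ht : ∀ N, ∑ n ∈ Finset.range N, (γ (n + 1) ^ 2 + γ (n + 1) ^ p) ≤ t) {a : ℝ}
    (ha : ∀ N, ‖∑ n ∈ Finset.range N,
      S.truncNoise V e (γ (n + 1)) (ω (n + 1)).1 (ω n).2‖ ≤ a) (n : ℕ) :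
    ‖S.partialSum γ ε V 1 n ω‖ ≤ a + e ^ (1 - p) * m * t := by
  have ht0 : 0 ≤ t := by simpa using ht 0
  have he2 : 0 ≤ e ^ (1 - p) := by positivity
  have ha0 : 0 ≤ a := by simpa using ha 0
  unfold partialSum
  split_ifs with hn
  · have hterm : ∀ l ∈ Finset.range n, ‖γ (l + 1) • S.noise (ω (l + 1)).1 (ω l).2 -
        S.truncNoise V e (γ (l + 1)) (ω (l + 1)).1 (ω l).2‖ ≤
        e ^ (1 - p) * m * (γ (l + 1) ^ 2 + γ (l + 1) ^ p) := by
      intro l hl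
      have hln : ((l : ℕ) : ℕ∞) < exitTime V ω := by
        refine lt_of_lt_of_le ?_ (hn.trans (min_le_left _ _))
        exact_mod_cast Finset.mem_range.1 hl
      obtain ⟨θ, hθ, hθe⟩ := hω.exists_mem hθ₀ hln
      have h1 := hb l
      rw [hθe] at h1 ⊢
      rw [moveSize_inl hθ] at h1
      rw [truncNoise_eq hθ (h1.le.trans (hεe _)), sub_add_cancel_left, neg_sub]
      refine (hm.norm_integral_trunc_sub_le hp he (hγ _).le hθ (hi θ)).trans ?_
      have := sq_nonneg (γ (l + 1))
      gcongr
      linarith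
    have hre : ∑ k ∈ Finset.Icc 1 n, γ k • S.noise (ω k).1 (ω (k - 1)).2 =
        ∑ l ∈ Finset.range n, γ (l + 1) • S.noise (ω (l + 1)).1 (ω l).2 := by
      clear * -
      induction n with
      | zero => simp
      | succ n ih =>
        rw [Finset.sum_Icc_succ_top (by omega), Finset.sum_range_succ, ih, Nat.add_sub_cancel]
    rw [hre]
    calc ‖∑ l ∈ Finset.range n, γ (l + 1) • S.noise (ω (l + 1)).1 (ω l).2‖
        = ‖∑ l ∈ Finset.range n, S.truncNoise V e (γ (l + 1)) (ω (l + 1)).1 (ω l).2 +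
            ∑ l ∈ Finset.range n, (γ (l + 1) • S.noise (ω (l + 1)).1 (ω l).2 -
              S.truncNoise V e (γ (l + 1)) (ω (l + 1)).1 (ω l).2)‖ := by
          rw [← Finset.sum_add_distrib]; simp
      _ ≤ a + ∑ l ∈ Finset.range n, e ^ (1 - p) * m * (γ (l + 1) ^ 2 + γ (l + 1) ^ p) :=
          (norm_add_le _ _).trans (add_le_add (ha n) (norm_sum_le_of_le _ hterm))
      _ ≤ _ := by
          rw [← Finset.mul_sum]
          gcongr
          exact ht n
  · rw [norm_zero]; positivity

/-- If no large move occurs in V, there is no large jump before the exit, and the partial sums are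
at most δ / 2 from the martingale plus δ / 2 from the bias. The large moves are counted once for
each of the two probabilities in A. -/
theorem MomentLE.A_le {V : Set Θ} {p m : ℝ} (hm : S.MomentLE V p m)
    (hm0 : 0 ≤ m) (hp : 1 ≤ p) (hV : MeasurableSet V) (hKV : S.K 0 ⊆ V) {γ ε : ℕ → ℝ}
    (hγ : ∀ n, 0 < γ n) (hε : ∀ n, 0 < ε n) {e : ℝ} (he : 0 < e) (hεe : ∀ n, ε n ≤ e)
    (hi : ∀ θ, Integrable (fun x => S.H x θ) (S.P θ)) {r t δ : ℝ} (hδ : 0 < δ)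
    (hr : ∀ N, ∑ n ∈ Finset.range N, (γ (n + 1) / ε (n + 1)) ^ p ≤ r)
    (ht : ∀ N, ∑ n ∈ Finset.range N, (γ (n + 1) ^ 2 + γ (n + 1) ^ p) ≤ t)
    (hδt : e ^ (1 - p) * m * t ≤ δ / 2) :
    S.A δ V γ ε ≤ ENNReal.ofReal (m * r) +
      ENNReal.ofReal (d * ((1 + e ^ (2 - p)) * (1 + m) * t / (δ / 2 / d) ^ 2)) +
      ENNReal.ofReal (m * r) := by
  refine iSup_le fun q => ?_
  have hθ₀ : (S.Φ q).2 ∈ V := hKV (S.Φ_mem q).2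
  have hbad := hm.measure_exists_le_moveSize hm0 hp hV hγ hε hr (S.Φ q)
  have hmart := hm.measure_exists_lt_norm_sum hm0 hp hV hγ he ht (half_pos hδ) (S.Φ q)
  refine add_le_add (le_trans (le_trans (measure_mono_ae ?_) (measure_union_le _ _))
    (add_le_add hbad hmart)) (le_trans (measure_mono_ae ?_) hbad)
  · filter_upwards [S.ae_followsMoves γ (S.Φ q)] with ω hω h
    by_contra hcon
    have hcon' : ¬ ((∃ n, ε (n + 1) ≤ S.moveSize V (γ (n + 1)) (ω (n + 1)).1 (ω n).2) ∨
      ∃ N, δ / 2 < ‖∑ n ∈ Finset.range N,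
        S.truncNoise V e (γ (n + 1)) (ω (n + 1)).1 (ω n).2‖) := hcon
    push Not at hcon'
    have h' : ENNReal.ofReal δ < ⨆ n : ℕ, ⨆ _ : 1 ≤ n, ‖S.partialSum γ ε V 1 n ω‖ₑ := h
    refine absurd h' (not_lt.2 (iSup₂_le fun n _ => ?_))
    rw [← ofReal_norm]
    refine ENNReal.ofReal_le_ofReal ?_
    have := hω.norm_partialSum_le hθ₀ hcon'.1 hm hm0 hp he hεe hγ hi ht hcon'.2 n
    linarith
  · filter_upwards [S.ae_followsMoves γ (S.Φ q)] with ω hω h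
    by_contra hcon
    have hcon' : ¬ ∃ n, ε (n + 1) ≤ S.moveSize V (γ (n + 1)) (ω (n + 1)).1 (ω n).2 := hcon
    push Not at hcon'
    exact absurd (show jumpTime ε ω < exitTime V ω from h)
      (not_lt.2 (hω.exitTime_le_jumpTime hθ₀ hcon'))

/-! ### The step sizes -/

theorem StepSizes.summable_div {p : ℝ} {γ ε : ℕ → ℝ} (h : StepSizes p γ ε) (hγ : ∀ n, 0 < γ n)
    (hε : ∀ n, 0 < ε n) : Summable fun n => (γ n / ε n) ^ p :=
  Summable.of_nonneg_of_le (fun n => Real.rpow_nonneg (div_nonneg (hγ n).le (hε n).le) _)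
    (fun n => by linarith [sq_nonneg (γ n)]) h.summable

theorem StepSizes.summable_sq_add {p : ℝ} {γ ε : ℕ → ℝ} (h : StepSizes p γ ε) (hp : 0 ≤ p)
    (hγ : ∀ n, 0 < γ n) (hε : ∀ n, 0 < ε n) (hε_anti : Antitone ε) :
    Summable fun n => γ n ^ 2 + γ n ^ p := by
  have h0 : ∀ n, 0 ≤ (γ n / ε n) ^ p := fun n =>
    Real.rpow_nonneg (div_nonneg (hγ n).le (hε n).le) _
  refine Summable.add ?_ ?_
  · exact Summable.of_nonneg_of_le (fun n => sq_nonneg _) (fun n => by linarith [h0 n]) h.summable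
  · refine Summable.of_nonneg_of_le (fun n => Real.rpow_nonneg (hγ n).le _) (fun n => ?_)
      ((h.summable_div hγ hε).mul_left (ε 0 ^ p))
    calc γ n ^ p = ε n ^ p * (γ n / ε n) ^ p := by
          rw [← Real.mul_rpow (hε n).le (div_nonneg (hγ n).le (hε n).le),
            mul_div_cancel₀ _ (hε n).ne']
      _ ≤ _ := mul_le_mul_of_nonneg_right
          (Real.rpow_le_rpow (hε n).le (hε_anti (Nat.zero_le n)) hp) (h0 n)

theorem sum_range_shift_le_tsum {f : ℕ → ℝ} (hf : Summable f) (h0 : ∀ n, 0 ≤ f n) (k N : ℕ) :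
    ∑ n ∈ Finset.range N, f (n + 1 + k) ≤ ∑' n, f (n + (k + 1)) := by
  have h1 : Summable fun n => f (n + (k + 1)) := (summable_nat_add_iff (k + 1)).2 hf
  have h2 : ∀ n, f (n + 1 + k) = f (n + (k + 1)) := fun n => by congr 1; omega
  simp only [h2]
  exact h1.sum_le_tsum _ fun n _ => h0 _

/-- The cut-off `ε 0` dominates all shifted tolerances, so the constants do not depend on the shift
and only tails of convergent series vary with k. -/
theorem MomentBound.tendsto_A {p : ℝ} {W : 𝒳 → ℝ} (hW : S.MomentBound p W) {γ ε : ℕ → ℝ}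
    (hst : StepSizes p γ ε) (hγ : ∀ n, 0 < γ n) (hε : ∀ n, 0 < ε n) (hε_anti : Antitone ε)
    (hi : ∀ θ, Integrable (fun x => S.H x θ) (S.P θ)) {V : Set Θ} (hV : IsCompact V)
    (hKV : S.K 0 ⊆ V) {δ : ℝ} (hδ : 0 < δ) :
    Tendsto (fun k => S.A δ V (shift γ k) (shift ε k)) atTop (𝓝 0) := by
  have hp : 1 ≤ p := hW.one_lt.le
  obtain ⟨m, hm0, hm⟩ := hW.exists_momentLE hV
  set f : ℕ → ℝ := fun n => (γ n / ε n) ^ p with hf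
  set b : ℕ → ℝ := fun n => γ n ^ 2 + γ n ^ p with hb
  have hf0 : ∀ n, 0 ≤ f n := fun n => Real.rpow_nonneg (div_nonneg (hγ n).le (hε n).le) _
  have hb0 : ∀ n, 0 ≤ b n := fun n => add_nonneg (sq_nonneg _) (Real.rpow_nonneg (hγ n).le _)
  have hfs : Summable f := hst.summable_div hγ hε
  have hbs : Summable b := hst.summable_sq_add (by linarith) hγ hε hε_anti
  have hft : Tendsto (fun k => ∑' n, f (n + (k + 1))) atTop (𝓝 0) :=
    (tendsto_sum_nat_add f).comp (tendsto_add_atTop_nat 1)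
  have hbt : Tendsto (fun k => ∑' n, b (n + (k + 1))) atTop (𝓝 0) :=
    (tendsto_sum_nat_add b).comp (tendsto_add_atTop_nat 1)
  have hlim : Tendsto (fun k => ENNReal.ofReal (m * ∑' n, f (n + (k + 1))) +
      ENNReal.ofReal (d * ((1 + ε 0 ^ (2 - p)) * (1 + m) * (∑' n, b (n + (k + 1))) /
        (δ / 2 / d) ^ 2)) + ENNReal.ofReal (m * ∑' n, f (n + (k + 1)))) atTop (𝓝 0) := by
    have h1 : Tendsto (fun k => ENNReal.ofReal (m * ∑' n, f (n + (k + 1)))) atTop (𝓝 0) := by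
      rw [← ENNReal.ofReal_zero]
      exact ENNReal.tendsto_ofReal (by simpa using hft.const_mul m)
    have h2 : Tendsto (fun k => ENNReal.ofReal (d * ((1 + ε 0 ^ (2 - p)) * (1 + m) *
        (∑' n, b (n + (k + 1))) / (δ / 2 / d) ^ 2))) atTop (𝓝 0) := by
      rw [← ENNReal.ofReal_zero]
      refine ENNReal.tendsto_ofReal ?_
      simpa using ((hbt.const_mul ((1 + ε 0 ^ (2 - p)) * (1 + m))).div_const
        ((δ / 2 / d) ^ 2)).const_mul (d : ℝ)
    simpa using (h1.add h2).add h1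
  have hsmall : ∀ᶠ k in atTop, ε 0 ^ (1 - p) * m * ∑' n, b (n + (k + 1)) ≤ δ / 2 := by
    have h1 : Tendsto (fun k => ε 0 ^ (1 - p) * m * ∑' n, b (n + (k + 1))) atTop (𝓝 0) := by
      simpa using hbt.const_mul (ε 0 ^ (1 - p) * m)
    exact h1.eventually (ge_mem_nhds (half_pos hδ))
  refine tendsto_of_tendsto_of_tendsto_of_le_of_le' tendsto_const_nhds hlim
    (Eventually.of_forall fun _ => zero_le) ?_
  filter_upwards [hsmall] with k hk
  exact hm.A_le hm0 hp hV.isClosed.measurableSet hKV (fun n => hγ _) (fun n => hε _) (hε 0)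
    (fun n => hε_anti (Nat.zero_le _)) hi hδ (sum_range_shift_le_tsum hfs hf0 k)
    (sum_range_shift_le_tsum hbs hb0 k) hk

end Scheme

end AdaptiveTruncation

namespace AdaptiveTruncation

namespace Scheme

variable {𝒳 : Type*} [MeasurableSpace 𝒳] {d : ℕ} {Θ : Set (EuclideanSpace ℝ (Fin d))}
  {S : Scheme 𝒳 Θ} {γ ε : ℕ → ℝ}

/-! ### Runs of the algorithm -/

/-- The run `ω` obeys the update rules. -/
def FollowsUpdates (S : Scheme 𝒳 Θ) (γ ε : ℕ → ℝ) (ω : ℕ → S.State) : Prop :=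
  ∀ n, (ω (n + 1)).2 = (S.update ε (ω n) (ω (n + 1)).1).2 ∧
    (ω (n + 1)).1.2 = S.move (γ (ω n).2.2.2) (ω (n + 1)).1.1 (S.start (ω n)).2

section Runs

variable {ω : ℕ → S.State}

theorem FollowsUpdates.kap_le (hω : S.FollowsUpdates γ ε ω) (n : ℕ) :
    (ω n).2.1 ≤ (ω (n + 1)).2.1 := by
  rw [(hω n).1]
  exact S.update_kap_le ε _ _

theorem FollowsUpdates.monotone_kap (hω : S.FollowsUpdates γ ε ω) :
    Monotone fun n => (ω n).2.1 := monotone_nat_of_le_succ hω.kap_le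

theorem FollowsUpdates.accepted_or (hω : S.FollowsUpdates γ ε ω) (n : ℕ) :
    (Accepted (ε (ω n).2.2.2) (S.K (ω n).2.1) (S.start (ω n)).2 (ω (n + 1)).1.2 ∧
      (ω (n + 1)).2 = ((ω n).2.1, (ω n).2.2.1 + 1, (ω n).2.2.2 + 1)) ∨
      ((ω (n + 1)).2.1 = (ω n).2.1 + 1 ∧ (ω (n + 1)).2.2.1 = 0) := by
  have h1 := (hω n).1
  unfold update at h1
  split_ifs at h1 with h
  · exact Or.inl ⟨h, h1⟩
  · exact Or.inr ⟨by rw [h1], by rw [h1]⟩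

theorem FollowsUpdates.accepted_of_kap_eq (hω : S.FollowsUpdates γ ε ω) {n : ℕ}
    (h : (ω (n + 1)).2.1 = (ω n).2.1) :
    Accepted (ε (ω n).2.2.2) (S.K (ω n).2.1) (S.start (ω n)).2 (ω (n + 1)).1.2 ∧
      (ω (n + 1)).2 = ((ω n).2.1, (ω n).2.2.1 + 1, (ω n).2.2.2 + 1) := by
  rcases hω.accepted_or n with h1 | h1
  · exact h1
  · omega

theorem FollowsUpdates.zeta_add (hω : S.FollowsUpdates γ ε ω) {n i : ℕ}
    (h : (ω (n + i)).2.1 = (ω n).2.1) : (ω (n + i)).2.2.2 = (ω n).2.2.2 + i := by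
  induction i with
  | zero => rfl
  | succ i ih =>
    have h1 : (ω n).2.1 ≤ (ω (n + i)).2.1 := hω.monotone_kap (Nat.le_add_right n i)
    have h2 : (ω (n + i)).2.1 ≤ (ω (n + (i + 1))).2.1 := hω.kap_le (n + i)
    have h3 : (ω (n + i)).2.1 = (ω n).2.1 := by omega
    have h4 : (ω (n + i + 1)).2.1 = (ω (n + i)).2.1 := by rw [h3]; exact h
    have h5 := (hω.accepted_of_kap_eq h4).2
    have h6 : (ω (n + (i + 1))).2.2.2 = (ω (n + i)).2.2.2 + 1 := by
      rw [← add_assoc, h5]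
    rw [h6, ih h3, add_assoc]

/-- Within a block between truncations, every index of the step sequences is used at most once. -/
theorem FollowsUpdates.sum_block_le (hω : S.FollowsUpdates γ ε ω) {b : ℕ → ℝ} (hb : Summable b)
    (hb0 : ∀ n, 0 ≤ b n) (m N : ℕ) :
    ∑ n ∈ Finset.range N, (if (ω n).2.1 = m then b (ω n).2.2.2 else 0) ≤ ∑' n, b n := by
  rw [← Finset.sum_filter]
  -- While κ is constant every move is accepted and ζ grows by exactly one.
  have hinj : Set.InjOn (fun n => (ω n).2.2.2)
      ((Finset.range N).filter fun n => (ω n).2.1 = m : Finset ℕ) := by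
    have key : ∀ n n', (ω n).2.1 = m → (ω n').2.1 = m → n ≤ n' →
        (ω n).2.2.2 = (ω n').2.2.2 → n = n' := by
      intro n n' hn hn' hle he
      obtain ⟨i, rfl⟩ := Nat.exists_eq_add_of_le hle
      have := hω.zeta_add (hn'.trans hn.symm)
      omega
    intro n hn n' hn' he
    have h1 := (Finset.mem_filter.1 hn).2
    have h2 := (Finset.mem_filter.1 hn').2
    rcases le_total n n' with h | h
    · exact key n n' h1 h2 h he
    · exact (key n' n h2 h1 h he.symm).symm
  rw [← Finset.sum_image (f := b) hinj]
  exact hb.sum_le_tsum _ fun n _ => hb0 n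

theorem FollowsUpdates.param_mem (hω : S.FollowsUpdates γ ε ω) (h0 : (ω 0).2.2.1 = 0) {n j : ℕ}
    (hj : j ≤ n) (hν : (ω j).2.2.1 ≠ 0) : (ω j).1.2 ∈ Sum.inl '' S.K (ω n).2.1 := by
  have hmono : Monotone S.K := monotone_nat_of_le_succ fun j =>
    (S.K_subset j).trans interior_subset
  rcases j with _ | i
  · exact absurd h0 hν
  · rcases hω.accepted_or i with ⟨⟨a, b, -, hb, -, hK⟩, -⟩ | h1
    · exact ⟨b, hmono ((hω.monotone_kap (Nat.le_succ i)).trans (hω.monotone_kap hj)) hK, hb.symm⟩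
    · exact absurd h1.2 hν

end Runs

/-! ### The noise within a block -/

/-- The truncated noise of the algorithm, while the truncation index is `m`. -/
noncomputable def blockNoise (S : Scheme 𝒳 Θ) (γ : ℕ → ℝ) (V : Set Θ) (e : ℝ) (m : ℕ)
    (r : S.State × S.State) : EuclideanSpace ℝ (Fin d) :=
  if r.1.2.1 = m then S.truncNoise V e (γ r.1.2.2.2) r.2.1.1 (S.start r.1).2 else 0

theorem measurable_blockNoise (S : Scheme 𝒳 Θ) (γ : ℕ → ℝ) {V : Set Θ} (hV : MeasurableSet V)
    (e : ℝ) (m : ℕ) : Measurable (S.blockNoise γ V e m) := by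
  have hc : Measurable fun r : S.State × S.State => r.1.2.1 := by fun_prop
  refine Measurable.ite (hc (measurableSet_singleton m)) ?_ measurable_const
  have h1 : Measurable fun r : S.State × S.State => γ r.1.2.2.2 :=
    (measurable_of_countable fun c : ℕ × ℕ × ℕ => γ c.2.2).comp
      (measurable_snd.comp measurable_fst)
  have h2 : Measurable fun r : S.State × S.State => (S.start r.1).2 :=
    measurable_snd.comp (S.measurable_start.comp measurable_fst)
  exact (S.measurable_truncNoise hV e).comp
    (f := fun r : S.State × S.State => ((γ r.1.2.2.2, r.2.1.1), (S.start r.1).2)) (by fun_prop)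

theorem measurable_update_move (S : Scheme 𝒳 Θ) (γ ε : ℕ → ℝ) (z : S.State) :
    Measurable fun y => S.update ε z (y, S.move (γ z.2.2.2) y (S.start z).2) :=
  (S.measurable_update_right ε z).comp (S.measurable_prodMk_move _ _)

/-- The noise is restricted to one value of κ because the step index can go back at truncations;
within a block no index is repeated, so the total variance is bounded by a multiple of ∑ (γ² + γ^p).
-/
theorem ae_tendsto_blockNoise {V : Set Θ} {p M : ℝ} (hm : S.MomentLE V p M) (hM0 : 0 ≤ M)
    (hp : 1 ≤ p) (hV : MeasurableSet V) (hγ : ∀ n, 0 < γ n)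
    (hs : Summable fun n => γ n ^ 2 + γ n ^ p) {e : ℝ} (he : 0 < e) (m : ℕ) (x : 𝒳) (θ : Θ) :
    ∀ᵐ ω ∂(S.algLaw γ ε x θ), ∃ l, Tendsto (fun N => ∑ n ∈ Finset.range N,
      S.blockNoise γ V e m (ω n, ω (n + 1))) atTop (𝓝 l) := by
  have he2 : 0 ≤ e ^ (2 - p) := by positivity
  set b : ℕ → ℝ := fun n => γ n ^ 2 + γ n ^ p with hb
  have hb0 : ∀ n, 0 ≤ b n := fun n => add_nonneg (sq_nonneg _) (Real.rpow_nonneg (hγ n).le _)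
  set c : ℝ := (1 + e ^ (2 - p)) * (1 + M) with hc
  have hc0 : 0 ≤ c := by positivity
  have hgm := S.measurable_blockNoise γ hV e m
  refine ae_exists_tendsto_sum_chainLaw (fun _ => S.algKernel γ ε) ((x, Sum.inl θ), 0, 0, 0)
    (g := fun _ => S.blockNoise γ V e m) (c := (c * ∑' n, b n).toNNReal)
    (fun _ => hgm) (fun _ => ⟨2 * e, fun r => ?_⟩) (fun _ z => ?_) fun N => ?_
  · unfold blockNoise
    split_ifs
    · exact S.norm_truncNoise_le he.le _ _ _ _
    · simpa using he.le
  · have hgx : Measurable fun y => S.blockNoise γ V e m (z, y) := hgm.comp measurable_prodMk_left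
    rw [algKernel_apply, integral_map (S.measurable_update_move γ ε z).aemeasurable
      hgx.aestronglyMeasurable]
    by_cases hz : z.2.1 = m
    · simp only [blockNoise, hz, if_true, update_fst]
      exact S.integral_truncNoise he.le V _ _
    · simp [blockNoise, hz]
  · have hbm : ∀ n, Measurable fun ω : ℕ → S.State =>
        ENNReal.ofReal (c * if (ω n).2.1 = m then b (ω n).2.2.2 else 0) := fun n =>
      (measurable_of_countable fun k : ℕ × ℕ × ℕ =>
        ENNReal.ofReal (c * if k.1 = m then b k.2.2 else 0)).comp
        (measurable_snd.comp (measurable_pi_apply n))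
    have h1 : ∀ n, ∫⁻ ω, ‖S.blockNoise γ V e m (ω n, ω (n + 1))‖ₑ ^ 2
        ∂(chainLaw (fun _ => S.algKernel γ ε) ((x, Sum.inl θ), 0, 0, 0)) ≤
        ∫⁻ ω, ENNReal.ofReal (c * if (ω n).2.1 = m then b (ω n).2.2.2 else 0)
          ∂(S.algLaw γ ε x θ) := by
      intro n
      rw [lintegral_chainLaw (fun _ => S.algKernel γ ε) ((x, Sum.inl θ), 0, 0, 0)
        (f := fun r => ‖S.blockNoise γ V e m r‖ₑ ^ 2) (hgm.enorm.pow_const 2)]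
      refine lintegral_mono fun ω => ?_
      have hgx : Measurable fun y => ‖S.blockNoise γ V e m (ω n, y)‖ₑ ^ 2 :=
        (hgm.enorm.pow_const 2).comp measurable_prodMk_left
      rw [algKernel_apply, lintegral_map hgx (S.measurable_update_move γ ε _)]
      by_cases hz : (ω n).2.1 = m
      · simp only [blockNoise, hz, if_true, update_fst]
        exact hm.lintegral_sample_truncNoise_sq_le hp he (hγ _).le _
      · simp [blockNoise, hz]
    refine (Finset.sum_le_sum fun n _ => h1 n).trans ?_
    rw [← lintegral_finsetSum _ fun n _ => hbm n]
    have h2 : ∀ᵐ ω ∂(S.algLaw γ ε x θ), ∑ n ∈ Finset.range N,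
        ENNReal.ofReal (c * if (ω n).2.1 = m then b (ω n).2.2.2 else 0) ≤
        ENNReal.ofReal (c * ∑' n, b n) := by
      filter_upwards [S.ae_update γ ε x θ] with ω hω
      have hω' : S.FollowsUpdates γ ε ω := hω
      rw [← ENNReal.ofReal_sum_of_nonneg, ← Finset.mul_sum]
      · exact ENNReal.ofReal_le_ofReal
          (mul_le_mul_of_nonneg_left (hω'.sum_block_le hs hb0 m N) hc0)
      · intro n _
        refine mul_nonneg hc0 ?_
        split_ifs
        · exact hb0 _
        · exact le_rfl
    have : IsProbabilityMeasure (S.algLaw γ ε x θ) := by unfold algLaw; infer_instance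
    exact (lintegral_mono_ae h2).trans (by simp [ENNReal.ofReal])

/-! ### Convergence -/

/-- Deterministic convergence of the mean-field recursion in a compact set, with cumulated noise
that converges. -/
theorem Lyapunov.tendsto_infEDist {w : EuclideanSpace ℝ (Fin d) → ℝ} {M₀ M₁ : ℝ}
    (hw : S.Lyapunov w M₀ M₁) {K : Set Θ} (hK : IsCompact K) {u : ℕ → Θ} (hu : ∀ n, u n ∈ K)
    {a : ℕ → ℝ} {ξ : ℕ → EuclideanSpace ℝ (Fin d)} {l : EuclideanSpace ℝ (Fin d)}
    (hrec : ∀ n, (u (n + 1) : EuclideanSpace ℝ (Fin d)) = u n + a n • S.h (u n) + ξ n)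
    (hξ : Tendsto (fun N => ∑ n ∈ Finset.range N, ξ n) atTop (𝓝 l)) (ha0 : ∀ n, 0 ≤ a n)
    (ha : Tendsto a atTop (𝓝 0)) (hsum : ¬ Summable a) :
    Tendsto (fun n => Metric.infEDist (u n) (S.critSet w)) atTop (𝓝 0) := by
  -- Adding the noise still to come gives a sequence that is driven by the drift alone and is
  -- asymptotic to u.
  set v : ℕ → EuclideanSpace ℝ (Fin d) := fun N => u N + (l - ∑ n ∈ Finset.range N, ξ n) with hv
  have huv : Tendsto (fun n => (u n : EuclideanSpace ℝ (Fin d)) - v n) atTop (𝓝 0) := by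
    have h1 : Tendsto (fun N => ∑ n ∈ Finset.range N, ξ n - l) atTop (𝓝 0) := by
      simpa using hξ.sub_const l
    refine h1.congr fun N => ?_
    simp only [hv]; abel
  have hvrec : ∀ n, v (n + 1) = v n + a n • S.meanField (u n) := by
    intro n
    simp only [hv, hrec, Finset.sum_range_succ, meanField_coe]
    abel
  have himage : w '' {y ∈ Θ | ⟪S.meanField y, gradient w y⟫ = 0} =
      (fun θ : Θ => w θ) '' S.critSet w := by
    ext t
    constructor
    · rintro ⟨y, ⟨hy, h0⟩, rfl⟩
      refine ⟨⟨y, hy⟩, ?_, rfl⟩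
      have h1 := S.meanField_coe ⟨y, hy⟩
      simp only at h1
      rw [h1] at h0
      exact h0
    · rintro ⟨θ, h0, rfl⟩
      exact ⟨θ, ⟨θ.2, by rw [meanField_coe]; exact h0⟩, rfl⟩
  have hKE : IsCompact (((↑) : Θ → EuclideanSpace ℝ (Fin d)) '' K) :=
    hK.image continuous_subtype_val
  obtain ⟨b, hb⟩ := exists_tendsto_lyapunov S.isOpen hw.continuousOn_meanField hw.contDiffOn
    (fun y hy h => hw.inner_neg hy h) (by rw [himage]; exact hw.interior_empty) hKE
    (by rintro _ ⟨θ, -, rfl⟩; exact θ.2) (u := fun n => (u n : EuclideanSpace ℝ (Fin d)))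
    (fun n => ⟨u n, hu n, rfl⟩) huv hvrec ha0 ha
  rw [ENNReal.tendsto_nhds_zero]
  by_contra hcon
  push Not at hcon
  obtain ⟨η, hη, hfreq⟩ := hcon
  -- If u is at distance at least η from the critical set infinitely often, compactness gives a
  -- cluster point at that distance, hence a noncritical one.
  have hfreq' : ∃ᶠ n in atTop, u n ∈ K ∩ {θ | η ≤ Metric.infEDist θ (S.critSet w)} := by
    refine hfreq.mono fun n hn => ⟨hu n, ?_⟩
    exact hn.le
  have hcl : IsClosed {θ | η ≤ Metric.infEDist θ (S.critSet w)} :=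
    isClosed_le continuous_const Metric.continuous_infEDist
  obtain ⟨y, ⟨-, hy⟩, hmap⟩ := (hK.inter_right hcl).exists_mapClusterPt_of_frequently hfreq'
  have hycrit : y ∉ S.critSet w := by
    intro h
    have h1 : η ≤ 0 := by
      rw [← Metric.infEDist_zero_of_mem h]
      exact hy
    exact absurd hη (not_lt.2 h1)
  have hneg : ⟪S.meanField y, gradient w y⟫ < 0 := by
    rw [meanField_coe]; exact hw.neg y hycrit
  exact not_mapClusterPt_of_lt S.isOpen hw.continuousOn_meanField hw.contDiffOn huv hvrec ha0 ha
    hsum hb y.2 hneg (hmap.continuousAt_comp continuous_subtype_val.continuousAt)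

/-- After the last truncation the run is a mean-field recursion in a compact set; its noise is the
convergent cut-off noise minus a summable bias. -/
theorem FollowsUpdates.tendsto_distTo {ω : ℕ → S.State} (hω : S.FollowsUpdates γ ε ω)
    {w : EuclideanSpace ℝ (Fin d) → ℝ} {M₀ M₁ : ℝ} (hw : S.Lyapunov w M₀ M₁)
    {m N : ℕ} (hkap : ∀ n ≥ N, (ω n).2.1 = m) {p M : ℝ} (hm : S.MomentLE (S.K m) p M)
    (hp : 1 ≤ p) (hγ : ∀ n, 0 < γ n) (hγ_zero : Tendsto γ atTop (𝓝 0))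
    (hs : Summable fun n => γ n ^ 2 + γ n ^ p) (hns : ¬ Summable γ)
    {e : ℝ} (he : 0 < e) (hεe : ∀ n, ε n ≤ e) {l : EuclideanSpace ℝ (Fin d)}
    (hl : Tendsto (fun N => ∑ n ∈ Finset.range N, S.blockNoise γ (S.K m) e m (ω n, ω (n + 1)))
      atTop (𝓝 l)) :
    Tendsto (fun n => distTo (S.critSet w) (S.param n ω)) atTop (𝓝 0) := by
  have hacc : ∀ n ≥ N, Accepted (ε (ω n).2.2.2) (S.K m) (S.start (ω n)).2 (ω (n + 1)).1.2 ∧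
      (ω (n + 1)).2 = ((ω n).2.1, (ω n).2.2.1 + 1, (ω n).2.2.2 + 1) := by
    intro n hn
    have h1 := hω.accepted_of_kap_eq (n := n) ((hkap _ (by omega)).trans (hkap n hn).symm)
    rwa [hkap n hn] at h1 ⊢
  -- Time starts at N + 1 and not at N: the step from N may be a re-initialization, whereas from N +
  -- 1 on ν ≠ 0 and each step starts from the current point.
  have hex : ∀ i, ∃ θ ∈ S.K m, (ω (N + 1 + i)).1.2 = Sum.inl θ := by
    intro i
    obtain ⟨⟨a, b, -, hb, -, hbK⟩, -⟩ := hacc (N + i) (by omega)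
    exact ⟨b, hbK, by rw [← hb]; congr 3; omega⟩
  choose u huK hu using hex
  have hstart : ∀ i, S.start (ω (N + 1 + i)) = (ω (N + 1 + i)).1 := by
    intro i
    have h1 := (hacc (N + i) (by omega)).2
    have h2 : (ω (N + 1 + i)).2.2.1 ≠ 0 := by
      rw [show N + 1 + i = N + i + 1 by omega, h1]
      exact Nat.succ_ne_zero _
    exact if_neg h2
  set a : ℕ → ℝ := fun i => γ ((ω (N + 1)).2.2.2 + i) with ha
  have hζ : ∀ i, (ω (N + 1 + i)).2.2.2 = (ω (N + 1)).2.2.2 + i := fun i =>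
    hω.zeta_add ((hkap _ (by omega)).trans (hkap _ (by omega)).symm)
  have hmove : ∀ i, (u (i + 1) : EuclideanSpace ℝ (Fin d)) =
      u i + a i • S.H (ω (N + 1 + i + 1)).1.1 (u i) := by
    intro i
    have h1 := (hω (N + 1 + i)).2
    rw [hstart, hu i, hζ i] at h1
    have h2 : (ω (N + 1 + i + 1)).1.2 = Sum.inl (u (i + 1)) := hu (i + 1)
    rw [h2] at h1
    exact coe_of_move_eq_inl h1.symm
  -- Accepted moves are within the tolerance, hence below the cut-off, which therefore changes none
  -- of them.
  have hsmall : ∀ i, ‖a i • S.H (ω (N + 1 + i + 1)).1.1 (u i)‖ ≤ e := by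
    intro i
    obtain ⟨⟨a', b', ha', hb', hle, -⟩, -⟩ := hacc (N + 1 + i) (by omega)
    rw [hstart, hu i] at ha'
    have h2 : (ω (N + 1 + i + 1)).1.2 = Sum.inl (u (i + 1)) := hu (i + 1)
    rw [h2] at hb'
    rw [← Sum.inl_injective ha', ← Sum.inl_injective hb', hmove i, add_sub_cancel_left] at hle
    exact hle.trans (hεe _)
  set ξ : ℕ → EuclideanSpace ℝ (Fin d) := fun i =>
    a i • S.noise (ω (N + 1 + i + 1)).1.1 (Sum.inl (u i)) with hξ
  set bias : ℕ → EuclideanSpace ℝ (Fin d) := fun i =>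
    a i • S.h (u i) - ∫ y', trunc e (a i • S.H y' (u i)) ∂(S.P (u i)) with hbias
  have hg : ∀ i, S.blockNoise γ (S.K m) e m (ω (N + 1 + i), ω (N + 1 + i + 1)) = ξ i + bias i := by
    intro i
    simp only [blockNoise, hkap (N + 1 + i) (by omega), if_true, hstart, hu i, hζ i]
    exact truncNoise_eq (huK i) (hsmall i)
  have ha_pos : ∀ i, 0 ≤ a i := fun i => (hγ _).le
  have hbs : Summable bias := by
    have h1 : Summable fun i => γ ((ω (N + 1)).2.2.2 + i) ^ 2 + γ ((ω (N + 1)).2.2.2 + i) ^ p := by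
      have := (summable_nat_add_iff (ω (N + 1)).2.2.2).2 hs
      simpa only [add_comm] using this
    refine Summable.of_norm_bounded (h1.mul_left (e ^ (1 - p) * |M|)) fun i => ?_
    rw [hbias, norm_sub_rev]
    refine (hm.norm_integral_trunc_sub_le hp he (ha_pos i) (huK i) (hw.integrable _)).trans ?_
    have h2 : 0 ≤ a i ^ p := Real.rpow_nonneg (ha_pos i) _
    have h3 : 0 ≤ e ^ (1 - p) := by positivity
    gcongr
    · exact le_abs_self M
    · change a i ^ p ≤ a i ^ 2 + a i ^ p
      linarith [sq_nonneg (a i)]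
  have hξt : Tendsto (fun I => ∑ i ∈ Finset.range I, ξ i) atTop
      (𝓝 (l - ∑ n ∈ Finset.range (N + 1), S.blockNoise γ (S.K m) e m (ω n, ω (n + 1)) -
        ∑' i, bias i)) := by
    have h1 := (hl.comp (tendsto_add_atTop_nat (N + 1))).sub_const
      (∑ n ∈ Finset.range (N + 1), S.blockNoise γ (S.K m) e m (ω n, ω (n + 1)))
    refine (h1.sub hbs.hasSum.tendsto_sum_nat).congr fun I => ?_
    simp only [Function.comp]
    rw [add_comm I, Finset.sum_range_add, add_sub_cancel_left, ← Finset.sum_sub_distrib]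
    refine Finset.sum_congr rfl fun i _ => ?_
    rw [hg i, add_sub_cancel_right]
  have hat : Tendsto a atTop (𝓝 0) := by
    have := (tendsto_add_atTop_iff_nat (ω (N + 1)).2.2.2).2 hγ_zero
    simpa only [ha, add_comm] using this
  have hans : ¬ Summable a := by
    intro h
    refine hns ((summable_nat_add_iff (ω (N + 1)).2.2.2).1 ?_)
    simpa only [ha, add_comm] using h
  have hfin := hw.tendsto_infEDist (S.K_compact m) huK (a := a) (ξ := ξ) (fun i => by
    rw [hmove i, hξ]
    simp only [noise, smul_sub]
    abel) hξt ha_pos hat hans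
  refine (tendsto_add_atTop_iff_nat (N + 1)).1 (hfin.congr fun i => ?_)
  unfold param
  rw [add_comm i, hu i]
  rfl

/-- Small distance excludes the cemetery point, which is at distance ⊤ from every subset of Θ. -/
theorem tendsto_param_of_distTo {L : Set Θ} {θ' : Θ} (hL : L = {θ'}) {f : ℕ → Bar Θ}
    (h : Tendsto (fun n => distTo L (f n)) atTop (𝓝 0)) : Tendsto f atTop (𝓝 (Sum.inl θ')) := by
  subst hL
  rw [tendsto_nhds]
  intro U hU hmem
  have h1 : (Sum.inl ⁻¹' U : Set Θ) ∈ 𝓝 θ' := (hU.preimage continuous_inl).mem_nhds hmem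
  obtain ⟨r, hr, hsub⟩ := EMetric.mem_nhds_iff.1 h1
  filter_upwards [h.eventually (gt_mem_nhds hr)] with n hn
  rcases hf : f n with θ | u
  · rw [hf] at hn
    have h2 : edist θ θ' < r := by simpa [distTo] using hn
    simpa [hf] using hsub h2
  · rw [hf] at hn
    simp [distTo] at hn

end Scheme

end AdaptiveTruncation

namespace AdaptiveTruncation

namespace Scheme

variable {𝒳 : Type*} [MeasurableSpace 𝒳] {d : ℕ} {Θ : Set (EuclideanSpace ℝ (Fin d))}
  {S : Scheme 𝒳 Θ} {γ ε : ℕ → ℝ}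

instance (S : Scheme 𝒳 Θ) (γ ε : ℕ → ℝ) (x : 𝒳) (θ : Θ) :
    IsProbabilityMeasure (S.algLaw γ ε x θ) := by
  unfold algLaw; infer_instance

theorem sublevel_mono (Θ : Set (EuclideanSpace ℝ (Fin d))) (w : EuclideanSpace ℝ (Fin d) → ℝ) :
    Monotone (sublevel Θ w) := fun _ _ h _ hθ => le_trans (α := ℝ) hθ h

/-- The event that the truncation index reaches `j`. -/
def kapEvent (S : Scheme 𝒳 Θ) (j : ℕ) : Set (ℕ → S.State) :=
  {ω | (j : ℕ∞) ≤ ⨆ k : ℕ, ⨆ _ : 1 ≤ k, (S.kap k ω : ℕ∞)}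

/-! ### Tails of the number of truncations and almost sure convergence -/

section Geometric

variable {w : EuclideanSpace ℝ (Fin d) → ℝ} {M₀ M₁ : ℝ}

/-- The number of truncations has geometric tails of every ratio. -/
theorem Lyapunov.exists_algLaw_kapEvent_le (hw : S.Lyapunov w M₀ M₁)
    (hγ_pos : ∀ n, 0 < γ n) (hε_pos : ∀ n, 0 < ε n) (hε_anti : Antitone ε)
    (hγ_zero : Tendsto γ atTop (𝓝 0)) (hK₀ : S.K 0 ⊆ sublevel Θ w M₀) {p : ℝ} {W : 𝒳 → ℝ}
    (hW : S.MomentBound p W) (hs : StepSizes p γ ε) {ρ : ℝ} (hρ0 : 0 < ρ) (hρ1 : ρ < 1) :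
    ∃ C : ℝ≥0, ∀ x θ, ∀ j : ℕ,
      S.algLaw γ ε x θ (S.kapEvent j) ≤ C * ENNReal.ofReal ρ ^ j := by
  have hM01 := hw.M₀_lt_M₁
  -- Any level strictly between M₀ and M₁ would do; it does not appear in the conclusion.
  obtain ⟨δ, hδ, hst⟩ := hw.exists_stableRec (M := (M₀ + M₁) / 2) (by linarith)
  have hM : M₀ ≤ (M₀ + M₁) / 2 := by linarith
  have hM' : (M₀ + M₁) / 2 ≤ M₁ := by linarith
  have hlim := hW.tendsto_A hs hγ_pos hε_pos hε_anti hw.integrable (hw.isCompact_sublevel hM')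
    (hK₀.trans (sublevel_mono Θ w hM)) hδ
  obtain ⟨n, hn⟩ := eventually_atTop.1
    (hlim.eventually (ge_mem_nhds (ENNReal.ofReal_pos.2 hρ0)))
  obtain ⟨m, hm⟩ := S.algLaw_le_A_pow hγ_pos hγ_zero hw hK₀ hst hδ.le hδ hM hM' (ε := ε) n
  have hsup : (⨆ k : ℕ, ⨆ _ : n ≤ k, S.A δ (sublevel Θ w ((M₀ + M₁) / 2)) (shift γ k) (shift ε k))
      ≤ ENNReal.ofReal ρ := iSup₂_le hn
  set r : ℝ≥0∞ := ENNReal.ofReal ρ with hr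
  have hr0 : r ≠ 0 := (ENNReal.ofReal_pos.2 hρ0).ne'
  have hrt : r ≠ ⊤ := ENNReal.ofReal_ne_top
  have hr1 : r ≤ 1 := by simpa [hr] using hρ1.le
  have hm0 : r ^ m ≠ 0 := pow_ne_zero _ hr0
  have hmt : r ^ m ≠ ⊤ := ENNReal.pow_ne_top hrt
  -- The constant ρ^(-m) compensates for the m blocks without a bound and makes the claim trivial
  -- for j < m.
  refine ⟨((r ^ m)⁻¹).toNNReal, fun x θ j => ?_⟩
  rw [ENNReal.coe_toNNReal (ENNReal.inv_ne_top.2 hm0)]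
  rcases le_or_gt m j with hj | hj
  · refine (hm x θ j hj).trans ((pow_le_pow_left' hsup _).trans_eq ?_)
    obtain ⟨i, rfl⟩ := Nat.exists_eq_add_of_le hj
    rw [Nat.add_sub_cancel_left, pow_add, ← mul_assoc, ENNReal.inv_mul_cancel hm0 hmt, one_mul]
  · refine prob_le_one.trans ?_
    rw [← ENNReal.inv_mul_cancel hm0 hmt]
    gcongr 1
    exact pow_le_pow_right_of_le_one' hr1 hj.le

theorem Lyapunov.exists_algLaw_kapEvent_le_A (hw : S.Lyapunov w M₀ M₁)
    (hγ_pos : ∀ n, 0 < γ n) (hγ_zero : Tendsto γ atTop (𝓝 0))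
    (hK₀ : S.K 0 ⊆ sublevel Θ w M₀) {M : ℝ} (hM : M₀ < M) (hM₁ : M < M₁) :
    ∃ δ₀ : ℝ, 0 < δ₀ ∧ ∀ n : ℕ, ∃ n₀ : ℕ, ∃ C : ℝ≥0, 0 < C ∧ ∀ x θ, ∀ j > n₀,
      S.algLaw γ ε x θ (S.kapEvent j) ≤
        C * (⨆ k : ℕ, ⨆ _ : n ≤ k, S.A δ₀ (sublevel Θ w M) (shift γ k) (shift ε k)) ^ j := by
  obtain ⟨δ, hδ, hst⟩ := hw.exists_stableRec hM
  refine ⟨δ, hδ, fun n => ?_⟩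
  obtain ⟨m, hm⟩ := S.algLaw_le_A_pow hγ_pos hγ_zero hw hK₀ hst hδ.le hδ hM.le hM₁.le (ε := ε) n
  obtain ⟨C, hC, hCle⟩ := exists_pow_sub_le
    (⨆ k : ℕ, ⨆ _ : n ≤ k, S.A δ (sublevel Θ w M) (shift γ k) (shift ε k)) m
  exact ⟨m, C, hC, fun x θ j hj => (hm x θ j hj.le).trans (hCle j hj)⟩

/-- If all the quantities `A δ` with `δ > 0` vanish, then so does `A 0`. -/
theorem A_zero_eq_zero {V : Set Θ} (h : ∀ δ : ℝ, 0 < δ → S.A δ V γ ε = 0) :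
    S.A 0 V γ ε = 0 := by
  have h' : ∀ δ : ℝ, 0 < δ → ∀ q : 𝒳 × Bar Θ,
      S.pathLaw γ (S.Φ q)
        {ω | ENNReal.ofReal δ < ⨆ n : ℕ, ⨆ _ : 1 ≤ n, ‖S.partialSum γ ε V 1 n ω‖ₑ} = 0 ∧
      S.pathLaw γ (S.Φ q) {ω | jumpTime ε ω < exitTime V ω} = 0 := by
    intro δ hδ q
    have h1 := h δ hδ
    rw [A, ENNReal.iSup_eq_zero] at h1
    exact add_eq_zero.1 (h1 q)
  rw [A, ENNReal.iSup_eq_zero]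
  intro q
  rw [(h' 1 one_pos q).2, add_zero]
  refine measure_mono_null (t := ⋃ i : ℕ, {ω | ENNReal.ofReal (1 / ((i : ℝ) + 1)) <
    ⨆ n : ℕ, ⨆ _ : 1 ≤ n, ‖S.partialSum γ ε V 1 n ω‖ₑ}) ?_
    (measure_iUnion_null fun i => (h' _ (by positivity) q).1)
  intro ω hω
  have hlim : Tendsto (fun i : ℕ => ENNReal.ofReal (1 / ((i : ℝ) + 1))) atTop
      (𝓝 (ENNReal.ofReal 0)) :=
    (ENNReal.continuous_ofReal.tendsto _).comp tendsto_one_div_add_atTop_nhds_zero_nat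
  obtain ⟨i, hi⟩ := (hlim.eventually (gt_mem_nhds hω)).exists
  exact Set.mem_iUnion.2 ⟨i, hi⟩

/-- For M = M₀ stability tolerates no noise, so the bound comes from elsewhere. If the base B is
positive for some δ > 0, the tails of ratio r < min B 1 are already below it. If it vanishes for
every δ > 0, it vanishes for δ = 0 too, and stability with zero noise makes the probability zero. -/
theorem Lyapunov.exists_algLaw_kapEvent_le_A_of_stepSizes (hw : S.Lyapunov w M₀ M₁)
    (hγ_pos : ∀ n, 0 < γ n) (hε_pos : ∀ n, 0 < ε n) (hε_anti : Antitone ε)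
    (hγ_zero : Tendsto γ atTop (𝓝 0)) (hK₀ : S.K 0 ⊆ sublevel Θ w M₀) {p : ℝ} {W : 𝒳 → ℝ}
    (hW : S.MomentBound p W) (hs : StepSizes p γ ε) {M : ℝ} (hM : M₀ ≤ M) (hM₁ : M < M₁) (n : ℕ) :
    ∃ n₀ : ℕ, ∃ δ₀ : ℝ, 0 < δ₀ ∧ ∃ C : ℝ≥0, 0 < C ∧ ∀ x θ, ∀ j > n₀,
      S.algLaw γ ε x θ (S.kapEvent j) ≤
        C * (⨆ k : ℕ, ⨆ _ : n ≤ k, S.A δ₀ (sublevel Θ w M) (shift γ k) (shift ε k)) ^ j := by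
  by_cases hex : ∃ δ : ℝ, 0 < δ ∧
      (⨆ k : ℕ, ⨆ _ : n ≤ k, S.A δ (sublevel Θ w M) (shift γ k) (shift ε k)) ≠ 0
  · obtain ⟨δ, hδ, hB⟩ := hex
    set B := ⨆ k : ℕ, ⨆ _ : n ≤ k, S.A δ (sublevel Θ w M) (shift γ k) (shift ε k) with hBdef
    obtain ⟨r, hr0, hr⟩ := ENNReal.lt_iff_exists_nnreal_btwn.1
      (lt_min (pos_iff_ne_zero.2 hB) one_pos)
    have hr0' : (0 : ℝ) < r := by exact_mod_cast hr0
    have hr1 : (r : ℝ) < 1 := by exact_mod_cast hr.trans_le (min_le_right _ _)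
    obtain ⟨C, hC⟩ := hw.exists_algLaw_kapEvent_le hγ_pos hε_pos hε_anti hγ_zero hK₀ hW hs
      hr0' hr1
    -- `C + 1` because C itself may be zero.
    refine ⟨0, δ, hδ, C + 1, by positivity, fun x θ j _ => (hC x θ j).trans ?_⟩
    rw [ENNReal.ofReal_coe_nnreal]
    gcongr
    · exact le_self_add
    · exact (hr.trans_le (min_le_left _ _)).le
  · push Not at hex
    have hzero : (⨆ k : ℕ, ⨆ _ : n ≤ k, S.A 0 (sublevel Θ w M) (shift γ k) (shift ε k)) = 0 := by
      simp only [ENNReal.iSup_eq_zero] at hex ⊢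
      exact fun k hk => A_zero_eq_zero fun δ hδ => hex δ hδ k hk
    obtain ⟨lam, hlam, hst⟩ := hw.exists_stableRec_zero hM
    obtain ⟨m, hm⟩ := S.algLaw_le_A_pow hγ_pos hγ_zero hw hK₀ hst le_rfl hlam hM hM₁.le (ε := ε) n
    refine ⟨m, 1, one_pos, 1, one_pos, fun x θ j hj => (hm x θ j hj.le).trans ?_⟩
    rw [hzero, zero_pow (by omega)]
    exact zero_le

/-- Almost surely, there are finitely many truncations. -/
theorem ae_eventually_kap_eq {x : 𝒳} {θ : Θ} {C : ℝ≥0}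
    (hC : ∀ j : ℕ, S.algLaw γ ε x θ (S.kapEvent j) ≤ C * ENNReal.ofReal (1 / 2) ^ j) :
    ∀ᵐ ω ∂(S.algLaw γ ε x θ), ∃ m N : ℕ, ∀ n ≥ N, (ω n).2.1 = m := by
  have hnull : S.algLaw γ ε x θ (⋂ j, S.kapEvent j) = 0 := by
    have hhalf : ENNReal.ofReal (1 / 2) < 1 := by
      rw [ENNReal.ofReal_lt_one]; norm_num
    have hlim := ENNReal.Tendsto.const_mul (a := (C : ℝ≥0∞))
      (ENNReal.tendsto_pow_atTop_nhds_zero_of_lt_one hhalf) (Or.inr ENNReal.coe_ne_top)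
    rw [mul_zero] at hlim
    exact le_antisymm (ge_of_tendsto' hlim fun j =>
      (measure_mono (Set.iInter_subset _ j)).trans (hC j)) (zero_le)
  filter_upwards [S.ae_update γ ε x θ, measure_eq_zero_iff_ae_notMem.1 hnull] with ω hω hω'
  have hω : S.FollowsUpdates γ ε ω := hω
  obtain ⟨j, hj⟩ : ∃ j, ω ∉ S.kapEvent j := by simpa using hω'
  have hle : ∀ n, (ω n).2.1 ≤ j := by
    intro n
    by_contra hn
    refine hj (le_trans (b := (S.kap (n + 1) ω : ℕ∞)) ?_
      (le_iSup₂ (f := fun (k : ℕ) (_ : 1 ≤ k) => (S.kap k ω : ℕ∞)) (n + 1) (by omega)))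
    have h1 := hω.kap_le n
    unfold kap
    exact_mod_cast (not_le.1 hn).le.trans h1
  have hbdd : BddAbove (Set.range fun n => (ω n).2.1) := ⟨j, by rintro _ ⟨n, rfl⟩; exact hle n⟩
  obtain ⟨N, hN⟩ := Nat.sSup_mem (Set.range_nonempty fun n => (ω n).2.1) hbdd
  exact ⟨(ω N).2.1, N, fun n hn => le_antisymm
    ((le_csSup hbdd ⟨n, rfl⟩).trans_eq hN.symm) (hω.monotone_kap hn)⟩

/-- Almost surely, the parameters converge to the critical set. -/
theorem Lyapunov.ae_tendsto_distTo (hw : S.Lyapunov w M₀ M₁)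
    (hγ_pos : ∀ n, 0 < γ n) (hε_pos : ∀ n, 0 < ε n) (hε_anti : Antitone ε)
    (hγ_zero : Tendsto γ atTop (𝓝 0)) (hK₀ : S.K 0 ⊆ sublevel Θ w M₀) {p : ℝ} {W : 𝒳 → ℝ}
    (hW : S.MomentBound p W) (hs : StepSizes p γ ε) (x : 𝒳) (θ : Θ) :
    ∀ᵐ ω ∂(S.algLaw γ ε x θ),
      Tendsto (fun n => distTo (S.critSet w) (S.param n ω)) atTop (𝓝 0) := by
  have hp := hW.one_lt.le
  obtain ⟨C, hC⟩ := hw.exists_algLaw_kapEvent_le hγ_pos hε_pos hε_anti hγ_zero hK₀ hW hs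
    (ρ := 1 / 2) (by norm_num) (by norm_num)
  have hsq := hs.summable_sq_add (zero_le_one.trans hp) hγ_pos hε_pos hε_anti
  -- The index of the last block is random, so the noise must converge simultaneously for all of the
  -- countably many indices m.
  choose c hc0 hc using fun m => hW.exists_momentLE (S.K_compact m)
  have hnoise : ∀ᵐ ω ∂(S.algLaw γ ε x θ), ∀ m, ∃ l, Tendsto (fun N => ∑ n ∈ Finset.range N,
      S.blockNoise γ (S.K m) (ε 0) m (ω n, ω (n + 1))) atTop (𝓝 l) :=
    ae_all_iff.2 fun m => ae_tendsto_blockNoise (hc m) (hc0 m) hp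
      (S.K_compact m).isClosed.measurableSet hγ_pos hsq (hε_pos 0) m x θ
  filter_upwards [S.ae_update γ ε x θ, ae_eventually_kap_eq (hC x θ), hnoise] with ω hω hk hl
  have hω : S.FollowsUpdates γ ε ω := hω
  obtain ⟨m, N, hN⟩ := hk
  obtain ⟨l, hl⟩ := hl m
  exact hω.tendsto_distTo hw hN (hc m) hp hγ_pos hγ_zero hsq hs.not_summable (hε_pos 0)
    (fun n => hε_anti (Nat.zero_le n)) hl

theorem ae_param_mem (S : Scheme 𝒳 Θ) (γ ε : ℕ → ℝ) (x : 𝒳) (θ : Θ) :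
    ∀ᵐ ω ∂(S.algLaw γ ε x θ), ∀ n, ∀ j ≤ n, S.nu j ω ≠ 0 →
      S.param j ω ∈ Sum.inl '' S.K (S.kap n ω) := by
  have hν : Measurable fun z : S.State => z.2.2.1 :=
    measurable_fst.comp (measurable_snd.comp measurable_snd)
  have h0 : ∀ᵐ ω ∂(S.algLaw γ ε x θ), ω 0 ∈ (fun z : S.State => z.2.2.1) ⁻¹' {0} :=
    ae_chainLaw_zero _ _ (hν (measurableSet_singleton 0)) rfl
  filter_upwards [S.ae_update γ ε x θ, h0] with ω hω h0 n j hj hν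
  have hω : S.FollowsUpdates γ ε ω := hω
  exact hω.param_mem h0 hj hν

end Geometric

end Scheme

end AdaptiveTruncation

theorem proposition4p1 {𝒳 : Type*} [MeasurableSpace 𝒳] {d : ℕ}
    {Θ : Set (EuclideanSpace ℝ (Fin d))} (S : AdaptiveTruncation.Scheme 𝒳 Θ)
    (γ ε : ℕ → ℝ) (hγ_pos : ∀ n, 0 < γ n) (hε_pos : ∀ n, 0 < ε n)
    (hγ_anti : Antitone γ) (hε_anti : Antitone ε) (hγ_zero : Tendsto γ atTop (𝓝 0))
    (w : EuclideanSpace ℝ (Fin d) → ℝ) (M₀ M₁ : ℝ) (hw : S.Lyapunov w M₀ M₁)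
    (hK₀ : S.K 0 ⊆ AdaptiveTruncation.Scheme.sublevel Θ w M₀) :
    -- geometric bound, `M₀ < M < M₁`, with `δ₀` independent of `n`
    (∀ M, M₀ < M → M < M₁ → ∃ δ₀ : ℝ, 0 < δ₀ ∧ ∀ n : ℕ, ∃ n₀ : ℕ, ∃ C : ℝ≥0, 0 < C ∧
      ∀ x θ, ∀ j > n₀,
        S.algLaw γ ε x θ {ω | (j : ℕ∞) ≤ ⨆ k : ℕ, ⨆ _ : 1 ≤ k, (S.kap k ω : ℕ∞)} ≤
          C * (⨆ k : ℕ, ⨆ _ : n ≤ k,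
            S.A δ₀ (AdaptiveTruncation.Scheme.sublevel Θ w M) (AdaptiveTruncation.shift γ k)
              (AdaptiveTruncation.shift ε k)) ^ j) ∧
    ∀ (p : ℝ) (W : 𝒳 → ℝ), S.MomentBound p W → AdaptiveTruncation.Scheme.StepSizes p γ ε →
      -- geometric bound, `M₀ ≤ M < M₁`
      (∀ M, M₀ ≤ M → M < M₁ → ∀ n : ℕ, ∃ n₀ : ℕ, ∃ δ₀ : ℝ, 0 < δ₀ ∧ ∃ C : ℝ≥0, 0 < C ∧
        ∀ x θ, ∀ j > n₀,
          S.algLaw γ ε x θ {ω | (j : ℕ∞) ≤ ⨆ k : ℕ, ⨆ _ : 1 ≤ k, (S.kap k ω : ℕ∞)} ≤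
            C * (⨆ k : ℕ, ⨆ _ : n ≤ k,
              S.A δ₀ (AdaptiveTruncation.Scheme.sublevel Θ w M) (AdaptiveTruncation.shift γ k)
                (AdaptiveTruncation.shift ε k)) ^ j) ∧
      -- the base tends to zero
      (∀ M, M₀ ≤ M → M < M₁ → ∀ δ : ℝ, 0 < δ →
        Tendsto (fun k => S.A δ (AdaptiveTruncation.Scheme.sublevel Θ w M)
          (AdaptiveTruncation.shift γ k) (AdaptiveTruncation.shift ε k)) atTop (𝓝 0)) ∧
      -- almost sure convergence of the parameters
      (∀ x θ, ∀ᵐ ω ∂(S.algLaw γ ε x θ),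
        Tendsto (fun n => AdaptiveTruncation.distTo (S.critSet w) (S.param n ω)) atTop (𝓝 0)) ∧
      (∀ θ' : Θ, S.critSet w = {θ'} → ∀ x θ, ∀ᵐ ω ∂(S.algLaw γ ε x θ),
        Tendsto (fun n => S.param n ω) atTop (𝓝 (Sum.inl θ'))) ∧
      -- the truncation counter
      (∀ x θ, ∀ᵐ ω ∂(S.algLaw γ ε x θ), ∀ n, ∀ j ≤ n, S.nu j ω ≠ 0 →
        S.param j ω ∈ Sum.inl '' S.K (S.kap n ω)) ∧
      (∀ ρ : ℝ, 0 < ρ → ρ < 1 → ∃ C : ℝ≥0, ∀ x θ, ∀ j : ℕ,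
        S.algLaw γ ε x θ {ω | (j : ℕ∞) ≤ ⨆ k : ℕ, ⨆ _ : 1 ≤ k, (S.kap k ω : ℕ∞)} ≤
          C * ENNReal.ofReal ρ ^ j) := by
  refine ⟨fun M hM hM₁ => hw.exists_algLaw_kapEvent_le_A hγ_pos hγ_zero hK₀ hM hM₁,
    fun p W hW hs => ⟨fun M hM hM₁ n => hw.exists_algLaw_kapEvent_le_A_of_stepSizes hγ_pos hε_pos
      hε_anti hγ_zero hK₀ hW hs hM hM₁ n, fun M hM hM₁ δ hδ => ?_, ?_, ?_, ?_, ?_⟩⟩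
  · exact hW.tendsto_A hs hγ_pos hε_pos hε_anti hw.integrable (hw.isCompact_sublevel hM₁.le)
      (hK₀.trans (AdaptiveTruncation.Scheme.sublevel_mono Θ w hM)) hδ
  · exact hw.ae_tendsto_distTo hγ_pos hε_pos hε_anti hγ_zero hK₀ hW hs
  · intro θ' hL x θ
    filter_upwards [hw.ae_tendsto_distTo hγ_pos hε_pos hε_anti hγ_zero hK₀ hW hs x θ] with ω h
    exact AdaptiveTruncation.Scheme.tendsto_param_of_distTo hL h
  · exact S.ae_param_mem γ ε
  · exact fun ρ hρ0 hρ1 =>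
      hw.exists_algLaw_kapEvent_le hγ_pos hε_pos hε_anti hγ_zero hK₀ hW hs hρ0 hρ1
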